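/- **Setting.** In the stochastic block model $\mathrm{SBM}(n,p,q,k)$, with $n,k\ge 1$ and $0<q<p<1$, a set of $kn$ vertices is partitioned into $k$ hidden clusters of size exactly $n$; independently for each pair of vertices, the pair is an edge of the random graph $G$ with probability $p$ if both vertices lie in the same cluster and with probability $q$ otherwise. Write $m=kn^2p+k^2n^2q$ for the order of magnitude of the number of edges. In the $s$-space massively parallel computation (MPC) model, $M$ machines, each with a memory of $s$ words of $O(\log n)$ bits, compute in synchronous rounds; in every round each machine performs arbitrary (free, possibly randomized) local computation and then sends and receives at most $s$ words, to and from arbitrary machines. Initially the edges of $G$ are distributed arbitrarily over the machines, two words per edge; at the end the machines together output one of $k$ labels for every vertex. The total space is the number of words used by all machines together. **Theorem.** There is an absolute constant $C_0>0$ such that for every constant $c_0>0$ there are constants $a,b\in\mathbb N$ and $C_1,C_2,C_3>0$ for which the following holds. For all $n,k,s,M$ there is a randomized MPC algorithm, depending on $n,k,s,M$ only (not on $p$, $q$ or the hidden partition), such that whenever $n,k\ge 1$, $0<q<p<1$, $$\frac{p-q}{\sqrt p}\;\ge\; C_0\,k^{3/4}\,n^{-1/4}\,(\log n)^{1/4},\qquad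 s\ge\max\{2,\;c_0\log n\},$$ and the number $M$ of machines satisfies $S\le Ms\le 2S+s$, where $S=C_1\,m\,(\log (kn))^{b}=\tilde O(m)$, the algorithm uses at most $C_2\log_s n$ rounds and, for every hidden partition and every distribution of the edges over the machines (which may depend on the hidden partition and on $G$), with probability at least $1-C_3/n$ over $G$ and the random choices of the algorithm, it respects the model with words of at most $a\log_2 n$ bits, uses at most $S$ words of total space at every time, and outputs exactly the $k$ hidden clusters (up to renaming them). -/

import Mathlib

/-! ### The stochastic block model -/

namespace SBM

/-- A hidden partition of `k * n` vertices into `k` clusters, each of size exactly `n`;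
`σ v` is the name of the cluster of `v`. -/
def IsBalanced (n k : ℕ) (σ : Fin (k * n) → Fin k) : Prop :=
  ∀ c : Fin k, (Finset.univ.filter (fun v => σ v = c)).card = n

/-- The probability that the pair `u, v` is an edge. -/
noncomputable def edgeProb {N k : ℕ} (p q : ℝ) (σ : Fin N → Fin k) (u v : Fin N) : ℝ :=
  if σ u = σ v then p else q

open Classical in
/-- The probability that the stochastic block model with hidden partition `σ` generates the
graph `G`: the pairs `u < v` are edges independently of each other. -/
noncomputable def weight {N k : ℕ} (p q : ℝ) (σ : Fin N → Fin k)
    (G : SimpleGraph (Fin N)) : ℝ :=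
  ∏ e ∈ Finset.univ.filter (fun e : Fin N × Fin N => e.1 < e.2),
    if G.Adj e.1 e.2 then edgeProb p q σ e.1 e.2 else 1 - edgeProb p q σ e.1 e.2

/-- The order of magnitude `m = k n² p + k² n² q` of the number of edges. -/
noncomputable def edgeScale (n k : ℕ) (p q : ℝ) : ℝ :=
  (k : ℝ) * (n : ℝ) ^ 2 * p + (k : ℝ) ^ 2 * (n : ℝ) ^ 2 * q

end SBM

/-! ### Massively parallel computation -/

namespace MPC

/-- A randomized algorithm for `M` machines, which labels the vertices `0, …, N - 1` of a graph
with `k` labels. A memory content is a list of words, a word is a natural number (the number of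
words and their size are bounded in `MPC.Succeeds`).

In round `t`, machine `i` looks at its memory and at a fresh private random number, uniform in
`Fin (coinBound + 1)`, and computes, at no cost, the words that it keeps and the words that it
sends, each with its recipient. After the last round every machine computes from its memory a
list of pairs (vertex, label), its part of the output. -/
structure Algorithm (M N k : ℕ) where
  rounds : ℕ
  coinBound : ℕ
  step : ℕ → Fin M → List ℕ → Fin (coinBound + 1) → List ℕ × List (Fin M × ℕ)
  output : Fin M → List ℕ → List (Fin N × Fin k)

/-- The memory contents of all the machines. -/
abbrev Config (M : ℕ) := Fin M → List ℕ

namespace Algorithm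

variable {M N k : ℕ}

/-- The outcomes of all the private random numbers of a run: one for each round and machine. -/
abbrev Coins (A : Algorithm M N k) := Fin A.rounds → Fin M → Fin (A.coinBound + 1)

/-- The words that machine `i` sends in round `t`, with their recipients. -/
def sent (A : Algorithm M N k) (ω : A.Coins) (t : Fin A.rounds) (C : Config M) (i : Fin M) :
    List (Fin M × ℕ) :=
  (A.step t i (C i) (ω t i)).2

/-- The words that machine `i` receives in round `t`, ordered by sender. -/
def received (A : Algorithm M N k) (ω : A.Coins) (t : Fin A.rounds) (C : Config M) (i : Fin M) :
    List ℕ :=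
  (List.finRange M).flatMap fun j =>
    ((A.sent ω t C j).filter (fun x => x.1 = i)).map Prod.snd

/-- One synchronous round: the new memory consists of what is kept and what is received. -/
def next (A : Algorithm M N k) (ω : A.Coins) (t : Fin A.rounds) (C : Config M) : Config M :=
  fun i => (A.step t i (C i) (ω t i)).1 ++ A.received ω t C i

/-- The memory contents after `t` rounds (constant after the last round). -/
def config (A : Algorithm M N k) (ω : A.Coins) (C : Config M) : ℕ → Config M
  | 0 => C
  | t + 1 =>
    if h : t < A.rounds then A.next ω ⟨t, h⟩ (A.config ω C t) else A.config ω C t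

end Algorithm

/-- A distribution of edges over the machines. -/
abbrev Placement (M N : ℕ) := Fin M → List (Fin N × Fin N)

open Classical in
/-- `P` distributes the edges of `G` over machines with `s` words of memory: every edge lies on
exactly one machine, once, in one of its two orientations, and an edge occupies two words. -/
def IsPlacement {M N : ℕ} (s : ℕ) (G : SimpleGraph (Fin N)) (P : Placement M N) : Prop :=
  (∑ i, (((P i).map fun e => s(e.1, e.2) : List (Sym2 (Fin N))) : Multiset (Sym2 (Fin N)))) =
      G.edgeFinset.val ∧
    ∀ i, 2 * (P i).length ≤ s

/-- The initial memory: every machine holds the endpoints of its edges. -/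
def input {M N : ℕ} (P : Placement M N) : Config M :=
  fun i => (P i).flatMap fun e => [(e.1 : ℕ), (e.2 : ℕ)]

/-- The run with random numbers `ω` on the input `P` respects the model and its output is the
partition `σ`, up to a renaming of the clusters. Here a word is less than `W`, every machine has
a memory of `s` words and sends and receives at most `s` words per round, and the total
space used is at most `S` words. -/
structure Succeeds {M N k : ℕ} (A : Algorithm M N k) (W s : ℕ) (S : ℝ) (σ : Fin N → Fin k)
    (P : Placement M N) (ω : A.Coins) : Prop where
  /-- All the words in memory, among them all that have been received, have the right size. -/
  word_lt : ∀ t ≤ A.rounds, ∀ i, ∀ w ∈ A.config ω (input P) t i, w < W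
  /-- The local memory suffices (also for the received words, which are part of it). -/
  memory_le : ∀ t ≤ A.rounds, ∀ i, (A.config ω (input P) t i).length ≤ s
  /-- No machine sends more than `s` words in a round. -/
  sent_le : ∀ (t : Fin A.rounds) (i : Fin M),
    (A.sent ω t (A.config ω (input P) t) i).length ≤ s
  /-- The space used by all the machines together is at most `S` at every time. -/
  total_le : ∀ t ≤ A.rounds, ((∑ i, (A.config ω (input P) t i).length : ℕ) : ℝ) ≤ S
  /-- The output of a single machine fits into its memory. -/
  output_le : ∀ i, (A.output i (A.config ω (input P) A.rounds i)).length ≤ s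
  /-- The output assigns exactly one label to every vertex, and two vertices have the same label
  if and only if they belong to the same cluster. -/
  correct : ∃ ℓ : Fin N → Fin k,
    (∀ v c, (∃ i, (v, c) ∈ A.output i (A.config ω (input P) A.rounds i)) ↔ ℓ v = c) ∧
      ∀ u v, ℓ u = ℓ v ↔ σ u = σ v

open Classical in
/-- The probability, over the random graph `G` of the stochastic block model and the random
numbers of the algorithm, that the edges of `G` have been distributed over the machines (which is
impossible only if they do not fit into the memory) and the run on the input `D G` succeeds. -/
noncomputable def successProb {M N k : ℕ} (A : Algorithm M N k) (W s : ℕ) (S p q : ℝ)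
    (σ : Fin N → Fin k) (D : SimpleGraph (Fin N) → Placement M N) : ℝ :=
  ∑ G : SimpleGraph (Fin N), SBM.weight p q σ G *
    (((Finset.univ.filter fun ω : A.Coins =>
        IsPlacement s G (D G) ∧ Succeeds A W s S σ (D G) ω).card : ℝ) /
      (Fintype.card A.Coins : ℝ))

end MPC

set_option linter.unusedSectionVars false

/-! ### Random edges with independent uniform labels: independence and Chernoff bounds -/

namespace SBM
open Finset

/-! Two vertices of one cluster have, in expectation, about `(p - q) ^ 2 * n` more common neighbours
than two vertices of different clusters. Hence it suffices to count the common neighbours of every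
vertex `v` with a few random centres, provided that every cluster contains a centre, and to compare
these counts. About `k * log n` centres are needed. Counting in the whole graph for each of them
would cost `k` times too much space, so every edge is put at random into one of `k` subgraphs, and
the centre number `(g, j)` counts in the subgraph `j`. With `O(log n)` copies of each edge all
centres are served, and the space stays `Õ(m)`.

In a subgraph of density `1 / k` the gap between the two cases is `Δ = (p - q) ^ 2 * n / k ^ 2`, and
the variance is at most about `V = n * p ^ 2 / k`. Paths through different midpoints use disjoint
pairs, so a Chernoff bound applies, and `Δ ^ 2 ≥ C * V * log n` reads `(p - q) ^ 4 * n ≥ C * k ^ 3 *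
log n * p ^ 2`. This is the fourth power of the hypothesis (`SBM.signal_of_le`,
`SBM.prob_codeg_le`).

As `p` and `q` are unknown, the threshold comes from the data: `v` joins a centre if twice their
count is at least the sum of the largest and the smallest count of `v` (`MPC.same_iff`). The label
of `v` is the number of clusters whose first centre precedes the first centre of the cluster of `v`
(`MPC.rank_spec`).

The computation is a program for a grid of cells, one for each centre, vertex and part of a
neighbourhood; the parts are random and keep the load of a cell small. The program uses a bounded
number of tree sums with fan-out about `s ^ (1 / 20)`, hence `O(log n / log s)` rounds, and two
exchanges with neighbours that count the paths of length two (`MPC.exec_program`). Edges reach the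
grid through random groups of `O(log n)` edges, which are spread out, copied and shipped to both
endpoints (`MPC.runCells_four`). Machines merely host cells (`MPC.succeeds_cellAlgorithm`).

The adversary may place the edges depending on the graph. Every machine draws labels for all pairs,
and a pair uses the draw of the machine that holds it; for each fixed graph these labels are
independent and uniform (`MPC.equidistributed_labels`), so `MPC.le_successProb` reduces everything
to a random graph with independent labels. If one machine suffices, it searches for a balanced
partition given by a threshold on common neighbours, which is unique (`SBM.IsThreshold.eq_iff`). For
bounded `n` the claim is void. -/

/-- The probability that the unordered pair `e` is an edge. -/
noncomputable def pairProb {N k : ℕ} (p q : ℝ) (σ : Fin N → Fin k) : Sym2 (Fin N) → ℝ :=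
  Sym2.lift ⟨edgeProb p q σ, fun u v => by simp [edgeProb, eq_comm]⟩

@[simp] lemma pairProb_mk {N k : ℕ} (p q : ℝ) (σ : Fin N → Fin k) (u v : Fin N) :
    pairProb p q σ s(u, v) = edgeProb p q σ u v := rfl

lemma pairProb_nonneg {N k : ℕ} {p q : ℝ} (hq : 0 ≤ q) (hqp : q ≤ p) (σ : Fin N → Fin k)
    (e : Sym2 (Fin N)) : 0 ≤ pairProb p q σ e := by
  induction e with | _ u v => simp only [pairProb_mk, edgeProb]; split_ifs <;> linarith

lemma pairProb_le {N k : ℕ} {p q : ℝ} (hqp : q ≤ p) (σ : Fin N → Fin k)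
    (e : Sym2 (Fin N)) : pairProb p q σ e ≤ p := by
  induction e with | _ u v => simp only [pairProb_mk, edgeProb]; split_ifs <;> linarith

lemma weight_nonneg {N k : ℕ} {p q : ℝ} (hq : 0 ≤ q) (hqp : q ≤ p) (hp : p ≤ 1)
    (σ : Fin N → Fin k) (G : SimpleGraph (Fin N)) : 0 ≤ weight p q σ G := by
  classical
  refine prod_nonneg fun e _ => ?_
  simp only [edgeProb]
  split_ifs <;> linarith

open Classical in
lemma weight_eq_prod_sym2 {N k : ℕ} (p q : ℝ) (σ : Fin N → Fin k) (G : SimpleGraph (Fin N)) :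
    weight p q σ G = ∏ e : Sym2 (Fin N) with ¬ e.IsDiag,
      if e ∈ G.edgeFinset then pairProb p q σ e else 1 - pairProb p q σ e := by
  unfold weight
  symm
  have h : Finset.univ.filter (fun e : Fin N × Fin N => e.1 < e.2) =
      (Finset.univ : Finset (Fin N)).offDiag.filter (fun e => e.1 < e.2) := by
    ext e; simp only [mem_filter, mem_univ, true_and, mem_offDiag]
    exact ⟨fun h => ⟨h.ne, h⟩, fun h => h.2⟩
  rw [h, ← Finset.sym2_univ]
  -- The product over unordered pairs is read as a sum in `Additive ℝ`.
  refine (Finset.sum_sym2_filter_not_isDiag (M := Additive ℝ) univ (fun e => Additive.ofMul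
    (if e ∈ G.edgeFinset then pairProb p q σ e else 1 - pairProb p q σ e))).trans
    (b := ∏ e ∈ univ.offDiag with e.1 < e.2, if s(e.1, e.2) ∈ G.edgeFinset then
      pairProb p q σ s(e.1, e.2) else 1 - pairProb p q σ s(e.1, e.2)) ?_
  refine prod_congr rfl fun e _ => ?_
  simp [SimpleGraph.mem_edgeFinset]

open Classical in
/-- The probability that a given set of pairs consists of edges. -/
lemma sum_weight_subset {N k : ℕ} (p q : ℝ) (σ : Fin N → Fin k) (F : Finset (Sym2 (Fin N)))
    (hF : ∀ e ∈ F, ¬ e.IsDiag) :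
    ∑ G : SimpleGraph (Fin N), weight p q σ G * (if F ⊆ G.edgeFinset then 1 else 0) =
      ∏ e ∈ F, pairProb p q σ e := by
  set D : Finset (Sym2 (Fin N)) := Finset.univ.filter (fun e => ¬ e.IsDiag) with hD
  set a := pairProb p q σ
  -- With `b = 0` on `F`, the expansion of `∏ (a e + b e)` over subsets of `D` retains exactly the
  -- graphs that contain `F`, while outside `F` each factor is `1`.
  set b : Sym2 (Fin N) → ℝ := fun e => if e ∈ F then 0 else 1 - a e with hb
  have hFD : F ⊆ D := fun e he => by simp [hD, hF e he]
  have h1 : ∏ e ∈ D, (a e + b e) = ∏ e ∈ F, a e := by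
    rw [← prod_subset hFD]
    · exact prod_congr rfl fun e he => by simp [hb, he]
    · intro e _ he; simp [hb, he]
  rw [← h1, prod_add]
  refine sum_bij' (fun G _ => G.edgeFinset) (fun A _ => SimpleGraph.fromEdgeSet (A : Set _))
    ?_ ?_ ?_ ?_ ?_
  · intro G _
    rw [mem_powerset]
    intro e he
    simp only [hD, mem_filter, mem_univ, true_and]
    exact G.not_isDiag_of_mem_edgeFinset he
  · simp
  · intro G _; simp
  · intro A hA
    rw [mem_powerset] at hA
    ext e
    simp only [SimpleGraph.mem_edgeFinset, SimpleGraph.edgeSet_fromEdgeSet, Set.mem_sdiff, mem_coe]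
    constructor
    · exact fun h => h.1
    · intro h
      have := hA h
      simp only [hD, mem_filter] at this
      exact ⟨h, this.2⟩
  · intro G _
    have hsub : G.edgeFinset ⊆ D := fun e he => by
      simp only [hD, mem_filter, mem_univ, true_and]
      exact G.not_isDiag_of_mem_edgeFinset he
    have h2 : weight p q σ G = (∏ e ∈ G.edgeFinset, a e) * ∏ e ∈ D \ G.edgeFinset, (1 - a e) := by
      rw [weight_eq_prod_sym2, ← hD, prod_ite, filter_mem_eq_inter, inter_eq_right.2 hsub]
      congr 1
      refine prod_congr ?_ fun _ _ => rfl
      ext e; simp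
    rw [h2, mul_assoc]
    congr 1
    by_cases hFG : F ⊆ G.edgeFinset
    · rw [if_pos hFG, mul_one]
      refine prod_congr rfl fun e he => ?_
      have : e ∉ F := fun h => (mem_sdiff.1 he).2 (hFG h)
      simp [hb, this]
    · rw [if_neg hFG, mul_zero]
      obtain ⟨e, heF, heG⟩ := not_subset.1 hFG
      symm
      exact prod_eq_zero (mem_sdiff.2 ⟨hFD heF, heG⟩) (by simp [hb, heF])

lemma sum_weight {N k : ℕ} (p q : ℝ) (σ : Fin N → Fin k) :
    ∑ G : SimpleGraph (Fin N), weight p q σ G = 1 := by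
  classical
  simpa using sum_weight_subset p q σ ∅ (by simp)

variable {N k : ℕ} {Y : Type} [Fintype Y]

/-- The expectation of a function of the random graph and of independent uniform labels of the
pairs of vertices. -/
noncomputable def expect (p q : ℝ) (σ : Fin N → Fin k)
    (f : SimpleGraph (Fin N) → (Sym2 (Fin N) → Y) → ℝ) : ℝ :=
  ∑ G, weight p q σ G * ((∑ ℓ, f G ℓ) / Fintype.card (Sym2 (Fin N) → Y))

lemma expect_mono {p q : ℝ} (hq : 0 ≤ q) (hqp : q ≤ p) (hp : p ≤ 1) (σ : Fin N → Fin k)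
    {f g : SimpleGraph (Fin N) → (Sym2 (Fin N) → Y) → ℝ} (h : ∀ G ℓ, f G ℓ ≤ g G ℓ) :
    expect p q σ f ≤ expect p q σ g := by
  refine sum_le_sum fun G _ => mul_le_mul_of_nonneg_left ?_ (weight_nonneg hq hqp hp σ G)
  gcongr
  exact h _ _

lemma expect_sum {ι : Type*} (p q : ℝ) (σ : Fin N → Fin k) (s : Finset ι)
    (f : ι → SimpleGraph (Fin N) → (Sym2 (Fin N) → Y) → ℝ) :
    expect p q σ (fun G ℓ => ∑ i ∈ s, f i G ℓ) = ∑ i ∈ s, expect p q σ (f i) := by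
  unfold expect
  rw [sum_comm]
  refine sum_congr rfl fun G _ => ?_
  rw [sum_comm, sum_div, mul_sum]

lemma expect_const_mul (p q : ℝ) (σ : Fin N → Fin k) (c : ℝ)
    (f : SimpleGraph (Fin N) → (Sym2 (Fin N) → Y) → ℝ) :
    expect p q σ (fun G ℓ => c * f G ℓ) = c * expect p q σ f := by
  unfold expect
  rw [mul_sum]
  refine sum_congr rfl fun G _ => ?_
  rw [← mul_sum]; ring

open Classical in
/-- The indicator of the event that `e` is an edge with a label in `A`. -/
noncomputable def hit (A : Finset Y) (e : Sym2 (Fin N)) (G : SimpleGraph (Fin N))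
    (ℓ : Sym2 (Fin N) → Y) : ℝ :=
  if e ∈ G.edgeFinset ∧ ℓ e ∈ A then 1 else 0

open Classical in
lemma card_labels (F : Finset (Sym2 (Fin N))) (A : Finset Y) [Nonempty Y] :
    ((∑ ℓ : Sym2 (Fin N) → Y, if ∀ e ∈ F, ℓ e ∈ A then (1 : ℝ) else 0) /
      Fintype.card (Sym2 (Fin N) → Y)) = ∏ _e ∈ F, ((A.card : ℝ) / Fintype.card Y) := by
  have h1 : (∑ ℓ : Sym2 (Fin N) → Y, if ∀ e ∈ F, ℓ e ∈ A then (1 : ℝ) else 0) =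
      (Fintype.piFinset (fun e => if e ∈ F then A else Finset.univ)).card := by
    rw [sum_boole]
    congr 2
    ext ℓ
    simp only [mem_filter, mem_univ, true_and, Fintype.mem_piFinset]
    refine forall_congr' fun e => ?_
    by_cases he : e ∈ F <;> simp [he]
  rw [h1, Fintype.card_piFinset, Fintype.card_fun]
  have h2 : (Fintype.card Y : ℝ) ≠ 0 := by exact_mod_cast Fintype.card_ne_zero
  have h3 : ((Fintype.card Y : ℝ)) ^ Fintype.card (Sym2 (Fin N)) =
      ∏ _e : Sym2 (Fin N), (Fintype.card Y : ℝ) := by simp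
  push_cast
  rw [h3, ← prod_div_distrib, ← prod_subset (subset_univ F)]
  · exact prod_congr rfl fun e he => by simp [he]
  · intro e _ he; simp [he, h2]

lemma expect_prod_hit [Nonempty Y] (p q : ℝ) (σ : Fin N → Fin k) (F : Finset (Sym2 (Fin N)))
    (hF : ∀ e ∈ F, ¬ e.IsDiag) (A : Finset Y) :
    expect p q σ (fun G ℓ => ∏ e ∈ F, hit A e G ℓ) =
      ∏ e ∈ F, (pairProb p q σ e * ((A.card : ℝ) / Fintype.card Y)) := by
  classical
  rw [prod_mul_distrib, ← sum_weight_subset p q σ F hF, ← card_labels, sum_mul]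
  refine sum_congr rfl fun G _ => ?_
  rw [mul_assoc]
  congr 1
  rw [← mul_div_assoc, mul_sum]
  congr 1
  refine sum_congr rfl fun ℓ _ => ?_
  simp only [hit, prod_ite_zero, prod_const_one]
  by_cases h1 : F ⊆ G.edgeFinset
  · rw [if_pos h1, one_mul]
    refine if_congr ?_ rfl rfl
    exact ⟨fun h e he => (h e he).2, fun h e he => ⟨h1 he, h e he⟩⟩
  · rw [if_neg h1, zero_mul, if_neg]
    exact fun h => h1 fun e he => (h e he).1

/-- Products of indicators over disjoint sets of pairs are independent: the generating
function of their sum factorizes. -/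
lemma expect_prod_one_add [Nonempty Y] {ι : Type*} (p q : ℝ) (σ : Fin N → Fin k)
    (I : Finset ι) (F : ι → Finset (Sym2 (Fin N)))
    (hF : ∀ i ∈ I, ∀ e ∈ F i, ¬ e.IsDiag)
    (hdisj : (I : Set ι).PairwiseDisjoint F) (A : Finset Y) (y : ℝ) :
    expect p q σ (fun G ℓ => ∏ i ∈ I, (1 + y * ∏ e ∈ F i, hit A e G ℓ)) =
      ∏ i ∈ I, (1 + y * ∏ e ∈ F i, (pairProb p q σ e * ((A.card : ℝ) / Fintype.card Y))) := by
  classical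
  simp only [prod_one_add, expect_sum]
  refine sum_congr rfl fun J hJ => ?_
  rw [mem_powerset] at hJ
  simp only [prod_mul_distrib, prod_const]
  have hd : (J : Set ι).PairwiseDisjoint F := hdisj.subset (by exact_mod_cast hJ)
  rw [expect_const_mul]
  simp_rw [← prod_mul_distrib]
  simp_rw [← prod_biUnion hd]
  rw [expect_prod_hit]
  · rw [prod_biUnion hd]
    simp only [prod_mul_distrib, prod_const]
  · intro e he
    obtain ⟨i, hi, he⟩ := mem_biUnion.1 he
    exact hF i (hJ hi) e he

/-- The number of those `i` for which all pairs in `F i` are edges with a label in `A`. -/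
noncomputable def hits {ι : Type*} (I : Finset ι) (F : ι → Finset (Sym2 (Fin N)))
    (A : Finset Y) (G : SimpleGraph (Fin N)) (ℓ : Sym2 (Fin N) → Y) : ℝ :=
  ∑ i ∈ I, ∏ e ∈ F i, hit A e G ℓ

/-- Each product of indicators is `0` or `1`, and `exp (θ * x) = 1 + (exp θ - 1) * x` for such `x`.
-/
lemma exp_mul_hits {ι : Type*} (I : Finset ι) (F : ι → Finset (Sym2 (Fin N)))
    (A : Finset Y) (G : SimpleGraph (Fin N)) (ℓ : Sym2 (Fin N) → Y) (θ : ℝ) :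
    Real.exp (θ * hits I F A G ℓ) =
      ∏ i ∈ I, (1 + (Real.exp θ - 1) * ∏ e ∈ F i, hit A e G ℓ) := by
  classical
  rw [hits, mul_sum, Real.exp_sum]
  refine prod_congr rfl fun i _ => ?_
  simp only [hit, prod_ite_zero, prod_const_one]
  split_ifs <;> simp

/-- Disjointness of the sets `F i` factorizes the moment generating function, and `1 + x ≤ exp x`
bounds each factor. -/
lemma expect_exp_hits_le [Nonempty Y] {ι : Type*} {p q : ℝ} (hq : 0 ≤ q) (hqp : q ≤ p)
    (hp : p ≤ 1) (σ : Fin N → Fin k) (I : Finset ι) (F : ι → Finset (Sym2 (Fin N)))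
    (hF : ∀ i ∈ I, ∀ e ∈ F i, ¬ e.IsDiag)
    (hdisj : (I : Set ι).PairwiseDisjoint F) (A : Finset Y) (θ : ℝ) :
    expect p q σ (fun G ℓ => Real.exp (θ * hits I F A G ℓ)) ≤
      Real.exp ((Real.exp θ - 1) *
        ∑ i ∈ I, ∏ e ∈ F i, (pairProb p q σ e * ((A.card : ℝ) / Fintype.card Y))) := by
  simp_rw [exp_mul_hits]
  rw [expect_prod_one_add p q σ I F hF hdisj, mul_sum, Real.exp_sum]
  refine prod_le_prod (fun i _ => ?_) fun i _ => ?_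
  · have h1 : ∀ e ∈ F i, 0 ≤ pairProb p q σ e * ((A.card : ℝ) / Fintype.card Y) :=
      fun e _ => mul_nonneg (pairProb_nonneg hq hqp σ e) (by positivity)
    have h2 : ∀ e ∈ F i, pairProb p q σ e * ((A.card : ℝ) / Fintype.card Y) ≤ 1 := by
      intro e _
      refine mul_le_one₀ ((pairProb_le hqp σ e).trans hp) (by positivity) ?_
      refine div_le_one_of_le₀ ?_ (by positivity)
      exact_mod_cast card_le_univ A
    have h3 := prod_nonneg h1
    have h4 := prod_le_one h1 h2
    nlinarith [Real.exp_pos θ]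
  · rw [add_comm]; exact Real.add_one_le_exp _

open Classical in
/-- The probability of an event. -/
noncomputable def prob (p q : ℝ) (σ : Fin N → Fin k)
    (E : SimpleGraph (Fin N) → (Sym2 (Fin N) → Y) → Prop) : ℝ :=
  expect p q σ (fun G ℓ => if E G ℓ then 1 else 0)

/-- Markov's inequality for the exponential. The sign of `θ` is free, so that both tails are
covered. -/
lemma prob_le_of_exp [Nonempty Y] {ι : Type*} {p q : ℝ} (hq : 0 ≤ q) (hqp : q ≤ p)
    (hp : p ≤ 1) (σ : Fin N → Fin k) (I : Finset ι) (F : ι → Finset (Sym2 (Fin N)))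
    (hF : ∀ i ∈ I, ∀ e ∈ F i, ¬ e.IsDiag)
    (hdisj : (I : Set ι).PairwiseDisjoint F) (A : Finset Y) (θ x μ : ℝ)
    (hμ : ∑ i ∈ I, ∏ e ∈ F i, (pairProb p q σ e * ((A.card : ℝ) / Fintype.card Y)) = μ) :
    prob p q σ (fun G ℓ => x ≤ θ * hits I F A G ℓ) ≤ Real.exp ((Real.exp θ - 1) * μ - x) := by
  classical
  rw [← hμ, sub_eq_add_neg, Real.exp_add, mul_comm _ (Real.exp (-x))]
  refine le_trans ?_ (mul_le_mul_of_nonneg_left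
    (expect_exp_hits_le hq hqp hp σ I F hF hdisj A θ) (Real.exp_pos _).le)
  rw [← expect_const_mul]
  refine expect_mono hq hqp hp σ fun G ℓ => ?_
  split_ifs with h
  · rw [← Real.exp_add]; exact Real.one_le_exp (by linarith)
  · positivity

/-- Upper and lower Chernoff bounds. -/
lemma prob_dev_le [Nonempty Y] {ι : Type*} {p q : ℝ} (hq : 0 ≤ q) (hqp : q ≤ p)
    (hp : p ≤ 1) (σ : Fin N → Fin k) (I : Finset ι) (F : ι → Finset (Sym2 (Fin N)))
    (hF : ∀ i ∈ I, ∀ e ∈ F i, ¬ e.IsDiag)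
    (hdisj : (I : Set ι).PairwiseDisjoint F) (A : Finset Y) (μ V lam : ℝ)
    (hμ : ∑ i ∈ I, ∏ e ∈ F i, (pairProb p q σ e * ((A.card : ℝ) / Fintype.card Y)) = μ)
    (hμ0 : 0 ≤ μ) (hV : μ ≤ V) (hV0 : 0 < V) (hl : 0 ≤ lam) (hlV : lam ≤ 2 * V) :
    prob p q σ (fun G ℓ => μ + lam ≤ hits I F A G ℓ) ≤ Real.exp (-(lam ^ 2 / (4 * V))) ∧
    prob p q σ (fun G ℓ => hits I F A G ℓ ≤ μ - lam) ≤ Real.exp (-(lam ^ 2 / (4 * V))) := by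
  -- The minimizer of `θ ^ 2 * V - θ * lam`; the assumption `lam ≤ 2 * V` makes it at most `1`,
  -- where `exp θ ≤ 1 + θ + θ ^ 2`.
  set θ := lam / (2 * V) with hθ
  have hθ0 : 0 ≤ θ := by positivity
  have hθ1 : θ ≤ 1 := by rw [hθ, div_le_one (by positivity)]; exact hlV
  have hkey : θ ^ 2 * V - θ * lam = -(lam ^ 2 / (4 * V)) := by
    rw [hθ]; field_simp; ring
  -- For `lam = 0` one cannot divide by `θ`, but then the bounds are `1`.
  rcases eq_or_lt_of_le hl with h0 | hlpos
  · have h1 : ∀ E : SimpleGraph (Fin N) → (Sym2 (Fin N) → Y) → Prop, prob p q σ E ≤ 1 := by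
      classical
      intro E
      calc prob p q σ E ≤ expect p q σ (fun _ _ => 1) := by
            refine expect_mono hq hqp hp σ fun G ℓ => ?_
            split_ifs <;> norm_num
        _ = 1 := by
            have : (Fintype.card Y : ℝ) ≠ 0 := by exact_mod_cast Fintype.card_ne_zero
            simp [expect, sum_weight, this]
    rw [← h0]; simp only [ne_eq, OfNat.ofNat_ne_zero, not_false_eq_true, zero_pow, zero_div, neg_zero,
      Real.exp_zero]
    exact ⟨h1 _, h1 _⟩
  have hθpos : 0 < θ := by positivity
  constructor
  · have h := prob_le_of_exp hq hqp hp σ I F hF hdisj A θ (θ * (μ + lam)) μ hμ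
    have e1 : prob p q σ (fun G ℓ => μ + lam ≤ hits I F A G ℓ) =
        prob p q σ (fun G ℓ => θ * (μ + lam) ≤ θ * hits I F A G ℓ) := by
      congr 1; ext G ℓ; rw [mul_le_mul_iff_right₀ hθpos]
    rw [e1]
    refine h.trans (Real.exp_le_exp.2 ?_)
    have h2 := (abs_le.1 (Real.abs_exp_sub_one_sub_id_le (abs_le.2 ⟨by linarith, hθ1⟩))).2
    have h3 : (Real.exp θ - 1) * μ ≤ (θ + θ ^ 2) * μ :=
      mul_le_mul_of_nonneg_right (by linarith) hμ0
    nlinarith [mul_le_mul_of_nonneg_left hV (sq_nonneg θ)]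
  · have h := prob_le_of_exp hq hqp hp σ I F hF hdisj A (-θ) (-θ * (μ - lam)) μ hμ
    have e1 : prob p q σ (fun G ℓ => hits I F A G ℓ ≤ μ - lam) =
        prob p q σ (fun G ℓ => -θ * (μ - lam) ≤ -θ * hits I F A G ℓ) := by
      congr 1; ext G ℓ; rw [mul_le_mul_left_of_neg (by linarith)]
    rw [e1]
    refine h.trans (Real.exp_le_exp.2 ?_)
    have h2 := (abs_le.1 (Real.abs_exp_sub_one_sub_id_le (x := -θ)
      (abs_le.2 ⟨by linarith, by linarith⟩))).2
    have h3 : (Real.exp (-θ) - 1) * μ ≤ (-θ + θ ^ 2) * μ :=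
      mul_le_mul_of_nonneg_right (by nlinarith) hμ0
    nlinarith [mul_le_mul_of_nonneg_left hV (sq_nonneg θ)]

/-- A large deviation bound for a sum that exceeds its mean by a large factor. -/
lemma prob_large_le [Nonempty Y] {ι : Type*} {p q : ℝ} (hq : 0 ≤ q) (hqp : q ≤ p)
    (hp : p ≤ 1) (σ : Fin N → Fin k) (I : Finset ι) (F : ι → Finset (Sym2 (Fin N)))
    (hF : ∀ i ∈ I, ∀ e ∈ F i, ¬ e.IsDiag)
    (hdisj : (I : Set ι).PairwiseDisjoint F) (A : Finset Y) (y K : ℝ)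
    (hμ : Real.exp y * ∑ i ∈ I, ∏ e ∈ F i, (pairProb p q σ e *
      ((A.card : ℝ) / Fintype.card Y)) ≤ K) (hy : 0 < y) :
    prob p q σ (fun G ℓ => K ≤ hits I F A G ℓ) ≤ Real.exp (-((y - 1) * K)) := by
  set μ := ∑ i ∈ I, ∏ e ∈ F i, (pairProb p q σ e * ((A.card : ℝ) / Fintype.card Y)) with hm
  have hμ0 : 0 ≤ μ := sum_nonneg fun i _ => prod_nonneg fun e _ =>
    mul_nonneg (pairProb_nonneg hq hqp σ e) (by positivity)
  have h := prob_le_of_exp hq hqp hp σ I F hF hdisj A y (y * K) μ hm.symm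
  have e1 : prob p q σ (fun G ℓ => K ≤ hits I F A G ℓ) =
      prob p q σ (fun G ℓ => y * K ≤ y * hits I F A G ℓ) := by
    congr 1; ext G ℓ; rw [mul_le_mul_iff_right₀ hy]
  rw [e1]
  exact h.trans (Real.exp_le_exp.2 (by nlinarith))

end SBM

/-! ### Concentration of common neighbours, edge numbers and degrees in the block model -/

namespace SBM
open Finset

section Means
variable {n k : ℕ} {σ : Fin (k * n) → Fin k}

lemma IsBalanced.sum_ite (hσ : IsBalanced n k σ) (c : Fin k) (x : ℝ) :
    ∑ w, (if σ w = c then x else 0) = n * x := by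
  rw [← sum_filter, sum_const, hσ c, nsmul_eq_mul]

lemma edgeProb_eq {N : ℕ} (p q : ℝ) (σ : Fin N → Fin k) (u v : Fin N) :
    edgeProb p q σ u v = q + if σ v = σ u then p - q else 0 := by
  unfold edgeProb
  by_cases h : σ u = σ v
  · rw [if_pos h, if_pos h.symm]; ring
  · rw [if_neg h, if_neg (Ne.symm h)]; ring

lemma IsBalanced.sum_edgeProb (hσ : IsBalanced n k σ) (p q : ℝ) (v : Fin (k * n)) :
    ∑ w, edgeProb p q σ v w = k * n * q + n * (p - q) := by
  simp_rw [edgeProb_eq, sum_add_distrib, hσ.sum_ite]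
  simp

/-- Write both factors as `q` plus `p - q` times an indicator and expand. Only the product of the
two indicators depends on whether `u` and `v` share a cluster; it yields the gap on which the
algorithm rests. -/
lemma IsBalanced.sum_edgeProb_mul (hσ : IsBalanced n k σ) (p q : ℝ) (u v : Fin (k * n)) :
    ∑ w, edgeProb p q σ u w * edgeProb p q σ w v =
      k * n * q ^ 2 + 2 * (p - q) * q * n + if σ u = σ v then (p - q) ^ 2 * n else 0 := by
  have h : ∀ w, edgeProb p q σ u w * edgeProb p q σ w v = q ^ 2 +
      (if σ w = σ u then (p - q) * q else 0) + (if σ w = σ v then (p - q) * q else 0) +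
      (if σ w = σ u then (if σ u = σ v then (p - q) ^ 2 else 0) else 0) := by
    intro w
    rw [edgeProb_eq, edgeProb_eq]
    by_cases h1 : σ w = σ u
    · by_cases h2 : σ u = σ v
      · simp [h1, h2]; ring
      · simp [h1, h2, Ne.symm h2]; ring
    · by_cases h3 : σ w = σ v
      · simp [h3]
        by_cases h2 : σ v = σ u
        · exact absurd (h3.trans h2) h1
        · simp [h2]; ring
      · simp [h1, h3, Ne.symm h3]; ring
  simp_rw [h, sum_add_distrib, hσ.sum_ite]
  simp only [sum_const, card_univ, Fintype.card_fin, nsmul_eq_mul, Nat.cast_mul]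
  split_ifs <;> ring

lemma IsBalanced.sum_edgeProb_mul_sdiff (hσ : IsBalanced n k σ) (p q : ℝ) {u v : Fin (k * n)}
    (huv : u ≠ v) :
    ∑ w ∈ univ \ {u, v}, edgeProb p q σ u w * edgeProb p q σ w v =
      k * n * q ^ 2 + 2 * (p - q) * q * n + (if σ u = σ v then (p - q) ^ 2 * n else 0)
        - 2 * p * edgeProb p q σ u v := by
  have h := sum_sdiff (f := fun w => edgeProb p q σ u w * edgeProb p q σ w v)
    (subset_univ {u, v})
  have h1 : ∀ w, edgeProb p q σ w w = p := fun w => by simp [edgeProb]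
  rw [sum_pair huv, h1, h1] at h
  rw [← hσ.sum_edgeProb_mul, ← h]
  ring

lemma IsBalanced.sum_pairProb_le (hσ : IsBalanced n k σ) {p q : ℝ} (hq : 0 ≤ q) (hqp : q ≤ p) :
    ∑ e : Sym2 (Fin (k * n)) with ¬ e.IsDiag, pairProb p q σ e ≤ edgeScale n k p q := by
  rw [← Finset.sym2_univ, sum_sym2_filter_not_isDiag]
  have h0 : ∀ u v, 0 ≤ edgeProb p q σ u v := fun u v => pairProb_nonneg hq hqp σ s(u, v)
  calc ∑ e ∈ (univ : Finset (Fin (k * n))).offDiag with e.1 < e.2, pairProb p q σ s(e.1, e.2)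
      ≤ ∑ e : Fin (k * n) × Fin (k * n), edgeProb p q σ e.1 e.2 :=
        sum_le_sum_of_subset_of_nonneg (subset_univ _) fun e _ _ => h0 _ _
    _ = ∑ u : Fin (k * n), (k * n * q + n * (p - q)) := by
        rw [Fintype.sum_prod_type]; exact sum_congr rfl fun u _ => hσ.sum_edgeProb p q u
    _ ≤ edgeScale n k p q := by
        simp only [sum_const, card_univ, Fintype.card_fin, nsmul_eq_mul, Nat.cast_mul, edgeScale]
        nlinarith [mul_nonneg (mul_nonneg (Nat.cast_nonneg (α := ℝ) k) (sq_nonneg (n : ℝ))) hq]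

end Means

variable {n k : ℕ} {σ : Fin (k * n) → Fin k} {Y : Type} [Fintype Y]

/-- The number of common neighbours of `u` and `v` by edges with labels in `A`. -/
noncomputable def codeg {N : ℕ} (A : Finset Y) (G : SimpleGraph (Fin N))
    (ℓ : Sym2 (Fin N) → Y) (u v : Fin N) : ℝ :=
  hits (univ \ {u, v}) (fun w => {s(u, w), s(w, v)}) A G ℓ

/-- A function of two vertices takes values close to `h + Δ` in the clusters and close to `h`
between them. -/
def Separates {N k : ℕ} (σ : Fin N → Fin k) (h Δ : ℝ) (f : Fin N → Fin N → ℝ) : Prop :=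
  ∀ u v, u ≠ v →
    (σ u = σ v → h + 7 / 8 * Δ ≤ f u v ∧ f u v ≤ h + 17 / 16 * Δ) ∧
    (σ u ≠ σ v → h - Δ / 8 ≤ f u v ∧ f u v ≤ h + Δ / 16)

lemma prob_mono {N : ℕ} {σ : Fin N → Fin k} {p q : ℝ} (hq : 0 ≤ q) (hqp : q ≤ p) (hp : p ≤ 1)
    {E F : SimpleGraph (Fin N) → (Sym2 (Fin N) → Y) → Prop} (h : ∀ G ℓ, E G ℓ → F G ℓ) :
    prob p q σ E ≤ prob p q σ F := by
  classical
  refine expect_mono hq hqp hp σ fun G ℓ => ?_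
  by_cases hE : E G ℓ
  · simp [hE, h G ℓ hE]
  · rw [if_neg hE]; split_ifs <;> norm_num

lemma prob_or_le {N : ℕ} {σ : Fin N → Fin k} {p q : ℝ} (hq : 0 ≤ q) (hqp : q ≤ p) (hp : p ≤ 1)
    (E F : SimpleGraph (Fin N) → (Sym2 (Fin N) → Y) → Prop) :
    prob p q σ (fun G ℓ => E G ℓ ∨ F G ℓ) ≤ prob p q σ E + prob p q σ F := by
  classical
  unfold prob
  calc _ ≤ expect p q σ (fun G ℓ => ∑ i ∈ (univ : Finset Bool),
        if (if i then E G ℓ else F G ℓ) then (1 : ℝ) else 0) := by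
        refine expect_mono hq hqp hp σ fun G ℓ => ?_
        by_cases h1 : E G ℓ <;> by_cases h2 : F G ℓ <;> simp [h1, h2]
    _ = _ := by rw [expect_sum]; simp

lemma prob_exists_le {N : ℕ} {σ : Fin N → Fin k} {p q : ℝ} (hq : 0 ≤ q) (hqp : q ≤ p)
    (hp : p ≤ 1) {ι : Type*} [Fintype ι] (E : ι → SimpleGraph (Fin N) → (Sym2 (Fin N) → Y) → Prop)
    (x : ℝ) (hE : ∀ i, prob p q σ (E i) ≤ x) :
    prob p q σ (fun G ℓ => ∃ i, E i G ℓ) ≤ Fintype.card ι * x := by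
  classical
  calc _ ≤ expect p q σ (fun G ℓ => ∑ i, if E i G ℓ then (1 : ℝ) else 0) := by
        refine expect_mono hq hqp hp σ fun G ℓ => ?_
        split_ifs with h
        · obtain ⟨i, hi⟩ := h
          have := single_le_sum (f := fun i => if E i G ℓ then (1 : ℝ) else 0)
            (fun j _ => by split_ifs <;> norm_num) (mem_univ i)
          simpa [hi] using this
        · exact sum_nonneg fun j _ => by split_ifs <;> norm_num
    _ = ∑ i, prob p q σ (E i) := by rw [expect_sum]; rfl
    _ ≤ _ := by
        refine (sum_le_sum fun i _ => hE i).trans ?_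
        simp

/-- The assumption on the parameters of the block model, in polynomial form. -/
structure Signal (n k : ℕ) (p q : ℝ) : Prop where
  q_pos : 0 < q
  q_lt_p : q < p
  p_lt_one : p < 1
  pow_le : 10000 * (k : ℝ) ^ 3 * Real.log n * p ^ 2 ≤ (p - q) ^ 4 * n
  sq_le : 32 * p ^ 2 ≤ (p - q) ^ 2 * n

/-- Chernoff with deviation `Δ / 16` and `V = r ^ 2 * k * n * p ^ 2`: the exponent `Δ ^ 2 / (1024 *
V)` is at least `(10000 / 1024) * (r * k) ^ 2 * log n`, hence at least `9 * log n`. The bounds are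
asymmetric because leaving out the midpoints `u` and `v` lowers the mean by up to another `Δ / 16`.
-/
lemma prob_codeg_le [Nonempty Y] {p q : ℝ} (hs : Signal n k p q) (hσ : IsBalanced n k σ)
    (hn : 1 ≤ n) (hk : 1 ≤ k) (A : Finset Y) {r : ℝ} (hr : (A.card : ℝ) / Fintype.card Y = r)
    (hrk : 1 ≤ r * k) {u v : Fin (k * n)} (huv : u ≠ v) :
    prob p q σ (fun G ℓ => ¬
      ((σ u = σ v → r ^ 2 * (k * n * q ^ 2 + 2 * (p - q) * q * n) +
          7 / 8 * (r ^ 2 * ((p - q) ^ 2 * n)) ≤ codeg A G ℓ u v ∧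
        codeg A G ℓ u v ≤ r ^ 2 * (k * n * q ^ 2 + 2 * (p - q) * q * n) +
          17 / 16 * (r ^ 2 * ((p - q) ^ 2 * n))) ∧
      (σ u ≠ σ v → r ^ 2 * (k * n * q ^ 2 + 2 * (p - q) * q * n) -
          (r ^ 2 * ((p - q) ^ 2 * n)) / 8 ≤ codeg A G ℓ u v ∧
        codeg A G ℓ u v ≤ r ^ 2 * (k * n * q ^ 2 + 2 * (p - q) * q * n) +
          (r ^ 2 * ((p - q) ^ 2 * n)) / 16))) ≤ 2 / (n : ℝ) ^ 9 := by
  obtain ⟨hq, hqp, hp, h4, h2⟩ := hs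
  have hp0 : 0 < p := hq.trans hqp
  have hn0 : (0 : ℝ) < n := by exact_mod_cast hn
  have hk0 : (0 : ℝ) < k := by exact_mod_cast hk
  have hr0 : 0 < r := by
    rcases lt_or_ge 0 r with h | h
    · exact h
    · nlinarith
  set I : Finset (Fin (k * n)) := univ \ {u, v} with hI
  set F : Fin (k * n) → Finset (Sym2 (Fin (k * n))) := fun w => {s(u, w), s(w, v)} with hF
  have hne : ∀ w ∈ I, w ≠ u ∧ w ≠ v := by
    intro w hw
    simpa [hI, not_or] using hw
  have hpair : ∀ w ∈ I, s(u, w) ≠ s(w, v) := by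
    intro w hw h
    rw [Sym2.eq_iff] at h
    rcases h with h | h
    · exact (hne w hw).1 h.1.symm
    · exact huv h.1
  set μ := ∑ i ∈ I, ∏ e ∈ F i, (pairProb p q σ e * ((A.card : ℝ) / Fintype.card Y)) with hμ
  have hμ1 : μ = r ^ 2 * (k * n * q ^ 2 + 2 * (p - q) * q * n +
      (if σ u = σ v then (p - q) ^ 2 * n else 0) - 2 * p * edgeProb p q σ u v) := by
    rw [← hσ.sum_edgeProb_mul_sdiff p q huv, mul_sum, hμ]
    refine sum_congr rfl fun w hw => ?_
    rw [hF, prod_pair (hpair w hw), hr, pairProb_mk, pairProb_mk]; ring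
  have hμ0 : 0 ≤ μ := sum_nonneg fun i _ => prod_nonneg fun e _ =>
    mul_nonneg (pairProb_nonneg hq.le hqp.le σ e) (by positivity)
  have hμV : μ ≤ r ^ 2 * (k * n * p ^ 2) := by
    calc μ ≤ ∑ w ∈ I, r ^ 2 * p ^ 2 := by
          refine sum_le_sum fun w hw => ?_
          rw [hF, prod_pair (hpair w hw), hr]
          have a1 := pairProb_nonneg hq.le hqp.le σ s(u, w)
          have a2 := pairProb_nonneg hq.le hqp.le σ s(w, v)
          have b1 := pairProb_le hqp.le σ s(u, w)
          have b2 := pairProb_le hqp.le σ s(w, v)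
          calc _ = r ^ 2 * (pairProb p q σ s(u, w) * pairProb p q σ s(w, v)) := by ring
            _ ≤ r ^ 2 * (p * p) := by gcongr
            _ = _ := by ring
      _ ≤ ∑ w : Fin (k * n), r ^ 2 * p ^ 2 :=
          sum_le_sum_of_subset_of_nonneg (subset_univ _) fun _ _ _ => by positivity
      _ = _ := by simp; ring
  -- Paths from `u` to `v` through different midpoints share no pair, which is what makes the
  -- summands independent.
  have hdisj : (I : Set (Fin (k * n))).PairwiseDisjoint F := by
    intro w hw w' hw' hww
    have h1 := hne w hw
    have h2 := hne w' hw'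
    simp only [hF, Function.onFun, disjoint_insert_left, disjoint_singleton_left, mem_insert,
      mem_singleton, Sym2.eq_iff]
    grind
  have hdiag : ∀ i ∈ I, ∀ e ∈ F i, ¬ e.IsDiag := by
    intro w hw e he
    have h1 := hne w hw
    simp only [hF, mem_insert, mem_singleton] at he
    rcases he with rfl | rfl
    · exact fun h => h1.1 (Sym2.mk_isDiag_iff.1 h).symm
    · exact fun h => h1.2 (Sym2.mk_isDiag_iff.1 h)
  set Δ := r ^ 2 * ((p - q) ^ 2 * n) with hΔ
  have hpq : (p - q) ^ 2 ≤ p ^ 2 := by nlinarith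
  have hΔ0 : 0 ≤ Δ := by positivity
  obtain ⟨hup, hlow⟩ := prob_dev_le hq.le hqp.le hp.le σ I F hdiag hdisj A μ
    (r ^ 2 * (k * n * p ^ 2)) (Δ / 16) hμ.symm hμ0 hμV (by positivity) (by positivity) (by
      have : Δ ≤ r ^ 2 * (k * n * p ^ 2) := by
        rw [hΔ]
        refine mul_le_mul_of_nonneg_left ?_ (by positivity)
        have hk1 : (1 : ℝ) ≤ k := by exact_mod_cast hk
        nlinarith [mul_le_mul_of_nonneg_right hk1 (mul_nonneg hn0.le (sq_nonneg p)),
          mul_le_mul_of_nonneg_right hpq hn0.le]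
      nlinarith)
  have hexp : Real.exp (-((Δ / 16) ^ 2 / (4 * (r ^ 2 * (k * n * p ^ 2))))) ≤ 1 / (n : ℝ) ^ 9 := by
    have hl : 9 * Real.log n ≤ (Δ / 16) ^ 2 / (4 * (r ^ 2 * (k * n * p ^ 2))) := by
      rw [le_div_iff₀ (by positivity)]
      have e1 : (Δ / 16) ^ 2 = r ^ 2 * n / 256 * (r ^ 2 * ((p - q) ^ 4 * n)) := by rw [hΔ]; ring
      have e2 : r ^ 2 * (10000 * (k : ℝ) ^ 3 * Real.log n * p ^ 2) ≤
          r ^ 2 * ((p - q) ^ 4 * n) := by gcongr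
      have hlog : 0 ≤ Real.log n := Real.log_natCast_nonneg n
      have e3 : (1 : ℝ) ≤ (r * k) ^ 2 := one_le_pow₀ hrk
      have e4 : 10000 * (k * Real.log n * p ^ 2) ≤
          r ^ 2 * (10000 * (k : ℝ) ^ 3 * Real.log n * p ^ 2) := by
        have := mul_le_mul_of_nonneg_right e3
          (show 0 ≤ 10000 * (k * Real.log n * p ^ 2) by positivity)
        calc _ ≤ _ := by simpa using this
          _ = _ := by ring
      rw [e1]
      calc 9 * Real.log n * (4 * (r ^ 2 * (k * n * p ^ 2)))
          = r ^ 2 * n / 256 * (9216 * (k * Real.log n * p ^ 2)) := by ring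
        _ ≤ r ^ 2 * n / 256 * (10000 * (k * Real.log n * p ^ 2)) := by
            have : 0 ≤ k * Real.log n * p ^ 2 := by positivity
            gcongr; norm_num
        _ ≤ _ := mul_le_mul_of_nonneg_left (e4.trans e2) (by positivity)
    calc _ ≤ Real.exp (-(9 * Real.log n)) := Real.exp_le_exp.2 (by linarith)
      _ = 1 / (n : ℝ) ^ 9 := by
        rw [Real.exp_neg, ← Real.rpow_natCast, Real.rpow_def_of_pos hn0, one_div]
        congr 2; push_cast; ring
  refine (prob_mono hq.le hqp.le hp.le (F := fun G ℓ => μ + Δ / 16 ≤ hits I F A G ℓ ∨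
    hits I F A G ℓ ≤ μ - Δ / 16) ?_).trans
    ((prob_or_le hq.le hqp.le hp.le _ _).trans ?_)
  · intro G ℓ h
    by_contra! hc
    apply h
    have hcod : codeg A G ℓ u v = hits I F A G ℓ := rfl
    -- The loss from the two missing midpoints; this is what the condition `Signal.sq_le` is for.
    have h3 : r ^ 2 * (2 * p ^ 2) ≤ Δ / 16 := by
      rw [hΔ]
      have := mul_le_mul_of_nonneg_left h2 (sq_nonneg r)
      linarith
    have h5 : r ^ 2 * (2 * p * q) ≤ r ^ 2 * (2 * p ^ 2) := by
      refine mul_le_mul_of_nonneg_left ?_ (sq_nonneg r)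
      nlinarith
    have h6 : 0 ≤ r ^ 2 * (2 * p * q) := by positivity
    have h7 : 0 ≤ r ^ 2 * (2 * p ^ 2) := by positivity
    rw [hcod]
    constructor
    · intro hc'
      simp only [hc', if_true, edgeProb] at hμ1
      have : μ = r ^ 2 * (k * n * q ^ 2 + 2 * (p - q) * q * n) + Δ - r ^ 2 * (2 * p ^ 2) := by
        rw [hμ1, hΔ]; ring
      constructor <;> linarith
    · intro hc'
      simp only [if_neg hc', edgeProb] at hμ1
      have : μ = r ^ 2 * (k * n * q ^ 2 + 2 * (p - q) * q * n) - r ^ 2 * (2 * p * q) := by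
        rw [hμ1]; ring
      constructor <;> linarith
  · calc _ ≤ 1 / (n : ℝ) ^ 9 + 1 / (n : ℝ) ^ 9 := add_le_add (hup.trans hexp) (hlow.trans hexp)
      _ = _ := by ring

/-- With high probability all the numbers of common neighbours are concentrated. -/
lemma prob_not_separates_le [Nonempty Y] {p q : ℝ} (hs : Signal n k p q) (hσ : IsBalanced n k σ)
    (hn : 1 ≤ n) (hk : 1 ≤ k) (A : Finset Y) {r : ℝ} (hr : (A.card : ℝ) / Fintype.card Y = r)
    (hrk : 1 ≤ r * k) :
    prob p q σ (fun G ℓ => ¬ Separates σ (r ^ 2 * (k * n * q ^ 2 + 2 * (p - q) * q * n))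
      (r ^ 2 * ((p - q) ^ 2 * n)) (codeg A G ℓ)) ≤ (k * n) ^ 2 * (2 / (n : ℝ) ^ 9) := by
  have h := prob_exists_le (σ := σ) (ι := Fin (k * n) × Fin (k * n)) hs.q_pos.le hs.q_lt_p.le
    hs.p_lt_one.le (fun i G ℓ => i.1 ≠ i.2 ∧ ¬
      ((σ i.1 = σ i.2 → r ^ 2 * (k * n * q ^ 2 + 2 * (p - q) * q * n) +
          7 / 8 * (r ^ 2 * ((p - q) ^ 2 * n)) ≤ codeg A G ℓ i.1 i.2 ∧
        codeg A G ℓ i.1 i.2 ≤ r ^ 2 * (k * n * q ^ 2 + 2 * (p - q) * q * n) +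
          17 / 16 * (r ^ 2 * ((p - q) ^ 2 * n))) ∧
      (σ i.1 ≠ σ i.2 → r ^ 2 * (k * n * q ^ 2 + 2 * (p - q) * q * n) -
          (r ^ 2 * ((p - q) ^ 2 * n)) / 8 ≤ codeg A G ℓ i.1 i.2 ∧
        codeg A G ℓ i.1 i.2 ≤ r ^ 2 * (k * n * q ^ 2 + 2 * (p - q) * q * n) +
          (r ^ 2 * ((p - q) ^ 2 * n)) / 16))) (2 / (n : ℝ) ^ 9) ?_
  · refine (prob_mono hs.q_pos.le hs.q_lt_p.le hs.p_lt_one.le ?_).trans (h.trans (le_of_eq ?_))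
    · intro G ℓ hG
      simp only [Separates, not_forall] at hG
      obtain ⟨u, v, huv, hG⟩ := hG
      exact ⟨(u, v), huv, hG⟩
    · rw [Fintype.card_prod, Fintype.card_fin]; push_cast; ring
  · rintro ⟨u, v⟩
    by_cases huv : u = v
    · subst huv
      have : prob p q σ (fun (G : SimpleGraph (Fin (k * n))) (ℓ : Sym2 (Fin (k * n)) → Y) =>
          False) ≤ 2 / (n : ℝ) ^ 9 := by
        simp [prob, expect]; positivity
      simpa using this
    · refine (prob_mono hs.q_pos.le hs.q_lt_p.le hs.p_lt_one.le fun G ℓ hG => hG.2).trans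
        (prob_codeg_le hs hσ hn hk A hr hrk huv)

open Classical in
/-- The number of all edges with a label in `A`. -/
lemma prob_edges_le [Nonempty Y] {p q : ℝ} (hs : Signal n k p q) (hσ : IsBalanced n k σ)
    (A : Finset Y) (y : ℝ) (hy : 0 < y) (K : ℕ)
    (hK : Real.exp y * (edgeScale n k p q * ((A.card : ℝ) / Fintype.card Y)) ≤ K) :
    prob p q σ (fun G ℓ => K ≤ (G.edgeFinset.filter (fun e => ℓ e ∈ A)).card) ≤
      Real.exp (-((y - 1) * K)) := by
  have h := prob_large_le (Y := Y) hs.q_pos.le hs.q_lt_p.le hs.p_lt_one.le σ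
    (univ.filter (fun e : Sym2 (Fin (k * n)) => ¬ e.IsDiag)) (fun e => {e})
    (fun i hi e he => by rw [mem_singleton.1 he]; exact (mem_filter.1 hi).2)
    (fun i _ j _ hij => by simpa using hij) A y K ?_ hy
  · refine (prob_mono hs.q_pos.le hs.q_lt_p.le hs.p_lt_one.le ?_).trans h
    intro G ℓ hG
    have : hits (univ.filter (fun e : Sym2 (Fin (k * n)) => ¬ e.IsDiag)) (fun e => {e}) A G ℓ =
        (G.edgeFinset.filter (fun e => ℓ e ∈ A)).card := by
      simp only [hits, prod_singleton, hit]
      rw [sum_boole, filter_filter]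
      congr 2
      ext e
      simp only [mem_filter, mem_univ, true_and]
      exact ⟨fun h => h.2, fun h => ⟨G.not_isDiag_of_mem_edgeFinset h.1, h⟩⟩
    rw [this]
    exact_mod_cast hG
  · refine le_trans ?_ hK
    simp only [prod_singleton]
    rw [← sum_mul]
    gcongr
    exact hσ.sum_pairProb_le hs.q_pos.le hs.q_lt_p.le

open Classical in
/-- The number of the edges at a vertex with a label in `A`. -/
lemma prob_degree_le [Nonempty Y] {p q : ℝ} (hs : Signal n k p q) (hσ : IsBalanced n k σ)
    (A : Finset Y) (v : Fin (k * n)) (y : ℝ) (hy : 0 < y) (K : ℕ)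
    (hK : Real.exp y * ((n * p + k * n * q) * ((A.card : ℝ) / Fintype.card Y)) ≤ K) :
    prob p q σ (fun G ℓ => K ≤ (univ.filter (fun w => G.Adj v w ∧ ℓ s(v, w) ∈ A)).card) ≤
      Real.exp (-((y - 1) * K)) := by
  have h := prob_large_le (Y := Y) hs.q_pos.le hs.q_lt_p.le hs.p_lt_one.le σ
    (univ.filter (fun w => w ≠ v)) (fun w => {s(v, w)})
    (fun i hi e he => by
      rw [mem_singleton.1 he, Sym2.mk_isDiag_iff]; exact (mem_filter.1 hi).2.symm)
    (fun i hi j hj hij => by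
      simp only [Function.onFun, disjoint_singleton, ne_eq, Sym2.eq_iff]
      simp only [coe_filter, mem_univ, true_and, Set.mem_ofPred_eq] at hi hj
      grind) A y K ?_ hy
  · refine (prob_mono hs.q_pos.le hs.q_lt_p.le hs.p_lt_one.le ?_).trans h
    intro G ℓ hG
    have : hits (univ.filter (fun w => w ≠ v)) (fun w => {s(v, w)}) A G ℓ =
        (univ.filter (fun w => G.Adj v w ∧ ℓ s(v, w) ∈ A)).card := by
      simp only [hits, prod_singleton, hit]
      rw [sum_boole, filter_filter]
      congr 2
      ext w
      simp only [mem_filter, mem_univ, true_and, SimpleGraph.mem_edgeFinset,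
        SimpleGraph.mem_edgeSet]
      exact ⟨fun h => h.2, fun h => ⟨h.1.ne', h⟩⟩
    rw [this]
    exact_mod_cast hG
  · refine le_trans ?_ hK
    simp only [prod_singleton]
    rw [← sum_mul]
    gcongr
    simp only [pairProb_mk]
    calc ∑ w ∈ univ.filter (fun w => w ≠ v), edgeProb p q σ v w ≤ ∑ w, edgeProb p q σ v w :=
          sum_le_sum_of_subset_of_nonneg (subset_univ _) fun e _ _ =>
            pairProb_nonneg hs.q_pos.le hs.q_lt_p.le σ s(v, e)
      _ ≤ _ := by
          rw [hσ.sum_edgeProb]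
          nlinarith [mul_nonneg (Nat.cast_nonneg (α := ℝ) n) hs.q_pos.le]

end SBM

/-! ### From the coins of the machines to uniform labels and random centres -/

namespace MPC
open Finset

/-- All the fibres of `Φ` have the same size. -/
def Equidistributed {α β : Type*} [Fintype α] (Φ : α → β) : Prop :=
  ∀ b b', Nat.card {a // Φ a = b} = Nat.card {a // Φ a = b'}

/-- An injection of every fibre into every other fibre forces equal cardinalities by symmetry in `b`
and `b'`. -/
lemma equidistributed_of_injective {α β : Type*} [Fintype α] {Φ : α → β}
    (h : ∀ b b', ∃ π : α → α, Function.Injective π ∧ ∀ a, Φ a = b → Φ (π a) = b') :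
    Equidistributed Φ := by
  have key : ∀ b b', Nat.card {a // Φ a = b} ≤ Nat.card {a // Φ a = b'} := by
    intro b b'
    obtain ⟨π, hπ, hb⟩ := h b b'
    exact Nat.card_le_card_of_injective (fun a => ⟨π a.1, hb _ a.2⟩)
      fun a a' haa => Subtype.ext (hπ (congrArg Subtype.val haa))
  exact fun b b' => le_antisymm (key _ _) (key _ _)

open Classical in
lemma Equidistributed.card_mul {α β : Type*} [Fintype α] [Fintype β] {Φ : α → β}
    (h : Equidistributed Φ) (P : β → Prop) :
    (univ.filter fun a => P (Φ a)).card * Fintype.card β =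
      (univ.filter P).card * Fintype.card α := by
  rcases isEmpty_or_nonempty β with hβ | ⟨⟨b₀⟩⟩
  · have : IsEmpty α := Φ.isEmpty
    simp
  have hc : ∀ b, (univ.filter fun a => Φ a = b).card = (univ.filter fun a => Φ a = b₀).card := by
    intro b
    have := h b b₀
    rwa [Nat.card_eq_fintype_card, Nat.card_eq_fintype_card, Fintype.card_subtype,
      Fintype.card_subtype] at this
  have h1 : ∀ s : Finset β, (univ.filter fun a => Φ a ∈ s).card =
      s.card * (univ.filter fun a => Φ a = b₀).card := by
    intro s
    rw [card_eq_sum_card_fiberwise (f := Φ) (t := s) (fun a ha => by simpa using ha), ← smul_eq_mul,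
      ← sum_const]
    refine sum_congr rfl fun b hb => ?_
    rw [← hc b, filter_filter]
    congr 1
    ext a
    simp only [mem_filter, mem_univ, true_and, and_iff_right_iff_imp]
    rintro rfl; exact hb
  have h2 := h1 (univ.filter P)
  have h3 := h1 univ
  simp only [mem_filter, mem_univ, true_and, filter_true, card_univ] at h2 h3
  rw [h2, h3]; ring

open Classical in
lemma Equidistributed.card_div {α β : Type*} [Fintype α] [Fintype β] [Nonempty α]
    {Φ : α → β} (h : Equidistributed Φ) (P : β → Prop) :
    ((univ.filter fun a => P (Φ a)).card : ℝ) / Fintype.card α =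
      (univ.filter P).card / Fintype.card β := by
  have : Nonempty β := ⟨Φ (Classical.arbitrary α)⟩
  rw [div_eq_div_iff (by exact_mod_cast Fintype.card_ne_zero)
    (by exact_mod_cast Fintype.card_ne_zero)]
  exact_mod_cast h.card_mul P

open Classical in
/-- A lower bound for the probability of success in terms of independent uniform labels of the
pairs of vertices and of other uniform random choices. -/
lemma le_successProb {M N k : ℕ} (A : Algorithm M N k) (W s : ℕ) {S p q : ℝ} (hq : 0 ≤ q)
    (hqp : q ≤ p) (hp : p ≤ 1) (σ : Fin N → Fin k) (D : SimpleGraph (Fin N) → Placement M N)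
    {Y Z : Type} [Fintype Y] [Fintype Z]
    (Φ : SimpleGraph (Fin N) → A.Coins → Sym2 (Fin N) → Y)
    (Ψ : A.Coins → Z) (hΦ : ∀ G, Equidistributed (Φ G))
    (hΨ : Equidistributed Ψ) (E : SimpleGraph (Fin N) → (Sym2 (Fin N) → Y) → Prop)
    (C : Z → Prop)
    (h : ∀ G ω, ¬ E G (Φ G ω) → ¬ C (Ψ ω) →
      IsPlacement s G (D G) ∧ Succeeds A W s S σ (D G) ω) :
    1 - SBM.prob p q σ (fun G ℓ => E G ℓ) -
      (univ.filter fun z => C z).card / (Fintype.card Z : ℝ) ≤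
        successProb A W s S p q σ D := by
  set b : ℝ := (univ.filter fun z => C z).card / (Fintype.card Z : ℝ)
  have h1 : 1 - SBM.prob p q σ (fun G ℓ => E G ℓ) - b = ∑ G, SBM.weight p q σ G *
      (1 - (∑ ℓ : Sym2 (Fin N) → Y, if E G ℓ then (1 : ℝ) else 0) /
        Fintype.card (Sym2 (Fin N) → Y) - b) := by
    simp only [mul_sub, sum_sub_distrib, mul_one, SBM.sum_weight, ← sum_mul, one_mul]
    rfl
  rw [h1]
  refine sum_le_sum fun G _ => mul_le_mul_of_nonneg_left ?_ (SBM.weight_nonneg hq hqp hp σ G)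
  have hc0 : (0 : ℝ) < Fintype.card A.Coins := by
    have : Nonempty A.Coins := ⟨fun _ _ => 0⟩
    exact_mod_cast Fintype.card_pos
  have : Nonempty A.Coins := ⟨fun _ _ => 0⟩
  rw [sum_boole, ← (hΦ G).card_div (fun ℓ => E G ℓ)]
  simp only [b]
  rw [← hΨ.card_div (fun z => C z), le_div_iff₀ hc0, sub_mul, sub_mul, div_mul_cancel₀ _ hc0.ne',
    div_mul_cancel₀ _ hc0.ne', one_mul]
  -- A union bound over the coins for a fixed graph. Hence `Φ` may depend on the graph, and the
  -- labels and the other choices need not be independent of each other.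
  have hcard : Fintype.card A.Coins ≤
      (univ.filter fun ω : A.Coins => IsPlacement s G (D G) ∧ Succeeds A W s S σ (D G) ω).card +
      (univ.filter fun ω => E G (Φ G ω)).card + (univ.filter fun ω => C (Ψ ω)).card := by
    rw [← card_univ]
    refine le_trans (card_le_card ?_) ((card_union_le _ _).trans
      (Nat.add_le_add_right (card_union_le _ _) _))
    intro ω _
    simp only [mem_union, mem_filter, mem_univ, true_and]
    by_cases h1 : E G (Φ G ω)
    · exact Or.inl (Or.inr h1)
    · by_cases h2 : C (Ψ ω)
      · exact Or.inr h2
      · exact Or.inl (Or.inl (h G ω h1 h2))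
  have : (Fintype.card A.Coins : ℝ) ≤
      (univ.filter fun ω : A.Coins => IsPlacement s G (D G) ∧ Succeeds A W s S σ (D G) ω).card +
      (univ.filter fun ω => E G (Φ G ω)).card + (univ.filter fun ω => C (Ψ ω)).card := by
    exact_mod_cast hcard
  linarith

lemma successProb_nonneg {M N k : ℕ} (A : Algorithm M N k) (W s : ℕ) {S p q : ℝ} (hq : 0 ≤ q)
    (hqp : q ≤ p) (hp : p ≤ 1) (σ : Fin N → Fin k) (D : SimpleGraph (Fin N) → Placement M N) :
    0 ≤ successProb A W s S p q σ D := by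
  classical
  exact sum_nonneg fun G _ => mul_nonneg (SBM.weight_nonneg hq hqp hp σ G) (by positivity)

section Coins

variable {a b Ω : Type} [Fintype a] {ρ M : ℕ}

/-- Reading off the labels of all pairs from the random choices of the machines in one round. -/
lemma equidistributed_labels [Fintype Ω] {J Y Z : Type} [DecidableEq Y] (dec : Ω ≃ (J → Y) × Z)
    (r : Fin ρ) (i : J → Fin M) :
    Equidistributed (fun (ω : Fin ρ → Fin M → Ω) (e : J) => (dec (ω r (i e))).1 e) := by
  classical
  refine equidistributed_of_injective fun y y' => ?_
  -- Swapping the values `y e` and `y' e` of the label of `e` on all machines and in all rounds is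
  -- an involution, and it does so in particular on the machine `i e` that is read.
  refine ⟨fun ω r m => dec.symm (fun e => Equiv.swap (y e) (y' e) ((dec (ω r m)).1 e),
    (dec (ω r m)).2), ?_, ?_⟩
  · refine Function.Involutive.injective fun ω => ?_
    funext r m
    simp
  · intro ω h
    funext e
    have := congrFun h e
    simp only [Equiv.apply_symm_apply]
    rw [this, Equiv.swap_apply_left]

end Coins

open Classical in
/-- Random vertices hit, except with a small probability, every large set of a family. -/
lemma card_not_hit_le {N T : ℕ} (B : Fin N → Finset (Fin N)) (β : ℕ) (hB : ∀ x, β ≤ (B x).card)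
    (hN : 0 < N) :
    ((univ.filter fun κ : Fin T → Fin N => ¬ ∀ x, ∃ t, κ t ∈ B x).card : ℝ) /
      Fintype.card (Fin T → Fin N) ≤ N * Real.exp (-(T * β / N)) := by
  have hN0 : (0 : ℝ) < N := by exact_mod_cast hN
  have h1 : (univ.filter fun κ : Fin T → Fin N => ¬ ∀ x, ∃ t, κ t ∈ B x) ⊆
      univ.biUnion fun x => Fintype.piFinset fun _ => (B x)ᶜ := by
    intro κ hκ
    simp only [mem_filter, mem_univ, true_and, not_forall, not_exists] at hκ
    obtain ⟨x, hx⟩ := hκ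
    simp only [mem_biUnion, mem_univ, true_and, Fintype.mem_piFinset, mem_compl]
    exact ⟨x, hx⟩
  have h2 : ∀ x, ((Fintype.piFinset fun _ : Fin T => (B x)ᶜ).card : ℝ) ≤
      Real.exp (-(T * β / N)) * (N : ℝ) ^ T := by
    intro x
    rw [Fintype.card_piFinset, prod_const, card_univ, Fintype.card_fin, card_compl,
      Fintype.card_fin]
    have e1 : ((N - (B x).card : ℕ) : ℝ) ≤ Real.exp (-(β / N)) * N := by
      have hle : (B x).card ≤ N := by simpa using card_le_univ (B x)
      rw [Nat.cast_sub hle]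
      have e2 := Real.add_one_le_exp (-((β : ℝ) / N))
      have e3 : ((β : ℕ) : ℝ) ≤ (B x).card := by exact_mod_cast hB x
      calc (N : ℝ) - (B x).card ≤ N - β := by linarith
        _ = (-((β : ℝ) / N) + 1) * N := by field_simp; ring
        _ ≤ _ := by gcongr
    calc _ = ((N - (B x).card : ℕ) : ℝ) ^ T := by push_cast; rfl
      _ ≤ (Real.exp (-(β / N)) * N) ^ T := by gcongr
      _ = _ := by
        rw [mul_pow, ← Real.exp_nat_mul]
        congr 2; ring
  rw [Fintype.card_fun, Fintype.card_fin, Fintype.card_fin, div_le_iff₀ (by positivity)]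
  calc _ ≤ ((univ.biUnion fun x => Fintype.piFinset fun _ : Fin T => (B x)ᶜ).card : ℝ) := by
        exact_mod_cast card_le_card h1
    _ ≤ ∑ x, ((Fintype.piFinset fun _ : Fin T => (B x)ᶜ).card : ℝ) := by
        exact_mod_cast card_biUnion_le
    _ ≤ ∑ _x : Fin N, Real.exp (-(T * β / N)) * (N : ℝ) ^ T := sum_le_sum fun x _ => h2 x
    _ = _ := by simp; ring

end MPC

/-! ### Hosting cells on machines -/

namespace MPC
open Finset

lemma filter_finsetSum {α β : Type*} (p : α → Prop) [DecidablePred p] (s : Finset β)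
    (f : β → Multiset α) : (∑ i ∈ s, f i).filter p = ∑ i ∈ s, (f i).filter p :=
  map_sum (⟨⟨Multiset.filter p, Multiset.filter_zero p⟩, Multiset.filter_add p⟩ :
    Multiset α →+ Multiset α) f s

lemma map_finsetSum {α β γ : Type*} (g : α → γ) (s : Finset β)
    (f : β → Multiset α) : (∑ i ∈ s, f i).map g = ∑ i ∈ s, (f i).map g :=
  map_sum (Multiset.mapAddMonoidHom g) f s

section Cells

variable {ι τ : Type} [Fintype ι] [Fintype τ] {M N k : ℕ}

/-- An addressed token as a word. -/
noncomputable def encode (x : ι × τ) : ℕ := Fintype.equivFin (ι × τ) x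

/-- The addressed token that a word stands for. -/
noncomputable def decode (w : ℕ) : Option (ι × τ) :=
  if h : w < Fintype.card (ι × τ) then some ((Fintype.equivFin (ι × τ)).symm ⟨w, h⟩) else none

lemma decode_encode (x : ι × τ) : decode (encode x) = some x := by
  have h : encode x < Fintype.card (ι × τ) := (Fintype.equivFin (ι × τ) x).2
  rw [decode, dif_pos h]
  simp [encode]

lemma encode_lt (x : ι × τ) : encode x < Fintype.card (ι × τ) := (Fintype.equivFin (ι × τ) x).2

variable [DecidableEq ι]

/-- The contents of the cells when the addressed tokens `X` have been delivered. -/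
def deliver (X : Multiset (ι × τ)) (β : ι) : Multiset τ :=
  (X.filter (fun x => x.1 = β)).map Prod.snd

/-- The contents of the cells after `t` rounds, where `step t α` tells which addressed tokens
cell `α` sends in round `t`, depending on its contents. -/
def runCells (step : ℕ → ι → Multiset τ → Multiset (ι × τ)) (C : ι → Multiset τ) :
    ℕ → ι → Multiset τ
  | 0 => C
  | t + 1 => deliver (∑ α, step t α (runCells step C t α))

/-- The edges that an input memory stands for. -/
def decodeEdges (N : ℕ) : List ℕ → List (Fin N × Fin N)
  | a :: b :: l =>
    if h : a < N ∧ b < N then (⟨a, h.1⟩, ⟨b, h.2⟩) :: decodeEdges N l else decodeEdges N l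
  | _ => []

lemma decodeEdges_flatMap (l : List (Fin N × Fin N)) :
    decodeEdges N (l.flatMap fun e => [(e.1 : ℕ), (e.2 : ℕ)]) = l := by
  induction l with
  | nil => rfl
  | cons e l ih => simp [decodeEdges, ih]

/-- The part of a memory that belongs to the cell `α`. -/
noncomputable def content (mem : List ℕ) (α : ι) : Multiset τ :=
  deliver ((mem : Multiset ℕ).filterMap decode) α

/-- The words of the machine `i`, if the cells have the contents `C`. -/
noncomputable def memory (host : ι → Fin M) (C : ι → Multiset τ) (i : Fin M) : Multiset ℕ :=
  ∑ α with host α = i, (C α).map fun x => encode (α, x)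

lemma memory_deliver (host : ι → Fin M) (X : Multiset (ι × τ)) (i : Fin M) :
    memory host (deliver X) i = (X.filter fun x => host x.1 = i).map encode := by
  classical
  unfold memory deliver
  induction X using Multiset.induction_on with
  | empty => simp
  | cons a X ih =>
    have h : ∀ β : ι, (((a ::ₘ X).filter fun x => x.1 = β).map Prod.snd).map
        (fun x => encode (β, x)) = (if a.1 = β then {encode a} else 0) +
        ((X.filter fun x => x.1 = β).map Prod.snd).map fun x => encode (β, x) := by
      intro β
      by_cases hb : a.1 = β
      · subst hb
        rw [Multiset.filter_cons_of_pos (p := fun x : ι × τ => x.1 = a.1) _ rfl]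
        simp
      · rw [Multiset.filter_cons_of_neg _ (by simpa using hb)]
        simp [hb]
    simp_rw [h]
    rw [sum_add_distrib, ih, sum_ite_eq]
    by_cases hi : host a.1 = i
    · rw [Multiset.filter_cons_of_pos (p := fun x : ι × τ => host x.1 = i) _ hi]; simp [hi]
    · rw [Multiset.filter_cons_of_neg (p := fun x : ι × τ => host x.1 = i) _ hi]; simp [hi]

lemma filterMap_decode_memory (host : ι → Fin M) (C : ι → Multiset τ) (i : Fin M) :
    (memory host C i).filterMap decode = ∑ α with host α = i, (C α).map fun x => (α, x) := by
  unfold memory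
  have hadd : ∀ s t : Multiset ℕ, (s + t).filterMap (decode (ι := ι) (τ := τ)) =
      s.filterMap decode + t.filterMap decode := by
    intro s t
    induction s using Multiset.induction_on with
    | empty => simp
    | cons a s ih =>
      rw [Multiset.cons_add]
      rcases h : decode (ι := ι) (τ := τ) a with _ | b
      · rw [Multiset.filterMap_cons_none _ _ h, Multiset.filterMap_cons_none _ _ h, ih]
      · rw [Multiset.filterMap_cons_some _ _ _ h, Multiset.filterMap_cons_some _ _ _ h, ih,
          Multiset.cons_add]
  let φ : Multiset ℕ →+ Multiset (ι × τ) :=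
    { toFun := fun s => s.filterMap decode, map_zero' := rfl, map_add' := hadd }
  have hφ := map_sum φ (fun α => (C α).map fun x => encode (α, x))
    (univ.filter fun α => host α = i)
  refine hφ.trans (sum_congr rfl fun α _ => ?_)
  change (((C α).map fun x => encode (α, x)).filterMap decode) = _
  rw [Multiset.filterMap_map]
  have : (decode ∘ fun x => encode (α, x)) = fun x : τ => some (α, x) := by
    funext x; exact decode_encode _
  rw [this]
  exact Multiset.filterMap_eq_map (fun x => (α, x)) ▸ rfl

/-- Every word carries the address of its cell, so the contents of a cell can be recovered from a
memory whose order is unknown. -/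
lemma content_of_memory (host : ι → Fin M) (C : ι → Multiset τ) (α : ι) {mem : List ℕ}
    (h : (mem : Multiset ℕ) = memory host C (host α)) : content mem α = C α := by
  unfold content
  rw [h, filterMap_decode_memory]
  unfold deliver
  rw [filter_finsetSum, map_finsetSum]
  rw [sum_eq_single_of_mem α (by simp)]
  · simp [Multiset.filter_map]
  · intro β _ hβ
    simp [Multiset.filter_map, hβ]

/-- The algorithm that hosts the cells on the machines. In the first round every machine sends
tokens depending on its edges and on its random choices, which need not be used again. -/
noncomputable def cellAlgorithm (ρ : ℕ) (Ω : Type) [Fintype Ω] [Nonempty Ω] (host : ι → Fin M)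
    (first : Fin M → List (Fin N × Fin N) → Ω → Multiset (ι × τ))
    (step : ℕ → ι → Multiset τ → Multiset (ι × τ))
    (out : ι → Multiset τ → Option (Fin N × Fin k)) : Algorithm M N k where
  rounds := ρ + 1
  -- The random number is uniform on `coinBound + 1` values, hence on `Ω`.
  coinBound := Fintype.card Ω - 1
  step t i mem x := ([], (if t = 0 then
      first i (decodeEdges N mem) ((Fintype.equivFin Ω).symm
        (Fin.cast (Nat.sub_add_cancel Fintype.card_pos) x))
    else ∑ α with host α = i, step (t - 1) α (content mem α)).toList.map
      fun y => (host y.1, encode y))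
  output i mem := (univ.filter fun α => host α = i).toList.filterMap fun α => out α (content mem α)

variable {ρ : ℕ} {Ω : Type} [Fintype Ω] [Nonempty Ω] {host : ι → Fin M}
  {first : Fin M → List (Fin N × Fin N) → Ω → Multiset (ι × τ)}
  {step : ℕ → ι → Multiset τ → Multiset (ι × τ)}
  {out : ι → Multiset τ → Option (Fin N × Fin k)}

/-- The random choices of the machine `i` in the first round. -/
noncomputable def choice
    (ω : (cellAlgorithm ρ Ω host first step out).Coins) (i : Fin M) : Ω :=
  (Fintype.equivFin Ω).symm
    (Fin.cast (Nat.sub_add_cancel Fintype.card_pos) (ω ⟨0, Nat.succ_pos ρ⟩ i))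

/-- The contents of the cells after the first round. -/
noncomputable def initialCells (ω : (cellAlgorithm ρ Ω host first step out).Coins)
    (P : Placement M N) : ι → Multiset τ :=
  deliver (∑ i, first i (P i) (choice ω i))

lemma coe_received (ω : (cellAlgorithm ρ Ω host first step out).Coins)
    (t : Fin (ρ + 1)) (C : Config M) (X : Fin M → Multiset (ι × τ))
    (hX : ∀ j, (cellAlgorithm ρ Ω host first step out).sent ω t C j =
      (X j).toList.map fun y => (host y.1, encode y)) (i : Fin M) :
    (((cellAlgorithm ρ Ω host first step out).received ω t C i : List ℕ) : Multiset ℕ) =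
      memory host (deliver (∑ j, X j)) i := by
  rw [memory_deliver, filter_finsetSum, map_finsetSum]
  unfold Algorithm.received
  simp_rw [hX]
  rw [← Multiset.coe_bind, Multiset.bind, Multiset.join, Fin.sum_univ_def]
  rw [← Multiset.sum_coe, Multiset.map_coe]
  congr 2
  refine List.map_congr_left fun j _ => ?_
  rw [← Multiset.map_coe, ← Multiset.filter_coe, ← Multiset.map_coe, Multiset.coe_toList,
    Multiset.filter_map, Multiset.map_map]
  rfl

/-- No word is ever kept, so the new memory is what has been received. A cell remembers something by
sending it to itself. -/
lemma coe_next (ω : (cellAlgorithm ρ Ω host first step out).Coins)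
    (t : Fin (ρ + 1)) (C : Config M) (X : Fin M → Multiset (ι × τ))
    (hX : ∀ j, (cellAlgorithm ρ Ω host first step out).sent ω t C j =
      (X j).toList.map fun y => (host y.1, encode y)) (i : Fin M) :
    (((cellAlgorithm ρ Ω host first step out).next ω t C i : List ℕ) : Multiset ℕ) =
      memory host (deliver (∑ j, X j)) i := by
  rw [← coe_received ω t C X hX]
  simp [Algorithm.next, cellAlgorithm]

lemma sent_zero (ω : (cellAlgorithm ρ Ω host first step out).Coins) (P : Placement M N)
    (j : Fin M) :
    (cellAlgorithm ρ Ω host first step out).sent ω ⟨0, Nat.succ_pos ρ⟩ (input P) j =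
      (first j (P j) (choice ω j)).toList.map fun y => (host y.1, encode y) := by
  simp only [Algorithm.sent, cellAlgorithm, if_true, input, decodeEdges_flatMap]
  rfl

lemma sent_succ (ω : (cellAlgorithm ρ Ω host first step out).Coins) {t : ℕ} (ht : t + 1 < ρ + 1)
    {C : Config M} {St : ι → Multiset τ}
    (hC : ∀ i, ((C i : List ℕ) : Multiset ℕ) = memory host St i) (j : Fin M) :
    (cellAlgorithm ρ Ω host first step out).sent ω ⟨t + 1, ht⟩ C j =
      (∑ α with host α = j, step t α (St α)).toList.map fun y => (host y.1, encode y) := by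
  simp only [Algorithm.sent, cellAlgorithm, Nat.add_one_ne_zero, if_false, Nat.add_sub_cancel]
  congr 2
  refine sum_congr rfl fun α hα => ?_
  rw [content_of_memory host St α]
  rw [hC, (mem_filter.1 hα).2]

/-- The first round of the machines turns the input into tokens, so the clock of the cells is one
behind that of the machines. -/
lemma coe_config (ω : (cellAlgorithm ρ Ω host first step out).Coins) (P : Placement M N) (t : ℕ)
    (ht : t ≤ ρ) (i : Fin M) :
    (((cellAlgorithm ρ Ω host first step out).config ω (input P) (t + 1) i : List ℕ) :
      Multiset ℕ) = memory host (runCells step (initialCells ω P) t) i := by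
  induction t generalizing i with
  | zero =>
    simp only [Algorithm.config]
    rw [dif_pos (show 0 < (cellAlgorithm ρ Ω host first step out).rounds from Nat.succ_pos ρ)]
    exact coe_next ω ⟨0, Nat.succ_pos ρ⟩ (input P) _ (sent_zero ω P) i
  | succ t ih =>
    have ih' := ih (by omega)
    have ht' : t + 1 < ρ + 1 := by omega
    rw [Algorithm.config, dif_pos
      (show t + 1 < (cellAlgorithm ρ Ω host first step out).rounds from ht')]
    refine (coe_next ω ⟨t + 1, ht'⟩ _ _ (sent_succ ω ht' ih') i).trans ?_
    congr 1
    rw [runCells]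
    congr 1
    exact sum_fiberwise univ host fun α => step t α (runCells step (initialCells ω P) t α)

/-- The run of a cell program succeeds if the loads of the cells are small enough. -/
lemma succeeds_cellAlgorithm {W s : ℕ} {S : ℝ} {σ : Fin N → Fin k} {P : Placement M N}
    (ω : (cellAlgorithm ρ Ω host first step out).Coins)
    (hNW : N ≤ W) (hW : Fintype.card (ι × τ) ≤ W) (hP : ∀ i, 2 * (P i).length ≤ s)
    (hPS : ((∑ i, 2 * (P i).length : ℕ) : ℝ) ≤ S)
    (hfirst : ∀ i, (first i (P i) (choice ω i)).card ≤ s)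
    (hload : ∀ t ≤ ρ, ∀ i,
      ∑ α with host α = i, (runCells step (initialCells ω P) t α).card ≤ s)
    (hsent : ∀ t < ρ, ∀ i,
      ∑ α with host α = i, (step t α (runCells step (initialCells ω P) t α)).card ≤ s)
    (htotal : ∀ t ≤ ρ, ((∑ α, (runCells step (initialCells ω P) t α).card : ℕ) : ℝ) ≤ S)
    (hout : ∀ i, (univ.filter fun α => host α = i ∧
      (out α (runCells step (initialCells ω P) ρ α)).isSome).card ≤ s)
    (hcorrect : ∃ ℓ : Fin N → Fin k,
      (∀ v c, (∃ α, out α (runCells step (initialCells ω P) ρ α) = some (v, c)) ↔ ℓ v = c) ∧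
        ∀ u v, ℓ u = ℓ v ↔ σ u = σ v) :
    Succeeds (cellAlgorithm ρ Ω host first step out) W s S σ P ω := by
  have hlen : ∀ t ≤ ρ, ∀ i,
      ((cellAlgorithm ρ Ω host first step out).config ω (input P) (t + 1) i).length =
        ∑ α with host α = i, (runCells step (initialCells ω P) t α).card := by
    intro t ht i
    rw [← Multiset.coe_card, coe_config ω P t ht i, memory, Multiset.card_sum]
    simp
  have hin : ∀ i, (input P i).length = 2 * (P i).length := by
    intro i
    simp [input, mul_comm]
  have houtput : ∀ i, (cellAlgorithm ρ Ω host first step out).output i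
      ((cellAlgorithm ρ Ω host first step out).config ω (input P) (ρ + 1) i) =
      (univ.filter fun α => host α = i).toList.filterMap
        fun α => out α (runCells step (initialCells ω P) ρ α) := by
    intro i
    refine List.filterMap_congr fun α hα => ?_
    have hα' : host α = i := by simpa using hα
    rw [content_of_memory host _ α]
    rw [hα', coe_config ω P ρ le_rfl i]
  refine ⟨?_, ?_, ?_, ?_, ?_, ?_⟩
  · rintro (_ | t) ht i w hw
    · obtain ⟨e, _, hw⟩ := List.mem_flatMap.1 hw
      have : w < N := by
        simp only [List.mem_cons, List.not_mem_nil, or_false] at hw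
        rcases hw with rfl | rfl
        · exact e.1.2
        · exact e.2.2
      omega
    · have hw' : w ∈ memory host (runCells step (initialCells ω P) t) i := by
        rw [← coe_config ω P t (Nat.le_of_succ_le_succ ht) i]; exact hw
      rw [memory, Multiset.mem_sum] at hw'
      obtain ⟨α, _, hα⟩ := hw'
      obtain ⟨x, _, rfl⟩ := Multiset.mem_map.1 hα
      exact (encode_lt _).trans_le hW
  · rintro (_ | t) ht i
    · exact (hin i).trans_le (hP i)
    · rw [hlen t (Nat.le_of_succ_le_succ ht)]; exact hload t (Nat.le_of_succ_le_succ ht) i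
  · rintro ⟨_ | t, ht⟩ i
    · have := sent_zero ω P i
      change ((cellAlgorithm ρ Ω host first step out).sent ω ⟨0, Nat.succ_pos ρ⟩
        (input P) i).length ≤ s
      rw [this]; simpa using hfirst i
    · have ht' : t < ρ := Nat.lt_of_succ_lt_succ ht
      have := sent_succ ω ht (coe_config ω P t ht'.le) i
      change ((cellAlgorithm ρ Ω host first step out).sent ω ⟨t + 1, ht⟩ _ i).length ≤ s
      rw [this]
      simpa [Multiset.card_sum] using hsent t ht' i
  · rintro (_ | t) ht
    · have : ∀ i, ((cellAlgorithm ρ Ω host first step out).config ω (input P) 0 i).length =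
        2 * (P i).length := hin
      simp_rw [this]; exact hPS
    · simp_rw [hlen t (Nat.le_of_succ_le_succ ht)]
      rw [sum_fiberwise univ host fun α => (runCells step (initialCells ω P) t α).card]
      exact htotal t (Nat.le_of_succ_le_succ ht)
  · intro i
    change ((cellAlgorithm ρ Ω host first step out).output i
      ((cellAlgorithm ρ Ω host first step out).config ω (input P) (ρ + 1) i)).length ≤ s
    rw [houtput]
    refine le_trans (le_of_eq ?_) (hout i)
    have hb : ∀ (l : List ι) (b : ι → Bool),
        ((l.filter b : List ι) : Multiset ι) = (l : Multiset ι).filter (fun a => b a = true) := by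
      intro l b
      rw [Multiset.filter_coe]; simp
    rw [List.length_filterMap_eq_countP, List.countP_eq_length_filter, ← Multiset.coe_card, hb,
      Finset.coe_toList, ← filter_filter]
    rfl
  · obtain ⟨ℓ, h1, h2⟩ := hcorrect
    refine ⟨ℓ, fun v c => ?_, h2⟩
    rw [← h1 v c]
    constructor
    · rintro ⟨i, hi⟩
      have hi' : (v, c) ∈ (cellAlgorithm ρ Ω host first step out).output i
        ((cellAlgorithm ρ Ω host first step out).config ω (input P) (ρ + 1) i) := hi
      rw [houtput, List.mem_filterMap] at hi'
      obtain ⟨α, _, hα⟩ := hi'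
      exact ⟨α, hα⟩
    · rintro ⟨α, hα⟩
      refine ⟨host α, ?_⟩
      change (v, c) ∈ (cellAlgorithm ρ Ω host first step out).output (host α)
        ((cellAlgorithm ρ Ω host first step out).config ω (input P) (ρ + 1) (host α))
      rw [houtput, List.mem_filterMap]
      exact ⟨α, by simp, hα⟩

end Cells
end MPC

/-! ### Networks of cells and sums along trees -/

namespace MPC
open Finset

section Network

variable {κ ν 𝒮 V : Type} [Fintype κ] [DecidableEq κ]

lemma sum_singleton_eq_map {κ V : Type*} (s : Finset κ) (x : κ → V) :
    ∑ α ∈ s, ({x α} : Multiset V) = s.val.map x :=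
  (congrArg Multiset.sum (Multiset.map_map (fun y : V => ({y} : Multiset V)) x s.val).symm).trans
    (Multiset.sum_map_singleton _)

/-- An instruction for a network of cells. Every cell updates its state and computes a value
from its state and the values that it has received, and sends this value to some cells, which
may depend on its neighbours. -/
structure Instr (κ ν 𝒮 V : Type) where
  run : κ → 𝒮 → Multiset V → 𝒮 × V
  dst : κ → Multiset ν → Multiset κ

/-- The states of the cells, and the values that they have received. -/
abbrev NetState (κ 𝒮 V : Type) := (κ → 𝒮) × (κ → Multiset V)

/-- The effect of an instruction. -/
def Instr.exec (nb : κ → Multiset ν) (I : Instr κ ν 𝒮 V) (X : NetState κ 𝒮 V) :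
    NetState κ 𝒮 V :=
  (fun α => (I.run α (X.1 α) (X.2 α)).1,
   fun β => ∑ α, Multiset.replicate ((I.dst α (nb α)).count β) (I.run α (X.1 α) (X.2 α)).2)

/-- The effect of a list of instructions. -/
def execAll (nb : κ → Multiset ν) (l : List (Instr κ ν 𝒮 V)) (X : NetState κ 𝒮 V) :
    NetState κ 𝒮 V :=
  l.foldl (fun X I => I.exec nb X) X

/-- The sum of a multiset with respect to a given addition. -/
def sumBy (A : AddCommMonoid V) (m : Multiset V) : V := letI := A; m.sum

/-- The sum of a family with respect to a given addition. -/
def finsumBy {κ : Type} (A : AddCommMonoid V) (s : Finset κ) (x : κ → V) : V :=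
  letI := A; ∑ α ∈ s, x α

lemma sumBy_singleton (A : AddCommMonoid V) (x : V) : sumBy A {x} = x := by
  let := A; exact Multiset.sum_singleton x

/-- Send the sum of what has been received to the parent. -/
def upInstr (A : AddCommMonoid V) (par : κ → κ) : Instr κ ν 𝒮 V where
  run _ s m := (s, sumBy A m)
  dst α _ := {par α}

/-- Send the sum of what has been received to all children. -/
def downInstr (A : AddCommMonoid V) (par : κ → κ) : Instr κ ν 𝒮 V where
  run _ s m := (s, sumBy A m)
  dst α _ := (univ.filter fun β => par β = α).val

/-- A local computation, with the sum of what has been received. -/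
def locInstr (A : AddCommMonoid V) (g : κ → 𝒮 → V → 𝒮 × V) : Instr κ ν 𝒮 V where
  run α s m := g α s (sumBy A m)
  dst α _ := {α}

/-- Send the sum of what has been received to the neighbours. -/
def exchInstr (A : AddCommMonoid V) (adr : κ → ν → κ) : Instr κ ν 𝒮 V where
  run _ s m := (s, sumBy A m)
  dst α nb := nb.map (adr α)

/-- Sum along the tree given by `par` and return the result to all cells. -/
def allReduce (A : AddCommMonoid V) (par : κ → κ) (D : ℕ) : List (Instr κ ν 𝒮 V) :=
  List.replicate D (upInstr A par) ++ List.replicate D (downInstr A par)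

variable (nb : κ → Multiset ν)

lemma execAll_append (l l' : List (Instr κ ν 𝒮 V)) (X : NetState κ 𝒮 V) :
    execAll nb (l ++ l') X = execAll nb l' (execAll nb l X) := by
  simp [execAll]

lemma execAll_singleton (I : Instr κ ν 𝒮 V) (X : NetState κ 𝒮 V) :
    execAll nb [I] X = I.exec nb X := rfl

lemma exec_upInstr (A : AddCommMonoid V) (par : κ → κ) (X : NetState κ 𝒮 V) :
    (upInstr A par).exec nb X =
      (X.1, fun β => (univ.filter fun α => par α = β).val.map fun α => sumBy A (X.2 α)) := by
  refine Prod.ext rfl (funext fun β => ?_)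
  simp only [Instr.exec, upInstr, Multiset.count_singleton]
  have : ∀ α, Multiset.replicate (if β = par α then 1 else 0) (sumBy A (X.2 α)) =
      if par α = β then {sumBy A (X.2 α)} else 0 := by
    intro α
    by_cases h : par α = β
    · rw [if_pos h, if_pos h.symm]; rfl
    · rw [if_neg h, if_neg (Ne.symm h)]; rfl
  simp_rw [this]
  rw [← sum_filter, sum_singleton_eq_map]

lemma exec_downInstr (A : AddCommMonoid V) (par : κ → κ) (X : NetState κ 𝒮 V) :
    (downInstr A par).exec nb X = (X.1, fun β => {sumBy A (X.2 (par β))}) := by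
  refine Prod.ext rfl (funext fun β => ?_)
  simp only [Instr.exec, downInstr]
  rw [sum_eq_single_of_mem (par β) (mem_univ _)]
  · rw [Multiset.count_eq_one_of_mem (Finset.nodup _) (by simp)]; rfl
  · intro α _ hα
    rw [Multiset.count_eq_zero_of_notMem (by simpa using hα.symm)]; rfl

lemma exec_locInstr (A : AddCommMonoid V) (g : κ → 𝒮 → V → 𝒮 × V) (X : NetState κ 𝒮 V) :
    (locInstr A g).exec nb X = (fun α => (g α (X.1 α) (sumBy A (X.2 α))).1,
      fun α => {(g α (X.1 α) (sumBy A (X.2 α))).2}) := by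
  refine Prod.ext rfl (funext fun β => ?_)
  simp only [Instr.exec, locInstr]
  rw [sum_eq_single_of_mem β (mem_univ _)]
  · simp
  · intro α _ hα
    rw [Multiset.count_singleton, if_neg (Ne.symm hα)]; rfl

/-- By induction a cell collects the total of its `d`-th generation of descendants. Only sums of the
received values are controlled, since with `d = 0` they have not been added up yet. -/
lemma sumBy_exec_replicate_up (A : AddCommMonoid V) (par : κ → κ) (d : ℕ)
    (X : NetState κ 𝒮 V) :
    (execAll nb (List.replicate d (upInstr A par)) X).1 = X.1 ∧
    ∀ β, sumBy A ((execAll nb (List.replicate d (upInstr A par)) X).2 β) =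
      finsumBy A (univ.filter fun α => par^[d] α = β) fun α => sumBy A (X.2 α) := by
  let := A
  induction d with
  | zero =>
    refine ⟨rfl, fun β => ?_⟩
    have h : (univ.filter fun α => par^[0] α = β) = {β} := by
      ext α; rw [mem_filter, mem_singleton]; exact ⟨fun h => h.2, fun h => ⟨mem_univ _, h⟩⟩
    rw [finsumBy, h, sum_singleton]
    rfl
  | succ d ih =>
    rw [List.replicate_succ', execAll_append]
    simp only [execAll, List.foldl_cons, List.foldl_nil]
    rw [exec_upInstr]
    refine ⟨ih.1, fun β => ?_⟩
    have h1 : sumBy A ((univ.filter fun α => par α = β).val.map fun α => sumBy A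
        ((execAll nb (List.replicate d (upInstr A par)) X).2 α)) =
        ∑ γ with par γ = β, ∑ α with par^[d] α = γ, sumBy A (X.2 α) :=
      sum_congr rfl fun γ _ => ih.2 γ
    refine h1.trans ?_
    simp only [finsumBy]
    rw [sum_filter]
    simp_rw [sum_filter]
    have : ∀ γ, (if par γ = β then ∑ α, (if par^[d] α = γ then sumBy A (X.2 α) else 0) else 0) =
        ∑ α, if par^[d] α = γ then (if par γ = β then sumBy A (X.2 α) else 0) else 0 := by
      intro γ
      split_ifs <;> simp
    simp_rw [this]
    rw [sum_comm]
    refine sum_congr rfl fun α _ => ?_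
    rw [sum_ite_eq, if_pos (mem_univ _), Function.iterate_succ_apply']

/-- At least one step is required: only then does every cell hold a single value. -/
lemma exec_replicate_down (A : AddCommMonoid V) (par : κ → κ) (d : ℕ) (X : NetState κ 𝒮 V) :
    execAll nb (List.replicate (d + 1) (downInstr A par)) X =
      (X.1, fun β => {sumBy A (X.2 (par^[d + 1] β))}) := by
  induction d generalizing X with
  | zero => exact exec_downInstr nb A par X
  | succ d ih =>
    rw [List.replicate_succ]
    change execAll nb (List.replicate (d + 1) (downInstr A par)) ((downInstr A par).exec nb X) = _
    rw [ih, exec_downInstr]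
    refine Prod.ext rfl (funext fun β => ?_)
    simp only [sumBy_singleton]
    rw [Function.iterate_succ_apply' par (d + 1)]

/-- The ancestor `par^[D] β` collects all cells with the same ancestor on the way up, and `β` reads
its value on the way down. No assumption on the shape of the tree is used. -/
lemma exec_allReduce (A : AddCommMonoid V) (par : κ → κ) {D : ℕ} (hD : 0 < D)
    (X : NetState κ 𝒮 V) :
    execAll nb (allReduce A par D) X = (X.1, fun β => {finsumBy A
      (univ.filter fun α => par^[D] α = par^[D] β) fun α => sumBy A (X.2 α)}) := by
  obtain ⟨d, rfl⟩ := Nat.exists_eq_succ_of_ne_zero hD.ne'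
  rw [allReduce, execAll_append, exec_replicate_down,
    (sumBy_exec_replicate_up nb A par (d + 1) X).1]
  refine Prod.ext rfl (funext fun β => ?_)
  simp only [(sumBy_exec_replicate_up nb A par (d + 1) X).2]

end Network
end MPC

/-! ### Truncated values and the grid of centres, vertices and parts -/

namespace MPC
open Finset

section Values

variable {B : ℕ}

/-- Truncation of a number to a value. -/
def emb (B x : ℕ) : Fin (B + 1) := ⟨min x B, by omega⟩

lemma emb_val {x : ℕ} (h : x ≤ B) : (emb B x).val = x := min_eq_left h

/-- Truncated addition. -/
@[reducible] def satAdd (B : ℕ) : AddCommMonoid (Fin (B + 1)) where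
  add x y := emb B (x.val + y.val)
  zero := emb B 0
  add_assoc x y z := Fin.ext (by
    change min (min (x.val + y.val) B + z.val) B = min (x.val + min (y.val + z.val) B) B; omega)
  zero_add x := Fin.ext (by change min (min 0 B + x.val) B = x.val; omega)
  add_zero x := Fin.ext (by change min (x.val + min 0 B) B = x.val; omega)
  add_comm x y := Fin.ext (by change min (x.val + y.val) B = min (y.val + x.val) B; omega)
  nsmul := @nsmulRec _ ⟨emb B 0⟩ ⟨fun x y => emb B (x.val + y.val)⟩
  nsmul_zero _ := rfl
  nsmul_succ _ _ := rfl

/-- The maximum as an addition. -/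
@[reducible] def maxAdd (B : ℕ) : AddCommMonoid (Fin (B + 1)) where
  add x y := max x y
  zero := emb B 0
  add_assoc x y z := max_assoc x y z
  zero_add x := Fin.ext (by
    change (max (emb B 0) x).val = x.val
    rw [max_eq_right]; exact Fin.le_def.2 (by simp [emb]))
  add_zero x := Fin.ext (by
    change (max x (emb B 0)).val = x.val
    rw [max_eq_left]; exact Fin.le_def.2 (by simp [emb]))
  add_comm x y := max_comm x y
  nsmul := @nsmulRec _ ⟨emb B 0⟩ ⟨fun x y => max x y⟩
  nsmul_zero _ := rfl
  nsmul_succ _ _ := rfl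

/-- Truncation at `B` commutes with truncated addition. Values thus stay in a finite type, and they
are exact whenever the true result is at most `B`. -/
lemma finsumBy_satAdd {κ : Type} (s : Finset κ) (x : κ → ℕ) :
    finsumBy (satAdd B) s (fun α => emb B (x α)) = emb B (∑ α ∈ s, x α) := by
  classical
  let := satAdd B
  unfold finsumBy
  induction s using Finset.induction_on with
  | empty => rfl
  | insert a s ha ih =>
    rw [sum_insert ha, sum_insert ha, ih]
    refine Fin.ext ?_
    change min (min (x a) B + min (∑ α ∈ s, x α) B) B = min (x a + ∑ α ∈ s, x α) B
    omega

lemma finsumBy_maxAdd {κ : Type} (s : Finset κ) (x : κ → ℕ) :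
    finsumBy (maxAdd B) s (fun α => emb B (x α)) = emb B (s.sup x) := by
  classical
  let := maxAdd B
  unfold finsumBy
  induction s using Finset.induction_on with
  | empty => rfl
  | insert a s ha ih =>
    rw [sum_insert ha, sup_insert, ih]
    refine Fin.ext ?_
    change (max (emb B (x a)) (emb B (s.sup x))).val = min (max (x a) (s.sup x)) B
    rw [Fin.coe_max]
    simp only [emb]
    omega

lemma sumBy_add (A : AddCommMonoid (Fin (B + 1))) (m m' : Multiset (Fin (B + 1))) :
    sumBy A (m + m') = A.add (sumBy A m) (sumBy A m') := by
  let := A; exact Multiset.sum_add m m'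

lemma sumBy_satAdd_sum_replicate {κ : Type} (s : Finset κ) (c x : κ → ℕ) :
    sumBy (satAdd B) (∑ α ∈ s, Multiset.replicate (c α) (emb B (x α))) =
      emb B (∑ α ∈ s, c α * x α) := by
  classical
  have hrep : ∀ c x : ℕ, sumBy (satAdd B) (Multiset.replicate c (emb B x)) = emb B (c * x) := by
    intro c x
    induction c with
    | zero => rw [zero_mul]; rfl
    | succ c ih =>
      rw [Multiset.replicate_succ, ← Multiset.singleton_add, sumBy_add, ih, sumBy_singleton]
      refine Fin.ext ?_
      change min (min x B + min (c * x) B) B = min ((c + 1) * x) B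
      rw [add_mul, one_mul]
      omega
  induction s using Finset.induction_on with
  | empty => rfl
  | insert a s ha ih =>
    rw [sum_insert ha, sum_insert ha, sumBy_add, ih, hrep]
    refine Fin.ext ?_
    change min (min (c a * x a) B + min (∑ α ∈ s, c α * x α) B) B =
      min (c a * x a + ∑ α ∈ s, c α * x α) B
    omega

end Values

/-- The parent in the tree with fan-out `f` on `0, …, X - 1`. -/
def divFin {X : ℕ} (f : ℕ) (x : Fin X) : Fin X := ⟨x / f, (Nat.div_le_self _ _).trans_lt x.2⟩

lemma divFin_iterate {X f D : ℕ} [NeZero X] (hD : X ≤ f ^ D) (x : Fin X) :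
    (divFin f)^[D] x = 0 := by
  have h : ∀ d (x : Fin X), ((divFin f)^[d] x).val = x / f ^ d := by
    intro d
    induction d with
    | zero => simp
    | succ d ih =>
      intro x
      rw [Function.iterate_succ_apply, ih, pow_succ']
      simp [divFin, Nat.div_div_eq_div_mul]
  refine Fin.ext ?_
  rw [h, Nat.div_eq_of_lt (x.2.trans_le hD)]
  simp

lemma card_divFin_le {X f : ℕ} (hf : 0 < f) (y : Fin X) :
    (univ.filter fun x : Fin X => divFin f x = y).card ≤ f := by
  have : (univ.filter fun x : Fin X => divFin f x = y).card ≤ (Finset.range f).card := by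
    refine card_le_card_of_injOn (fun x => x.val % f) (fun x _ => ?_) ?_
    · simpa using Nat.mod_lt _ hf
    · intro a ha b hb hab
      simp only [coe_filter, mem_univ, true_and] at ha hb
      have ha' : a.val / f = y := congrArg Fin.val ha
      have hb' : b.val / f = y := congrArg Fin.val hb
      refine Fin.ext ?_
      rw [← Nat.div_add_mod a.val f, ← Nat.div_add_mod b.val f, ha', hb']
      simpa using hab
  simpa using this

section Grid

variable {T N R : ℕ}

/-- The cells of the main computation: a cell for each centre, vertex, and part of the
neighbourhood of the vertex. -/
abbrev Grid (T N R : ℕ) := Fin T × Fin N × Fin R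

/-- Trees along one of the three coordinates, for any fixed values of the other two. Sums along them
are sums over centres, vertices, or parts. -/
def parCentre (f : ℕ) (α : Grid T N R) : Grid T N R := (divFin f α.1, α.2)
def parVertex (f : ℕ) (α : Grid T N R) : Grid T N R := (α.1, divFin f α.2.1, α.2.2)
def parPart (f : ℕ) (α : Grid T N R) : Grid T N R := (α.1, α.2.1, divFin f α.2.2)

/-- The address of a neighbour. -/
def nbrCell (α : Grid T N R) (w : Fin N) : Grid T N R := (α.1, w, α.2.2)

lemma count_map_nbrCell (nb : Multiset (Fin N)) (α β : Grid T N R) :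
    (nb.map (nbrCell α)).count β =
      if α.1 = β.1 ∧ α.2.2 = β.2.2 then nb.count β.2.1 else 0 := by
  split_ifs with hα
  · have : β = nbrCell α β.2.1 := by rw [nbrCell, hα.1, hα.2]
    conv_lhs => rw [this]
    rw [Multiset.count_map_eq_count' (nbrCell α)]
    intro a b hab
    exact congrArg (fun γ => γ.2.1) hab
  · rw [Multiset.count_eq_zero]
    intro hm
    obtain ⟨w, _, rfl⟩ := Multiset.mem_map.1 hm
    exact hα ⟨rfl, rfl⟩

lemma sum_grid_fibre (β : Grid T N R) (g : Grid T N R → ℕ) :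
    ∑ α : Grid T N R, (if α.1 = β.1 ∧ α.2.2 = β.2.2 then g α else 0) =
      ∑ v, g (β.1, v, β.2.2) := by
  rw [← sum_filter]
  symm
  refine sum_bij (fun v _ => (β.1, v, β.2.2)) ?_ ?_ ?_ ?_
  · intro v _; simp
  · intro a _ b _ h; exact congrArg (fun γ => γ.2.1) h
  · rintro ⟨t, v, ρ⟩ h
    simp only [mem_filter, mem_univ, true_and] at h
    exact ⟨v, mem_univ _, by rw [← h.1, ← h.2]⟩
  · intro v _; rfl

variable [NeZero T] [NeZero N] [NeZero R] {f D : ℕ}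

lemma parCentre_iterate (hD : T ≤ f ^ D) (α : Grid T N R) :
    (parCentre f)^[D] α = (0, α.2) := by
  have h : ∀ d (α : Grid T N R), (parCentre f)^[d] α = ((divFin f)^[d] α.1, α.2) := by
    intro d
    induction d with
    | zero => intro α; rfl
    | succ d ih => intro α; rw [Function.iterate_succ_apply, ih]; rfl
  rw [h, divFin_iterate hD]

lemma parVertex_iterate (hD : N ≤ f ^ D) (α : Grid T N R) :
    (parVertex f)^[D] α = (α.1, 0, α.2.2) := by
  have h : ∀ d (α : Grid T N R), (parVertex f)^[d] α = (α.1, (divFin f)^[d] α.2.1, α.2.2) := by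
    intro d
    induction d with
    | zero => intro α; rfl
    | succ d ih => intro α; rw [Function.iterate_succ_apply, ih]; rfl
  rw [h, divFin_iterate hD]

lemma parPart_iterate (hD : R ≤ f ^ D) (α : Grid T N R) :
    (parPart f)^[D] α = (α.1, α.2.1, 0) := by
  have h : ∀ d (α : Grid T N R), (parPart f)^[d] α = (α.1, α.2.1, (divFin f)^[d] α.2.2) := by
    intro d
    induction d with
    | zero => intro α; rfl
    | succ d ih => intro α; rw [Function.iterate_succ_apply, ih]; rfl
  rw [h, divFin_iterate hD]

variable {ν 𝒮 V : Type} (nb : Grid T N R → Multiset ν)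

lemma finsumBy_congr {κ κ' : Type} (A : AddCommMonoid V) (s : Finset κ) (e : κ' → κ)
    (s' : Finset κ') (he : Set.InjOn e s') (hs : ∀ α, α ∈ s ↔ ∃ x ∈ s', e x = α) (x : κ → V) :
    finsumBy A s x = finsumBy A s' fun i => x (e i) := by
  classical
  let := A
  have : s = s'.image e := by ext α; rw [mem_image]; exact hs α
  unfold finsumBy
  rw [this, sum_image he]

lemma exec_allReduce_centre (A : AddCommMonoid V) (hD0 : 0 < D) (hD : T ≤ f ^ D)
    (X : NetState (Grid T N R) 𝒮 V) :
    execAll nb (allReduce A (parCentre f) D) X = (X.1, fun β => {finsumBy A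
      univ fun t => sumBy A (X.2 (t, β.2))}) := by
  rw [exec_allReduce nb A _ hD0]
  refine Prod.ext rfl (funext fun β => ?_)
  simp only [parCentre_iterate hD]
  rw [finsumBy_congr A _ (fun t => (t, β.2)) univ]
  · exact fun a _ b _ h => congrArg Prod.fst h
  · rintro ⟨t, v⟩
    simp [eq_comm]

lemma exec_allReduce_vertex (A : AddCommMonoid V) (hD0 : 0 < D) (hD : N ≤ f ^ D)
    (X : NetState (Grid T N R) 𝒮 V) :
    execAll nb (allReduce A (parVertex f) D) X = (X.1, fun β => {finsumBy A
      univ fun v => sumBy A (X.2 (β.1, v, β.2.2))}) := by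
  rw [exec_allReduce nb A _ hD0]
  refine Prod.ext rfl (funext fun β => ?_)
  simp only [parVertex_iterate hD]
  rw [finsumBy_congr A _ (fun v => (β.1, v, β.2.2)) univ]
  · exact fun a _ b _ h => congrArg (fun α => α.2.1) h
  · rintro ⟨t, v, ρ⟩
    simp [eq_comm]

lemma exec_allReduce_part (A : AddCommMonoid V) (hD0 : 0 < D) (hD : R ≤ f ^ D)
    (X : NetState (Grid T N R) 𝒮 V) :
    execAll nb (allReduce A (parPart f) D) X = (X.1, fun β => {finsumBy A
      univ fun ρ => sumBy A (X.2 (β.1, β.2.1, ρ))}) := by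
  rw [exec_allReduce nb A _ hD0]
  refine Prod.ext rfl (funext fun β => ?_)
  simp only [parPart_iterate hD]
  rw [finsumBy_congr A _ (fun ρ => (β.1, β.2.1, ρ)) univ]
  · exact fun a _ b _ h => congrArg (fun α => α.2.2) h
  · rintro ⟨t, v, ρ⟩
    simp [eq_comm]

/-- An exchange multiplies the vector of values by an adjacency matrix, separately for every centre
and part; summing over the parts afterwards yields the product with the matrix of the whole
subgraph. -/
lemma sumBy_exec_exch {B : ℕ} (nb : Grid T N R → Multiset (Fin N))
    (X : NetState (Grid T N R) 𝒮 (Fin (B + 1))) (x : Grid T N R → ℕ)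
    (hx : ∀ α, sumBy (satAdd B) (X.2 α) = emb B (x α)) :
    ((exchInstr (satAdd B) nbrCell).exec nb X).1 = X.1 ∧ ∀ β,
    sumBy (satAdd B) (((exchInstr (satAdd B) nbrCell).exec nb X).2 β) =
      emb B (∑ v, (nb (β.1, v, β.2.2)).count β.2.1 * x (β.1, v, β.2.2)) := by
  refine ⟨rfl, fun β => ?_⟩
  simp only [Instr.exec, exchInstr, hx]
  rw [sumBy_satAdd_sum_replicate]
  congr 1
  simp_rw [count_map_nbrCell, ite_mul, zero_mul]
  exact sum_grid_fibre β fun α => (nb α).count β.2.1 * x α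

end Grid
end MPC

/-! ### The clustering program -/

namespace MPC
open Finset

section Clustering

variable {T N R : ℕ}

/-- The number of common neighbours of the centre `c t` and of `v` in the `t`-th graph. -/
def pathCount (a : Fin T → Fin N → Fin N → ℕ) (c : Fin T → Fin N) (t : Fin T) (v : Fin N) : ℕ :=
  ∑ w, a t w v * a t (c t) w

/-- The largest number of common neighbours of `v` and a centre other than `v`. -/
def maxCount (d : Fin T → Fin N → ℕ) (c : Fin T → Fin N) (v : Fin N) : ℕ :=
  univ.sup fun t => if v = c t then 0 else d t v

/-- `B` minus the smallest number of common neighbours of `v` and a centre other than `v`. -/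
def coMinCount (B : ℕ) (d : Fin T → Fin N → ℕ) (c : Fin T → Fin N) (v : Fin N) : ℕ :=
  univ.sup fun t => if v = c t then 0 else B - d t v

/-- The algorithm finds that the centre `c t` and `v` belong to the same cluster. -/
def Same (one : Prop) (B : ℕ) (d : Fin T → Fin N → ℕ) (c : Fin T → Fin N) (t : Fin T)
    (v : Fin N) : Prop :=
  one ∨ v = c t ∨ maxCount d c v + B ≤ 2 * d t v + coMinCount B d c v

open Classical in
/-- `T - t`, where `t` is the first centre in the cluster of `v`. -/
noncomputable def coFirst (same : Fin T → Fin N → Prop) (v : Fin N) : ℕ :=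
  univ.sup fun t => if same t v then T - t.val else 0

/-- Whether `c t` is the first centre in its cluster. -/
noncomputable def leader (same : Fin T → Fin N → Prop) (c : Fin T → Fin N) (t : Fin T) : ℕ :=
  ∑ v, if v = c t ∧ T - t.val = coFirst same v then 1 else 0

/-- The number of clusters with a smaller first centre. -/
noncomputable def rank (same : Fin T → Fin N → Prop) (c : Fin T → Fin N) (v : Fin N) : ℕ :=
  ∑ t, if coFirst same v < T - t.val then leader same c t else 0

lemma coFirst_le (same : Fin T → Fin N → Prop) (v : Fin N) : coFirst same v ≤ T := by
  classical
  refine Finset.sup_le fun t _ => ?_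
  split_ifs <;> omega

lemma leader_eq (same : Fin T → Fin N → Prop) (c : Fin T → Fin N) (t : Fin T) :
    leader same c t = if T - t.val = coFirst same (c t) then 1 else 0 := by
  classical
  unfold leader
  rw [sum_eq_single_of_mem (c t) (mem_univ _)]
  · simp
  · intro v _ hv; simp [hv]

lemma leader_le_one (same : Fin T → Fin N → Prop) (c : Fin T → Fin N) (t : Fin T) :
    leader same c t ≤ 1 := by
  rw [leader_eq]; split_ifs <;> omega

variable {B : ℕ}

/-- The registers of a cell. -/
abbrev Regs (B : ℕ) := Fin (B + 1) × Fin (B + 1) × Fin (B + 1)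

open Classical in
/-- The main part of the algorithm. -/
noncomputable def program (one : Prop) (B f D : ℕ) :
    List (Instr (Grid T N R) (Fin N) (Regs B) (Fin (B + 1))) :=
  -- The name of the centre is initially known to the cell `(t, 0, 0)` only; these sums tell it to
  -- all cells of the centre.
  allReduce (satAdd B) (parVertex f) D ++ allReduce (satAdd B) (parPart f) D ++
  [locInstr (satAdd B) fun α _ x => ((x, emb B 0, emb B 0),
    emb B (if α.2.1.val = x.val then 1 else 0))] ++
  -- Two multiplications of the indicator of the centre by the adjacency matrix count the paths of
  -- length two.
  [exchInstr (satAdd B) nbrCell] ++ allReduce (satAdd B) (parPart f) D ++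
  [exchInstr (satAdd B) nbrCell] ++ allReduce (satAdd B) (parPart f) D ++
  [locInstr (satAdd B) fun α s x => ((s.1, x, emb B 0),
    emb B (if α.2.1.val = s.1.val then 0 else x.val))] ++
  -- The largest count of each vertex, followed by `B` minus the smallest one, so that both are
  -- maxima. A vertex that is itself the centre contributes the neutral value `0`.
  allReduce (maxAdd B) (parCentre f) D ++
  [locInstr (satAdd B) fun α s x => ((s.1, s.2.1, x),
    emb B (if α.2.1.val = s.1.val then 0 else B - s.2.1.val))] ++
  allReduce (maxAdd B) (parCentre f) D ++
  -- As `T - t` is positive and decreasing in `t`, its maximum points to the first centre in the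
  -- cluster, and `0` stands for no centre.
  [locInstr (satAdd B) fun α s x => ((s.1, emb B 0, emb B 0),
    emb B (if one ∨ α.2.1.val = s.1.val ∨ s.2.2.val + B ≤ 2 * s.2.1.val + x.val
      then T - α.1.val else 0))] ++
  allReduce (maxAdd B) (parCentre f) D ++
  -- Only the cells at the vertex `c t` know whether the centre `t` is a leader; the sum over the
  -- vertices tells the others.
  [locInstr (satAdd B) fun α s x => ((s.1, emb B 0, x),
    emb B (if α.2.1.val = s.1.val ∧ T - α.1.val = x.val then 1 else 0))] ++
  allReduce (satAdd B) (parVertex f) D ++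
  [locInstr (satAdd B) fun α s x => (s, emb B (if s.2.2.val < T - α.1.val then x.val else 0))] ++
  allReduce (satAdd B) (parCentre f) D

variable [NeZero T] [NeZero N] [NeZero R] {f D : ℕ}

/-- Every stage is evaluated in closed form. The bounds by `B` ensure that no register that is read
later has been truncated. -/
lemma exec_program (one : Prop) (nb : Grid T N R → Multiset (Fin N)) (c : Fin T → Fin N)
    (a : Fin T → Fin N → Fin N → ℕ)
    (ha : ∀ t v w, ∑ ρ, (nb (t, v, ρ)).count w = a t v w)
    (hB : ∀ t v, pathCount a c t v ≤ B) (hNB : N ≤ B) (hTB : T ≤ B)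
    (hD0 : 0 < D) (hDT : T ≤ f ^ D) (hDN : N ≤ f ^ D) (hDR : R ≤ f ^ D)
    (X : NetState (Grid T N R) (Regs B) (Fin (B + 1)))
    (hX : ∀ α, sumBy (satAdd B) (X.2 α) =
      emb B (if α.2.1 = 0 ∧ α.2.2 = 0 then (c α.1).val else 0)) :
    (execAll nb (program one B f D) X).2 = fun β =>
      {emb B (rank (Same one B (pathCount a c) c) c β.2.1)} := by
  classical
  have hc : ∀ t, (c t).val ≤ B := fun t => (c t).2.le.trans hNB
  simp only [program, List.append_assoc]
  rw [execAll_append, exec_allReduce_vertex nb _ hD0 hDN]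
  simp only [hX, finsumBy_satAdd]
  rw [execAll_append, exec_allReduce_part nb _ hD0 hDR]
  simp only [sumBy_singleton, finsumBy_satAdd]
  have e1 : ∀ t : Fin T, (∑ ρ : Fin R, ∑ v : Fin N, if v = 0 ∧ ρ = 0 then (c t).val else 0) =
      (c t).val := by
    intro t
    rw [sum_eq_single_of_mem 0 (mem_univ _), sum_eq_single_of_mem 0 (mem_univ _)]
    · simp
    · intro v _ hv; simp [hv]
    · intro ρ _ hρ; simp [hρ]
  simp only [e1]
  rw [execAll_append, execAll_singleton, exec_locInstr]
  simp only [sumBy_singleton, emb_val (hc _)]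
  obtain ⟨g1, g2⟩ := sumBy_exec_exch (B := B) nb ((fun α : Grid T N R => (emb B (c α.1).val,
    emb B 0, emb B 0)), fun α : Grid T N R => {emb B (if α.2.1.val = (c α.1).val then 1 else 0)})
    (fun α => if α.2.1.val = (c α.1).val then 1 else 0) (fun α => sumBy_singleton _ _)
  rw [execAll_append, execAll_singleton, execAll_append, exec_allReduce_part nb _ hD0 hDR, g1]
  have e2 : ∀ (t : Fin T) (w : Fin N), (∑ ρ : Fin R, ∑ v : Fin N, (nb (t, v, ρ)).count w *
      (if v.val = (c t).val then 1 else 0)) = a t (c t) w := by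
    intro t w
    rw [← ha]
    refine sum_congr rfl fun ρ _ => ?_
    rw [sum_eq_single_of_mem (c t) (mem_univ _)]
    · simp
    · intro v _ hv
      rw [if_neg (fun h => hv (Fin.ext h)), mul_zero]
  simp only [g2, finsumBy_satAdd, e2]
  obtain ⟨g5, g6⟩ := sumBy_exec_exch (B := B) nb ((fun α : Grid T N R =>
    (emb B (c α.1).val, emb B 0, emb B 0)),
    fun α : Grid T N R => {emb B (a α.1 (c α.1) α.2.1)})
    (fun α => a α.1 (c α.1) α.2.1) (fun α => sumBy_singleton _ _)
  rw [execAll_append, execAll_singleton, execAll_append, exec_allReduce_part nb _ hD0 hDR, g5]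
  have e3 : ∀ (t : Fin T) (w : Fin N), (∑ ρ : Fin R, ∑ v : Fin N, (nb (t, v, ρ)).count w *
      a t (c t) v) = pathCount a c t w := by
    intro t w
    rw [sum_comm]
    refine sum_congr rfl fun v _ => ?_
    rw [← ha t v w, sum_mul]
  simp only [g6, finsumBy_satAdd, e3]
  have hmax : ∀ v, maxCount (pathCount a c) c v ≤ B := by
    intro v
    refine Finset.sup_le fun t _ => ?_
    split_ifs
    · omega
    · exact hB t v
  have hmin : ∀ v, coMinCount B (pathCount a c) c v ≤ B := by
    intro v
    refine Finset.sup_le fun t _ => ?_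
    split_ifs <;> omega
  set d := pathCount a c with hd
  set same := Same one B d c with hsame
  have hfirst : ∀ v, coFirst same v ≤ B := fun v => (coFirst_le same v).trans hTB
  have hlead : ∀ t, leader same c t ≤ B := by
    intro t
    have : 0 < N := Nat.pos_of_ne_zero (NeZero.ne N)
    have := leader_le_one same c t
    omega
  have m1 : ∀ v : Fin N, (univ.sup fun t : Fin T => if v.val = (c t).val then 0 else d t v) =
      maxCount d c v := by
    intro v; simp only [maxCount, Fin.ext_iff]
  have m2 : ∀ v : Fin N, (univ.sup fun t : Fin T => if v.val = (c t).val then 0 else B - d t v) =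
      coMinCount B d c v := by
    intro v; simp only [coMinCount, Fin.ext_iff]
  have m3 : ∀ v : Fin N, (univ.sup fun t : Fin T => if one ∨ v.val = (c t).val ∨
      maxCount d c v + B ≤ 2 * d t v + coMinCount B d c v then T - t.val else 0) =
      coFirst same v := by
    intro v; simp only [coFirst, hsame, Same, Fin.ext_iff]
  have m4 : ∀ t : Fin T, (∑ v : Fin N, if v.val = (c t).val ∧ T - t.val = coFirst same v then 1
      else 0) = leader same c t := by
    intro t; simp only [leader, Fin.ext_iff]
  rw [execAll_append, execAll_singleton, exec_locInstr]
  simp only [sumBy_singleton, emb_val (hc _), emb_val (hB _ _)]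
  rw [execAll_append, exec_allReduce_centre nb _ hD0 hDT]
  simp only [sumBy_singleton, finsumBy_maxAdd, m1]
  rw [execAll_append, execAll_singleton, exec_locInstr]
  simp only [sumBy_singleton, emb_val (hc _), emb_val (hB _ _)]
  rw [execAll_append, exec_allReduce_centre nb _ hD0 hDT]
  simp only [sumBy_singleton, finsumBy_maxAdd, m2]
  rw [execAll_append, execAll_singleton, exec_locInstr]
  simp only [sumBy_singleton, emb_val (hc _), emb_val (hB _ _), emb_val (hmax _), emb_val (hmin _)]
  rw [execAll_append, exec_allReduce_centre nb _ hD0 hDT]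
  simp only [sumBy_singleton, finsumBy_maxAdd, m3]
  rw [execAll_append, execAll_singleton, exec_locInstr]
  simp only [sumBy_singleton, emb_val (hc _), emb_val (hfirst _)]
  rw [execAll_append, exec_allReduce_vertex nb _ hD0 hDN]
  simp only [sumBy_singleton, finsumBy_satAdd, m4]
  rw [execAll_append, execAll_singleton, exec_locInstr]
  simp only [sumBy_singleton, emb_val (hfirst _), emb_val (hlead _)]
  rw [exec_allReduce_centre nb _ hD0 hDT]
  simp only [sumBy_singleton, finsumBy_satAdd]
  rfl

end Clustering
end MPC

/-! ### Correctness of the thresholds and of the labels -/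

namespace MPC
open Finset

section Correctness

variable {T N k : ℕ} {σ : Fin N → Fin k} {c : Fin T → Fin N} {same : Fin T → Fin N → Prop}

/-- Since `T - t > 0` for every index, the maximum is not the default `0` once the cluster contains
a centre, and it is attained at the smallest such index. -/
lemma coFirst_spec (hs : ∀ t v, same t v ↔ σ (c t) = σ v) (v : Fin N)
    (hv : ∃ t, σ (c t) = σ v) :
    ∃ t₀, coFirst same v = T - t₀.val ∧ σ (c t₀) = σ v ∧ ∀ t, σ (c t) = σ v → t₀ ≤ t := by
  classical
  obtain ⟨t, ht⟩ := hv
  have hle : ∀ t, σ (c t) = σ v → T - t.val ≤ coFirst same v := by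
    intro t ht
    have := Finset.le_sup (f := fun t => if same t v then T - t.val else 0) (mem_univ t)
    rw [if_pos ((hs t v).2 ht)] at this
    exact this
  obtain ⟨t₀, -, h₀⟩ := Finset.exists_mem_eq_sup univ ⟨t, mem_univ t⟩
    (fun t => if same t v then T - t.val else 0)
  have h₀' : coFirst same v = if same t₀ v then T - t₀.val else 0 := h₀
  have hpos := hle t ht
  have hT := t.2
  split_ifs at h₀' with h1
  · refine ⟨t₀, h₀', (hs _ _).1 h1, fun t' ht' => ?_⟩
    have h2 := hle t' ht'
    rw [h₀'] at h2
    have h3 := t₀.2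
    have h4 := t'.2
    exact Fin.le_def.2 (by omega)
  · omega

/-- The ranks of the first centres name the clusters. -/
lemma rank_spec (hs : ∀ t v, same t v ↔ σ (c t) = σ v) (hv : ∀ v, ∃ t, σ (c t) = σ v) :
    ∃ ℓ : Fin N → Fin k, (∀ v, (ℓ v).val = rank same c v) ∧ ∀ u v, ℓ u = ℓ v ↔ σ u = σ v := by
  classical
  choose F hF1 hF2 hF3 using fun v => coFirst_spec hs v (hv v)
  have hFeq : ∀ u v, σ u = σ v → F u = F v := fun u v h =>
    le_antisymm (hF3 u _ ((hF2 v).trans h.symm)) (hF3 v _ ((hF2 u).trans h))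
  have hFF : ∀ v, F (c (F v)) = F v := fun v => hFeq _ _ (hF2 v)
  set Ld : Finset (Fin T) := univ.filter fun t => F (c t) = t with hLd
  have hrank : ∀ v, rank same c v = (Ld.filter fun t => t < F v).card := by
    intro v
    rw [rank, card_eq_sum_ones, sum_filter, hLd, sum_filter]
    refine sum_congr rfl fun t _ => ?_
    rw [leader_eq, hF1, hF1]
    have h1 := t.2
    have h2 := (F v).2
    have h3 := (F (c t)).2
    simp only [Fin.lt_def, Fin.ext_iff]
    split_ifs <;> omega
  have hmem : ∀ v, F v ∈ Ld := fun v => by simp [hLd, hFF]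
  -- There is at most one leader in each cluster.
  have hinj : Ld.card ≤ k := by
    have := card_le_card_of_injOn (s := Ld) (t := (univ : Finset (Fin k))) (fun t => σ (c t))
      (fun _ _ => mem_univ _) (by
        intro a ha b hb hab
        have ha' : F (c a) = a := (mem_filter.1 ha).2
        have hb' : F (c b) = b := (mem_filter.1 hb).2
        rw [← ha', ← hb']
        exact hFeq _ _ hab)
    simpa using this
  -- The leader `F u` itself is counted for `v` but not for `u`, so ranks of different clusters
  -- differ.
  have hlt : ∀ u v, F u < F v → rank same c u < rank same c v := by
    intro u v h
    rw [hrank, hrank]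
    refine card_lt_card (Finset.ssubset_iff_subset_ne.2 ⟨?_, ?_⟩)
    · intro t ht
      rw [mem_filter] at ht ⊢
      exact ⟨ht.1, ht.2.trans h⟩
    · intro heq
      have : F u ∈ Ld.filter fun t => t < F v := mem_filter.2 ⟨hmem u, h⟩
      rw [← heq, mem_filter] at this
      exact lt_irrefl _ this.2
  have hk : ∀ v, rank same c v < k := by
    intro v
    refine lt_of_lt_of_le ?_ hinj
    rw [hrank]
    refine card_lt_card (Finset.ssubset_iff_subset_ne.2 ⟨filter_subset _ _, ?_⟩)
    intro heq
    have := hmem v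
    rw [← heq, mem_filter] at this
    exact lt_irrefl _ this.2
  refine ⟨fun v => ⟨rank same c v, hk v⟩, fun v => rfl, fun u v => ?_⟩
  rw [Fin.mk.injEq]
  constructor
  · intro h
    have hFuv : F u = F v := by
      rcases lt_trichotomy (F u) (F v) with h1 | h1 | h1
      · exact absurd h (hlt _ _ h1).ne
      · exact h1
      · exact absurd h (hlt _ _ h1).ne'
    rw [← hF2 u, ← hF2 v, hFuv]
  · intro h
    rw [hrank, hrank, hFeq u v h]

/-- The thresholds of the algorithm separate the clusters. -/
lemma same_iff {B : ℕ} {d : Fin T → Fin N → ℕ} {h Δ : ℝ} (hΔ : 0 < Δ) (hB : ∀ t v, d t v ≤ B)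
    (hd : ∀ t v, v ≠ c t →
      (σ (c t) = σ v → h + 7 / 8 * Δ ≤ d t v ∧ d t v ≤ h + 17 / 16 * Δ) ∧
      (σ (c t) ≠ σ v → h - Δ / 8 ≤ d t v ∧ d t v ≤ h + Δ / 16))
    (h1 : ∀ v, ∃ t, v ≠ c t ∧ σ (c t) = σ v) (h2 : ∀ v, ∃ t, σ (c t) ≠ σ v)
    {one : Prop} (hone : ¬ one) (t : Fin T) (v : Fin N) :
    Same one B d c t v ↔ σ (c t) = σ v := by
  classical
  by_cases hvt : v = c t
  · simp [Same, hvt]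
  have hBr : ∀ t v, (d t v : ℝ) ≤ B := fun t v => by exact_mod_cast hB t v
  obtain ⟨t₁, hv₁, hs₁⟩ := h1 v
  obtain ⟨t₂, hs₂⟩ := h2 v
  have hv₂ : v ≠ c t₂ := by rintro rfl; exact hs₂ rfl
  obtain ⟨a1, a2⟩ := (hd t₁ v hv₁).1 hs₁
  obtain ⟨b1, b2⟩ := (hd t₂ v hv₂).2 hs₂
  have hmax_ge : h + 7 / 8 * Δ ≤ maxCount d c v := by
    have := Finset.le_sup (f := fun t => if v = c t then 0 else d t v) (mem_univ t₁)
    rw [if_neg hv₁] at this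
    have h3 : (d t₁ v : ℝ) ≤ maxCount d c v := by exact_mod_cast this
    linarith
  have hmax_le : (maxCount d c v : ℝ) ≤ h + 17 / 16 * Δ := by
    obtain ⟨t', -, ht'⟩ := Finset.exists_mem_eq_sup univ ⟨t, mem_univ t⟩
      (fun t => if v = c t then 0 else d t v)
    have ht'' : maxCount d c v = if v = c t' then 0 else d t' v := ht'
    rw [ht'']
    split_ifs with h3
    -- The default `0` does no harm: the upper bound also bounds the nonnegative number `d t₁ v`.
    · have : (0 : ℝ) ≤ d t₁ v := Nat.cast_nonneg _
      push_cast; linarith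
    · by_cases h4 : σ (c t') = σ v
      · exact ((hd t' v h3).1 h4).2
      · have := ((hd t' v h3).2 h4).2
        linarith
  have hmin_ge : B - (h + Δ / 16) ≤ (coMinCount B d c v : ℝ) := by
    have := Finset.le_sup (f := fun t => if v = c t then 0 else B - d t v) (mem_univ t₂)
    rw [if_neg hv₂] at this
    have h3 : ((B - d t₂ v : ℕ) : ℝ) ≤ coMinCount B d c v := by exact_mod_cast this
    rw [Nat.cast_sub (hB _ _)] at h3
    linarith
  have hmin_le : (coMinCount B d c v : ℝ) ≤ B - (h - Δ / 8) := by
    obtain ⟨t', -, ht'⟩ := Finset.exists_mem_eq_sup univ ⟨t, mem_univ t⟩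
      (fun t => if v = c t then 0 else B - d t v)
    have ht'' : coMinCount B d c v = if v = c t' then 0 else B - d t' v := ht'
    rw [ht'']
    split_ifs with h3
    · have := hBr t₂ v
      push_cast; linarith
    · rw [Nat.cast_sub (hB _ _)]
      by_cases h4 : σ (c t') = σ v
      · have := ((hd t' v h3).1 h4).1
        linarith
      · have := ((hd t' v h3).2 h4).1
        linarith
  have hiff : Same one B d c t v ↔
      (maxCount d c v : ℝ) + B ≤ 2 * d t v + coMinCount B d c v := by
    simp only [Same, hone, hvt, false_or]
    exact_mod_cast Iff.rfl
  rw [hiff]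
  -- The maximum plus the minimum lies between `2 * h + 3 / 4 * Δ` and `2 * h + 9 / 8 * Δ`, whereas
  -- `2 * d t v` is at least `2 * h + 7 / 4 * Δ` inside a cluster and at most `2 * h + Δ / 8`
  -- between clusters.
  constructor
  · intro h5
    by_contra h6
    have := ((hd t v hvt).2 h6).2
    linarith
  · intro h6
    have := ((hd t v hvt).1 h6).1
    linarith

end Correctness
end MPC

/-! ### The protocol that carries edges to the grid and runs a program there -/

namespace MPC
open Finset

section Deliver

variable {ι τ : Type} [DecidableEq ι]

@[simp] lemma deliver_zero (β : ι) : deliver (0 : Multiset (ι × τ)) β = 0 := rfl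

lemma deliver_add (X Y : Multiset (ι × τ)) (β : ι) :
    deliver (X + Y) β = deliver X β + deliver Y β := by
  simp [deliver]

lemma deliver_sum {κ : Type*} (s : Finset κ) (X : κ → Multiset (ι × τ)) (β : ι) :
    deliver (∑ i ∈ s, X i) β = ∑ i ∈ s, deliver (X i) β := by
  unfold deliver
  rw [filter_finsetSum, map_finsetSum]

lemma deliver_singleton (x : ι × τ) (β : ι) :
    deliver {x} β = if x.1 = β then {x.2} else 0 := by
  unfold deliver
  rw [Multiset.filter_singleton]
  split_ifs <;> simp

lemma deliver_map_pair (α : ι) (X : Multiset τ) (β : ι) :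
    deliver (X.map fun x => (α, x)) β = if α = β then X else 0 := by
  unfold deliver
  rw [Multiset.filter_map]
  split_ifs with h
  · subst h; simp
  · simp [h]

lemma deliver_map_value {κ : Type*} (α : ι) (m : Multiset κ) (h : κ → τ) (β : ι) :
    deliver (m.map fun w => (α, h w)) β = if α = β then m.map h else 0 := by
  rw [← deliver_map_pair, Multiset.map_map]
  rfl

lemma deliver_bind {κ : Type*} (m : Multiset κ) (h : κ → Multiset (ι × τ)) (β : ι) :
    deliver (m.bind h) β = m.bind fun i => deliver (h i) β := by
  unfold deliver
  rw [Multiset.filter_bind, Multiset.map_bind]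

lemma deliver_map_dst {κ : Type*} (m : Multiset κ) (e : κ → ι) (x : τ) (β : ι) :
    deliver (m.map fun i => (e i, x)) β =
      Multiset.replicate (m.countP fun i => e i = β) x := by
  unfold deliver
  rw [Multiset.filter_map, Multiset.map_map, Multiset.countP_eq_card_filter]
  rw [← Multiset.map_const']
  rfl

end Deliver

lemma filterMap_add {α β : Type*} (f : α → Option β) (s t : Multiset α) :
    (s + t).filterMap f = s.filterMap f + t.filterMap f := by
  induction s using Multiset.induction_on with
  | empty => simp
  | cons a s ih =>
    rw [Multiset.cons_add]
    rcases h : f a with _ | b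
    · rw [Multiset.filterMap_cons_none _ _ h, Multiset.filterMap_cons_none _ _ h, ih]
    · rw [Multiset.filterMap_cons_some _ _ _ h, Multiset.filterMap_cons_some _ _ _ h, ih,
        Multiset.cons_add]

/-- Positions beyond the end contribute nothing, so `L` slots suffice for every list of length at
most `L`. -/
lemma sum_getElem?_elim {α : Type*} {β : Type*} [AddCommMonoid β] (h : α → β) (l : List α) (L : ℕ)
    (hL : l.length ≤ L) : ∑ i : Fin L, (l[i.val]?.elim 0 h) = (l.map h).sum := by
  induction l generalizing L with
  | nil => simp
  | cons a l ih =>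
    obtain ⟨L, rfl⟩ : ∃ L', L = L' + 1 := ⟨L - 1, by simp at hL; omega⟩
    rw [Fin.sum_univ_succ]
    simp only [Fin.val_zero, List.getElem?_cons_zero, Option.elim_some, Fin.val_succ,
      List.getElem?_cons_succ, List.map_cons, List.sum_cons]
    rw [ih L (by simpa using hL)]

section Protocol

variable {N k Γ Λ L R B : ℕ}

/-- The cells that hold copies of the edges: copy, group, and position in the group. -/
abbrev Slot (Γ Λ L : ℕ) := Fin Λ × Fin Γ × Fin L

/-- All cells: the groups of edges, the cells for single edges, and the main cells. -/
abbrev Cell (N k Γ Λ L R : ℕ) := Fin Γ ⊕ (Slot Γ Λ L ⊕ Grid (Λ * k) N R)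

/-- An edge with a part of its label. -/
abbrev LabelledEdge (N k R : ℕ) := Fin N × Fin N × Fin k × Fin R

/-- The tokens: labelled edges, neighbours, registers, and values. -/
abbrev Token (N k R B : ℕ) := LabelledEdge N k R ⊕ (Fin N ⊕ (Regs B ⊕ Fin (B + 1)))

def tokEdge (x : LabelledEdge N k R) : Token N k R B := Sum.inl x
def tokNbr (w : Fin N) : Token N k R B := Sum.inr (Sum.inl w)
def tokRegs (s : Regs B) : Token N k R B := Sum.inr (Sum.inr (Sum.inl s))
def tokVal (x : Fin (B + 1)) : Token N k R B := Sum.inr (Sum.inr (Sum.inr x))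

def getEdges (X : Multiset (Token N k R B)) : Multiset (LabelledEdge N k R) :=
  X.filterMap fun x => Sum.elim some (fun _ => none) x

def getNbrs (X : Multiset (Token N k R B)) : Multiset (Fin N) :=
  X.filterMap fun x => Sum.elim (fun _ => none) (Sum.elim some fun _ => none) x

def getRegs (X : Multiset (Token N k R B)) : Multiset (Regs B) :=
  X.filterMap fun x => Sum.elim (fun _ => none) (Sum.elim (fun _ => none)
    (Sum.elim some fun _ => none)) x

def getVals (X : Multiset (Token N k R B)) : Multiset (Fin (B + 1)) :=
  X.filterMap fun x => Sum.elim (fun _ => none) (Sum.elim (fun _ => none)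
    (Sum.elim (fun _ => none) some)) x

/-- The contents of a main cell. -/
def gridContent (nb : Multiset (Fin N)) (s : Multiset (Regs B)) (x : Multiset (Fin (B + 1))) :
    Multiset (Token N k R B) := nb.map tokNbr + s.map tokRegs + x.map tokVal

lemma getEdges_map (X : Multiset (LabelledEdge N k R)) :
    getEdges (X.map (tokEdge (B := B))) = X := by
  unfold getEdges
  rw [Multiset.filterMap_map]
  exact Multiset.filterMap_some X

lemma filterMap_none {α β : Type*} (s : Multiset α) :
    s.filterMap (fun _ => (none : Option β)) = 0 := by
  induction s using Multiset.induction_on with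
  | empty => rfl
  | cons a s ih => rw [Multiset.filterMap_cons_none _ _ rfl, ih]

variable (nb : Multiset (Fin N)) (s : Multiset (Regs B)) (x : Multiset (Fin (B + 1)))

lemma getNbrs_gridContent : getNbrs (gridContent (k := k) (R := R) nb s x) = nb := by
  unfold getNbrs gridContent
  rw [filterMap_add, filterMap_add, Multiset.filterMap_map, Multiset.filterMap_map,
    Multiset.filterMap_map]
  exact (congrArg₂ _ (congrArg₂ _ (Multiset.filterMap_some nb) (filterMap_none s))
    (filterMap_none x)).trans (by simp)

lemma getRegs_gridContent : getRegs (gridContent (k := k) (R := R) nb s x) = s := by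
  unfold getRegs gridContent
  rw [filterMap_add, filterMap_add, Multiset.filterMap_map, Multiset.filterMap_map,
    Multiset.filterMap_map]
  exact (congrArg₂ _ (congrArg₂ _ (filterMap_none nb) (Multiset.filterMap_some s))
    (filterMap_none x)).trans (by simp)

lemma getVals_gridContent : getVals (gridContent (k := k) (R := R) nb s x) = x := by
  unfold getVals gridContent
  rw [filterMap_add, filterMap_add, Multiset.filterMap_map, Multiset.filterMap_map,
    Multiset.filterMap_map]
  exact (congrArg₂ _ (congrArg₂ _ (filterMap_none nb) (filterMap_none s))
    (Multiset.filterMap_some x)).trans (by simp)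

/-- The registers that are stored in a cell, or initial ones. -/
noncomputable def theRegs (s : Multiset (Regs B)) : Regs B :=
  s.toList.headD (emb B 0, emb B 0, emb B 0)

lemma theRegs_singleton (s : Regs B) : theRegs {s} = s := by simp [theRegs]

/-- Distribute a group of edges over the cells for single edges. -/
noncomputable def spreadOut [NeZero Λ] (γ : Fin Γ) (X : Multiset (Token N k R B)) :
    Multiset (Cell N k Γ Λ L R × Token N k R B) :=
  ∑ i : Fin L, (getEdges X).toList[i.val]?.elim 0 fun x => {(.inr (.inl (0, γ, i)), tokEdge x)}

/-- The copies form a tree with fan-out `L`, rooted at copy `0`, which is its own parent; two rounds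
of copying reach all of them if `Λ ≤ L ^ 2`. -/
def parCopy (σ : Slot Γ Λ L) : Slot Γ Λ L := (divFin L σ.1, σ.2)

/-- Copy a cell to its children. -/
def copyOut (σ : Slot Γ Λ L) (X : Multiset (Token N k R B)) :
    Multiset (Cell N k Γ Λ L R × Token N k R B) :=
  ∑ σ' with parCopy σ' = σ, X.map fun x => (.inr (.inl σ'), x)

/-- Send the edges to the main cells of both endpoints. -/
def shipOut (σ : Slot Γ Λ L) (X : Multiset (Token N k R B)) :
    Multiset (Cell N k Γ Λ L R × Token N k R B) :=
  (getEdges X).bind fun x =>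
    {(.inr (.inr (finProdFinEquiv (σ.1, x.2.2.1), x.1, x.2.2.2)), tokNbr x.2.1)} +
    {(.inr (.inr (finProdFinEquiv (σ.1, x.2.2.1), x.2.1, x.2.2.2)), tokNbr x.1)}

/-- Carry out an instruction in a main cell. -/
noncomputable def instrOut (I : Instr (Grid (Λ * k) N R) (Fin N) (Regs B) (Fin (B + 1)))
    (α : Grid (Λ * k) N R) (X : Multiset (Token N k R B)) :
    Multiset (Cell N k Γ Λ L R × Token N k R B) :=
  ((getNbrs X).map fun w => (.inr (.inr α), tokNbr w)) +
  {(.inr (.inr α), tokRegs (I.run α (theRegs (getRegs X)) (getVals X)).1)} +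
  ((I.dst α (getNbrs X)).map fun β =>
    (.inr (.inr β), tokVal (I.run α (theRegs (getRegs X)) (getVals X)).2))

/-- What the cells do in round `t`. -/
noncomputable def protocol [NeZero Λ]
    (prog : List (Instr (Grid (Λ * k) N R) (Fin N) (Regs B) (Fin (B + 1)))) (t : ℕ) :
    Cell N k Γ Λ L R → Multiset (Token N k R B) →
      Multiset (Cell N k Γ Λ L R × Token N k R B) :=
  -- Round `0` spreads the groups, rounds `1` and `2` copy, and round `3` ships. Until then the main
  -- cells preserve their contents by sending them to themselves.
  Sum.elim (fun γ X => if t = 0 then spreadOut γ X else 0)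
    (Sum.elim (fun σ X => if t = 1 ∨ t = 2 then copyOut σ X else if t = 3 then shipOut σ X else 0)
      fun α X => if t < 4 then X.map fun x => (.inr (.inr α), x)
        else prog[t - 4]?.elim 0 fun I => instrOut I α X)

/-- The contents of all cells, given for the three kinds of cells. -/
def cells (e : Fin Γ → Multiset (Token N k R B)) (sl : Slot Γ Λ L → Multiset (Token N k R B))
    (gr : Grid (Λ * k) N R → Multiset (Token N k R B)) :
    Cell N k Γ Λ L R → Multiset (Token N k R B) := Sum.elim e (Sum.elim sl gr)

variable [NeZero Λ] (prog : List (Instr (Grid (Λ * k) N R) (Fin N) (Regs B) (Fin (B + 1))))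
  (e : Fin Γ → Multiset (Token N k R B)) (sl : Slot Γ Λ L → Multiset (Token N k R B))
  (gr : Grid (Λ * k) N R → Multiset (Token N k R B))

lemma deliver_spreadOut_slot (γ : Fin Γ) (X : Multiset (Token N k R B)) (σ : Slot Γ Λ L) :
    deliver (spreadOut (Λ := Λ) (L := L) γ X) (.inr (.inl σ)) = if σ.1 = 0 ∧ σ.2.1 = γ then
      (getEdges X).toList[σ.2.2.val]?.elim 0 (fun x => {tokEdge x}) else 0 := by
  unfold spreadOut
  rw [deliver_sum]
  have h : ∀ i : Fin L, deliver ((getEdges X).toList[i.val]?.elim 0 fun x =>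
      ({(.inr (.inl (0, γ, i)), tokEdge x)} : Multiset (Cell N k Γ Λ L R × Token N k R B)))
        (.inr (.inl σ)) = if σ.2.2 = i then (if σ.1 = 0 ∧ σ.2.1 = γ then
      (getEdges X).toList[i.val]?.elim 0 (fun x => {tokEdge x}) else 0) else 0 := by
    intro i
    rcases (getEdges X).toList[i.val]? with _ | x
    · simp
    · simp only [Option.elim_some]
      rw [deliver_singleton]
      obtain ⟨a, b, c⟩ := σ
      simp only [Sum.inr.injEq, Sum.inl.injEq, Prod.mk.injEq]
      rw [← ite_and]
      refine if_congr ?_ rfl rfl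
      constructor
      · rintro ⟨rfl, rfl, rfl⟩; exact ⟨rfl, rfl, rfl⟩
      · rintro ⟨rfl, rfl, rfl⟩; exact ⟨rfl, rfl, rfl⟩
  simp_rw [h]
  rw [sum_ite_eq, if_pos (mem_univ _)]

lemma deliver_spreadOut_other (γ : Fin Γ) (X : Multiset (Token N k R B))
    (β : Cell N k Γ Λ L R) (hβ : ∀ σ, β ≠ .inr (.inl σ)) :
    deliver (spreadOut (Λ := Λ) (L := L) γ X) β = 0 := by
  unfold spreadOut
  rw [deliver_sum]
  refine sum_eq_zero fun i _ => ?_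
  rcases (getEdges X).toList[i.val]? with _ | x
  · simp
  · simp only [Option.elim_some]
    rw [deliver_singleton, if_neg (Ne.symm (hβ _))]

lemma deliver_copyOut_slot (σ : Slot Γ Λ L) (X : Multiset (Token N k R B)) (σ' : Slot Γ Λ L) :
    deliver (copyOut (N := N) (k := k) (R := R) σ X) (.inr (.inl σ')) =
      if parCopy σ' = σ then X else 0 := by
  unfold copyOut
  rw [deliver_sum]
  simp_rw [deliver_map_pair, Sum.inr.injEq, Sum.inl.injEq]
  rw [sum_filter]
  simp_rw [← ite_and, and_comm (a := parCopy _ = σ), ite_and]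
  rw [sum_ite_eq', if_pos (mem_univ _)]

lemma deliver_copyOut_other (σ : Slot Γ Λ L) (X : Multiset (Token N k R B))
    (β : Cell N k Γ Λ L R) (hβ : ∀ σ, β ≠ .inr (.inl σ)) :
    deliver (copyOut σ X) β = 0 := by
  unfold copyOut
  rw [deliver_sum]
  refine sum_eq_zero fun σ' _ => ?_
  rw [deliver_map_pair, if_neg (Ne.symm (hβ _))]

/-- What the main cell `β` learns from a copy of a labelled edge. -/
def contrib (β : Grid (Λ * k) N R) (g : Fin Λ) (x : LabelledEdge N k R) : Multiset (Fin N) :=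
  if finProdFinEquiv (g, x.2.2.1) = β.1 ∧ x.2.2.2 = β.2.2 then
    (if x.1 = β.2.1 then {x.2.1} else 0) + (if x.2.1 = β.2.1 then {x.1} else 0) else 0

lemma deliver_shipOut_grid (σ : Slot Γ Λ L) (X : Multiset (Token N k R B))
    (β : Grid (Λ * k) N R) :
    deliver (shipOut (L := L) σ X) (.inr (.inr β)) =
      ((getEdges X).bind (contrib β σ.1)).map tokNbr := by
  unfold shipOut
  rw [deliver_bind, Multiset.map_bind]
  refine Multiset.bind_congr fun x _ => ?_
  rw [deliver_add, deliver_singleton, deliver_singleton]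
  obtain ⟨a, b, c⟩ := β
  simp only [Sum.inr.injEq, Prod.mk.injEq, contrib]
  by_cases h1 : finProdFinEquiv (σ.1, x.2.2.1) = a <;> by_cases h2 : x.2.2.2 = c <;>
    by_cases h3 : x.1 = b <;> by_cases h4 : x.2.1 = b <;> simp [h1, h2, h3, h4]

lemma deliver_shipOut_other (σ : Slot Γ Λ L) (X : Multiset (Token N k R B))
    (β : Cell N k Γ Λ L R) (hβ : ∀ α, β ≠ .inr (.inr α)) :
    deliver (shipOut σ X) β = 0 := by
  unfold shipOut
  rw [deliver_bind]
  refine Multiset.bind_zero _ ▸ Multiset.bind_congr fun x _ => ?_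
  rw [deliver_add, deliver_singleton, deliver_singleton, if_neg (Ne.symm (hβ _)),
    if_neg (Ne.symm (hβ _)), add_zero]

lemma deliver_instrOut_grid (I : Instr (Grid (Λ * k) N R) (Fin N) (Regs B) (Fin (B + 1)))
    (α : Grid (Λ * k) N R) (nb : Multiset (Fin N)) (s : Multiset (Regs B))
    (x : Multiset (Fin (B + 1))) (β : Grid (Λ * k) N R) :
    deliver (instrOut (Γ := Γ) (L := L) I α (gridContent nb s x)) (.inr (.inr β)) =
      (if α = β then nb.map tokNbr + {tokRegs (I.run α (theRegs s) x).1} else 0) +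
      (Multiset.replicate ((I.dst α nb).count β) (I.run α (theRegs s) x).2).map tokVal := by
  unfold instrOut
  rw [getNbrs_gridContent, getRegs_gridContent, getVals_gridContent, deliver_add, deliver_add,
    deliver_singleton, deliver_map_dst, deliver_map_value]
  simp only [Sum.inr.injEq, Multiset.map_replicate]
  congr 1
  · split_ifs <;> simp
  · congr 1
    rw [Multiset.count]
    exact Multiset.countP_congr rfl fun a _ => by simp [eq_comm]

lemma deliver_instrOut_other (I : Instr (Grid (Λ * k) N R) (Fin N) (Regs B) (Fin (B + 1)))
    (α : Grid (Λ * k) N R) (X : Multiset (Token N k R B))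
    (β : Cell N k Γ Λ L R) (hβ : ∀ α, β ≠ .inr (.inr α)) :
    deliver (instrOut I α X) β = 0 := by
  unfold instrOut
  rw [deliver_add, deliver_add, deliver_singleton, if_neg (Ne.symm (hβ _)), deliver_map_dst,
    deliver_map_value, if_neg (Ne.symm (hβ _))]
  rw [Multiset.countP_eq_zero.2 fun a _ => Ne.symm (hβ _)]
  rfl

/-- The contents of the cells after a round. -/
noncomputable def nextCells (t : ℕ) (C : Cell N k Γ Λ L R → Multiset (Token N k R B)) :
    Cell N k Γ Λ L R → Multiset (Token N k R B) :=
  deliver (∑ α, protocol prog t α (C α))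

lemma nextCells_zero : nextCells prog 0 (cells (L := L) e 0 gr) =
    cells 0 (fun σ => if σ.1 = 0 then
      (getEdges (e σ.2.1)).toList[σ.2.2.val]?.elim 0 (fun x => {tokEdge x}) else 0) gr := by
  funext β
  simp only [nextCells, deliver_sum]
  simp only [Fintype.sum_sum_type, protocol, cells, Sum.elim_inl,
    Sum.elim_inr]
  rcases β with γ | σ | β
  · simp [deliver_spreadOut_other, deliver_map_pair]
  · simp only [deliver_spreadOut_slot, if_true]
    simp [ite_and, deliver_map_pair]
  · simp [deliver_spreadOut_other, deliver_map_pair]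

lemma nextCells_copy {t : ℕ} (ht : t = 1 ∨ t = 2) : nextCells prog t (cells 0 sl gr) =
    cells 0 (fun σ => sl (parCopy σ)) gr := by
  have h0 : t ≠ 0 := by omega
  have h4 : t < 4 := by omega
  funext β
  simp only [nextCells, deliver_sum]
  simp only [Fintype.sum_sum_type, protocol, cells, Sum.elim_inl,
    Sum.elim_inr, if_pos ht, if_neg h0, if_pos h4]
  rcases β with γ | σ | β
  · simp [deliver_copyOut_other, deliver_map_pair]
  · simp [deliver_copyOut_slot, deliver_map_pair]
  · simp [deliver_copyOut_other, deliver_map_pair]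

lemma nextCells_ship : nextCells prog 3 (cells 0 sl gr) =
    cells 0 0 (fun β => (∑ σ, (getEdges (sl σ)).bind (contrib β σ.1)).map tokNbr + gr β) := by
  funext β
  simp only [nextCells, deliver_sum]
  simp only [Fintype.sum_sum_type, protocol, cells, Sum.elim_inl,
    Sum.elim_inr]
  rcases β with γ | σ | β
  · simp [deliver_shipOut_other, deliver_map_pair]
  · simp [deliver_shipOut_other, deliver_map_pair]
  · simp [deliver_shipOut_grid, deliver_map_pair, map_finsetSum]

/-- Four rounds of preparation explain the shift. A main cell sends its neighbours and registers to
itself and its value to the destinations, which is precisely one step of the network. -/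
lemma nextCells_instr {t : ℕ} {I : Instr (Grid (Λ * k) N R) (Fin N) (Regs B) (Fin (B + 1))}
    (hI : prog[t]? = some I) (nb : Grid (Λ * k) N R → Multiset (Fin N))
    (s : Grid (Λ * k) N R → Multiset (Regs B)) (x : Grid (Λ * k) N R → Multiset (Fin (B + 1))) :
    nextCells prog (t + 4)
      (cells (Γ := Γ) (L := L) 0 0 (fun α => gridContent (nb α) (s α) (x α))) =
    cells 0 0 (fun α => gridContent (nb α)
      {(I.exec nb (fun α => theRegs (s α), x)).1 α} ((I.exec nb (fun α => theRegs (s α), x)).2 α)) := by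
  funext β
  have h1 : ¬ (t + 4 = 1 ∨ t + 4 = 2) := by omega
  have h4 : ¬ (t + 4 < 4) := by omega
  have h0 : t + 4 ≠ 0 := by omega
  have h3 : t + 4 ≠ 3 := by omega
  simp only [nextCells, deliver_sum]
  simp only [Fintype.sum_sum_type, protocol, cells, Sum.elim_inl,
    Sum.elim_inr, if_neg h0, if_neg h3, if_neg h1, if_neg h4, Nat.add_sub_cancel, hI, Option.elim_some]
  rcases β with γ | σ | β
  · simp [deliver_instrOut_other]
  · simp [deliver_instrOut_other]
  · simp only [deliver_zero, sum_const_zero, zero_add, deliver_instrOut_grid,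
      sum_add_distrib, sum_ite_eq', mem_univ, if_true]
    simp only [gridContent, Instr.exec, map_finsetSum, Multiset.map_singleton]
    rfl

end Protocol
end MPC

/-! ### Bounds for the traffic of the program -/

namespace MPC
open Finset

section Bounds

variable {κ ν 𝒮 V : Type} [Fintype κ] [DecidableEq κ]

/-- No cell sends or receives more than `b` values. -/
def Instr.Within (nb : κ → Multiset ν) (b : ℕ) (I : Instr κ ν 𝒮 V) : Prop :=
  (∀ α, (I.dst α (nb α)).card ≤ b) ∧ ∀ β, ∑ α, (I.dst α (nb α)).count β ≤ b

lemma card_exec_le {nb : κ → Multiset ν} {b : ℕ} {I : Instr κ ν 𝒮 V} (h : I.Within nb b)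
    (X : NetState κ 𝒮 V) (β : κ) : ((I.exec nb X).2 β).card ≤ b := by
  simp only [Instr.exec, Multiset.card_sum, Multiset.card_replicate]
  exact h.2 β

variable (nb : κ → Multiset ν) {b : ℕ}

lemma within_upInstr (A : AddCommMonoid V) {par : κ → κ} (hb : 1 ≤ b)
    (hpar : ∀ β, (univ.filter fun α => par α = β).card ≤ b) :
    (upInstr (ν := ν) (𝒮 := 𝒮) A par).Within nb b := by
  refine ⟨fun α => hb, fun β => ?_⟩
  refine le_trans (le_of_eq ?_) (hpar β)
  rw [card_eq_sum_ones, sum_filter]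
  refine sum_congr rfl fun α _ => ?_
  change Multiset.count β {par α} = _
  rw [Multiset.count_singleton]
  simp [eq_comm]

lemma within_downInstr (A : AddCommMonoid V) {par : κ → κ} (hb : 1 ≤ b)
    (hpar : ∀ β, (univ.filter fun α => par α = β).card ≤ b) :
    (downInstr (ν := ν) (𝒮 := 𝒮) A par).Within nb b := by
  refine ⟨fun α => hpar α, fun β => ?_⟩
  refine le_trans (le_of_eq ?_) hb
  change ∑ α, Multiset.count β (univ.filter fun β => par β = α).val = 1
  rw [sum_eq_single_of_mem (par β) (mem_univ _)]
  · exact Multiset.count_eq_one_of_mem (Finset.nodup _) (by simp)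
  · intro α _ hα
    exact Multiset.count_eq_zero_of_notMem (by simpa using hα.symm)

lemma within_locInstr (A : AddCommMonoid V) (g : κ → 𝒮 → V → 𝒮 × V) (hb : 1 ≤ b) :
    (locInstr (ν := ν) A g).Within nb b := by
  refine ⟨fun α => hb, fun β => ?_⟩
  change ∑ α, Multiset.count β {α} ≤ b
  simp only [Multiset.count_singleton, sum_ite_eq, mem_univ, if_true]
  exact hb

lemma within_allReduce (A : AddCommMonoid V) {par : κ → κ} {D : ℕ} (hb : 1 ≤ b)
    (hpar : ∀ β, (univ.filter fun α => par α = β).card ≤ b) :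
    ∀ I ∈ allReduce (ν := ν) (𝒮 := 𝒮) A par D, I.Within nb b := by
  intro I hI
  rcases List.mem_append.1 hI with h | h
  · rw [List.eq_of_mem_replicate h]; exact within_upInstr nb A hb hpar
  · rw [List.eq_of_mem_replicate h]; exact within_downInstr nb A hb hpar

end Bounds

section GridBounds

variable {T N R f b B : ℕ}

lemma card_parCentre_le (hf : 0 < f) (β : Grid T N R) :
    (univ.filter fun α => parCentre f α = β).card ≤ f := by
  refine le_trans (card_le_card_of_injOn (fun α => α.1) (t := univ.filter fun t =>
    divFin f t = β.1) (fun α hα => ?_) ?_) (card_divFin_le hf β.1)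
  · simp only [coe_filter, mem_univ, true_and, Set.mem_ofPred_eq] at hα ⊢
    exact congrArg Prod.fst hα
  · intro α hα α' hα' h
    simp only [coe_filter, mem_univ, true_and, Set.mem_ofPred_eq] at hα hα'
    exact Prod.ext h ((congrArg Prod.snd hα).trans (congrArg Prod.snd hα').symm)

lemma card_parVertex_le (hf : 0 < f) (β : Grid T N R) :
    (univ.filter fun α => parVertex f α = β).card ≤ f := by
  refine le_trans (card_le_card_of_injOn (fun α => α.2.1) (t := univ.filter fun t =>
    divFin f t = β.2.1) (fun α hα => ?_) ?_) (card_divFin_le hf β.2.1)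
  · simp only [coe_filter, mem_univ, true_and, Set.mem_ofPred_eq] at hα ⊢
    exact congrArg (fun γ => γ.2.1) hα
  · intro α hα α' hα' h
    simp only [coe_filter, mem_univ, true_and, Set.mem_ofPred_eq] at hα hα'
    have e := hα.trans hα'.symm
    have e1 := congrArg (fun γ => γ.1) e
    have e2 := congrArg (fun γ => γ.2.2) e
    exact Prod.ext e1 (Prod.ext h e2)

lemma card_parPart_le (hf : 0 < f) (β : Grid T N R) :
    (univ.filter fun α => parPart f α = β).card ≤ f := by
  refine le_trans (card_le_card_of_injOn (fun α => α.2.2) (t := univ.filter fun t =>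
    divFin f t = β.2.2) (fun α hα => ?_) ?_) (card_divFin_le hf β.2.2)
  · simp only [coe_filter, mem_univ, true_and, Set.mem_ofPred_eq] at hα ⊢
    exact congrArg (fun γ => γ.2.2) hα
  · intro α hα α' hα' h
    simp only [coe_filter, mem_univ, true_and, Set.mem_ofPred_eq] at hα hα'
    have e := hα.trans hα'.symm
    have e1 := congrArg (fun γ => γ.1) e
    have e2 := congrArg (fun γ => γ.2.1) e
    exact Prod.ext e1 (Prod.ext e2 h)

/-- By symmetry of the neighbourhoods a cell receives as many values as it sends. -/
lemma within_exchInstr {𝒮 V : Type} (A : AddCommMonoid V) {nb : Grid T N R → Multiset (Fin N)}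
    (hnb : ∀ α, (nb α).card ≤ b)
    (hsymm : ∀ t v w ρ, (nb (t, v, ρ)).count w = (nb (t, w, ρ)).count v) :
    (exchInstr (𝒮 := 𝒮) A nbrCell).Within nb b := by
  refine ⟨fun α => (Multiset.card_map _ _).trans_le (hnb α), fun β => ?_⟩
  change ∑ α, ((nb α).map (nbrCell α)).count β ≤ b
  simp_rw [count_map_nbrCell]
  rw [sum_grid_fibre β fun α => (nb α).count β.2.1]
  simp_rw [hsymm _ _ β.2.1]
  refine le_trans (le_of_eq ?_) (hnb β)
  exact Multiset.sum_count_eq_card fun a _ => mem_univ a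

lemma within_program (one : Prop) {D : ℕ} {nb : Grid T N R → Multiset (Fin N)}
    (hnb : ∀ α, (nb α).card ≤ b)
    (hsymm : ∀ t v w ρ, (nb (t, v, ρ)).count w = (nb (t, w, ρ)).count v)
    (hb : 1 ≤ b) (hf : 0 < f) (hfb : f ≤ b) :
    ∀ I ∈ program (T := T) (N := N) (R := R) one B f D, I.Within nb b := by
  have h1 := fun β => (card_parCentre_le (T := T) (N := N) (R := R) hf β).trans hfb
  have h2 := fun β => (card_parVertex_le (T := T) (N := N) (R := R) hf β).trans hfb
  have h3 := fun β => (card_parPart_le (T := T) (N := N) (R := R) hf β).trans hfb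
  simp only [program, List.forall_mem_append, List.forall_mem_singleton]
  refine ⟨⟨⟨⟨⟨⟨⟨⟨⟨⟨⟨⟨⟨⟨⟨⟨?_, ?_⟩, ?_⟩, ?_⟩, ?_⟩, ?_⟩, ?_⟩, ?_⟩, ?_⟩, ?_⟩, ?_⟩, ?_⟩, ?_⟩, ?_⟩,
    ?_⟩, ?_⟩, ?_⟩ <;>
  first
  | exact within_locInstr _ _ _ hb
  | exact within_exchInstr _ hnb hsymm
  | exact within_allReduce _ _ hb h1
  | exact within_allReduce _ _ hb h2
  | exact within_allReduce _ _ hb h3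

/-- Nine tree sums of `2 * D` instructions, six local computations and two exchanges. -/
lemma length_program (one : Prop) (D : ℕ) :
    (program (T := T) (N := N) (R := R) one B f D).length = 18 * D + 8 := by
  simp only [program, allReduce, List.length_append, List.length_replicate, List.length_cons,
    List.length_nil]
  ring

end GridBounds
end MPC

/-! ### Labels and centres drawn by the machines, and the neighbourhoods that result -/

namespace MPC
open Finset

section Placement

variable {M N : ℕ}

/-- All edges, oriented as in the input. -/
def allEdges (P : Placement M N) : Multiset (Fin N × Fin N) := ∑ i, ((P i : List _) : Multiset _)

lemma map_allEdges {s : ℕ} {G : SimpleGraph (Fin N)} {P : Placement M N}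
    (h : IsPlacement s G P) [Fintype G.edgeSet] :
    (allEdges P).map (fun e => s(e.1, e.2)) = G.edgeFinset.val := by
  rw [allEdges, map_finsetSum]
  simp only [Multiset.map_coe]
  convert h.1

open Classical in
/-- The machine that holds an edge. -/
noncomputable def holder [NeZero M] (P : Placement M N) (x : Sym2 (Fin N)) : Fin M :=
  if h : ∃ i, ∃ e ∈ P i, s(e.1, e.2) = x then h.choose else 0

/-- The placed edges form the duplicate-free multiset of all edges, so a second machine with the
same edge would give multiplicity two. Pairs that are not placed are assigned to machine `0`, so
that every pair has a label. -/
lemma holder_eq [NeZero M] {s : ℕ} {G : SimpleGraph (Fin N)} {P : Placement M N}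
    (h : IsPlacement s G P) {i : Fin M} {e : Fin N × Fin N} (he : e ∈ P i) :
    holder P s(e.1, e.2) = i := by
  classical
  have hex : ∃ i, ∃ e' ∈ P i, s(e'.1, e'.2) = s(e.1, e.2) := ⟨i, e, he, rfl⟩
  rw [holder, dif_pos hex]
  by_contra hne
  obtain ⟨e', he', hee'⟩ := hex.choose_spec
  have hcount : G.edgeFinset.val.count s(e.1, e.2) ≤ 1 :=
    Multiset.nodup_iff_count_le_one.1 (Finset.nodup _) _
  rw [← h.1, Multiset.count_sum'] at hcount
  have hpos : ∀ j, (∃ e' ∈ P j, s(e'.1, e'.2) = s(e.1, e.2)) → 1 ≤ Multiset.count s(e.1, e.2)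
      ((((P j).map fun e => s(e.1, e.2)) : List (Sym2 (Fin N))) : Multiset (Sym2 (Fin N))) := by
    rintro j ⟨e', h1, h2⟩
    refine Multiset.one_le_count_iff_mem.2 ?_
    rw [Multiset.mem_coe, List.mem_map]
    exact ⟨e', h1, h2⟩
  have h2 := sum_le_univ_sum_of_nonneg (s := {hex.choose, i}) (f := fun j =>
    Multiset.count s(e.1, e.2) ((((P j).map fun e => s(e.1, e.2)) : List (Sym2 (Fin N))) :
      Multiset (Sym2 (Fin N)))) (fun _ => Nat.zero_le _)
  rw [sum_pair hne] at h2
  have h3 := hpos _ ⟨e', he', hee'⟩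
  have h4 := hpos i ⟨e, he, rfl⟩
  omega

end Placement

section Run

variable {M N k Γ Λ L R B : ℕ} [NeZero Λ] [NeZero N] [NeZero k] [NeZero R]

/-- The random choices of a machine: labels for all pairs of vertices, and centres. -/
abbrev Coin (N k Γ Λ R : ℕ) :=
  (Sym2 (Fin N) → Fin Γ × Fin k × Fin R) × (Fin (Λ * k) → Fin N)

/-- The main cell that is told the `t`-th centre. -/
def centreCell (t : Fin (Λ * k)) : Cell N k Γ Λ L R := .inr (.inr (t, 0, 0))

/-- The tokens sent in the first round: every edge goes to a random group, and every centre to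
its cell. -/
def firstOut (host : Cell N k Γ Λ L R → Fin M) (i : Fin M) (P : List (Fin N × Fin N))
    (ω : Coin N k Γ Λ R) : Multiset (Cell N k Γ Λ L R × Token N k R B) :=
  (P : Multiset (Fin N × Fin N)).map (fun e =>
    (.inl (ω.1 s(e.1, e.2)).1, tokEdge (e.1, e.2, (ω.1 s(e.1, e.2)).2))) +
  ∑ t with host (centreCell t) = i, {(centreCell t, tokVal (emb B (ω.2 t)))}

/-- The labelled edges in a group. -/
def group (O : Multiset (Fin N × Fin N)) (ℓ : Sym2 (Fin N) → Fin Γ × Fin k × Fin R)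
    (γ : Fin Γ) : Multiset (LabelledEdge N k R) :=
  (O.filter fun e => (ℓ s(e.1, e.2)).1 = γ).map fun e => (e.1, e.2, (ℓ s(e.1, e.2)).2)

/-- The initial contents of the main cells. -/
def centreTokens (B : ℕ) (c : Fin (Λ * k) → Fin N) (β : Grid (Λ * k) N R) :
    Multiset (Fin (B + 1)) :=
  if β.2.1 = 0 ∧ β.2.2 = 0 then {emb B (c β.1)} else 0

/-- Each edge uses the draw of its holder and each centre the draw of the host of its cell, so the
local draws amount to one labelling of all pairs and one family of centres. -/
lemma deliver_firstOut [NeZero M] (host : Cell N k Γ Λ L R → Fin M) {s : ℕ}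
    {G : SimpleGraph (Fin N)} {P : Placement M N} (h : IsPlacement s G P)
    (ω : Fin M → Coin N k Γ Λ R) :
    deliver (∑ i, firstOut (B := B) host i (P i) (ω i)) =
      cells (fun γ => (group (allEdges P) (fun x => (ω (holder P x)).1 x) γ).map tokEdge) 0
        (fun β => (centreTokens B (fun t => (ω (host (centreCell t))).2 t) β).map tokVal) := by
  have h1 : ∑ i, ((P i : List _) : Multiset (Fin N × Fin N)).map (fun e =>
      ((Sum.inl ((ω i).1 s(e.1, e.2)).1, tokEdge (e.1, e.2, ((ω i).1 s(e.1, e.2)).2)) :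
        Cell N k Γ Λ L R × Token N k R B)) =
      (allEdges P).map fun e => (Sum.inl ((ω (holder P s(e.1, e.2))).1 s(e.1, e.2)).1,
        tokEdge (e.1, e.2, ((ω (holder P s(e.1, e.2))).1 s(e.1, e.2)).2)) := by
    rw [allEdges, map_finsetSum]
    refine sum_congr rfl fun i _ => Multiset.map_congr rfl fun e he => ?_
    rw [holder_eq h (Multiset.mem_coe.1 he)]
  have h2 : ∑ i, ∑ t with host (centreCell t) = i, ({(centreCell t, tokVal (emb B ((ω i).2 t)))} :
      Multiset (Cell N k Γ Λ L R × Token N k R B)) =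
      ∑ t, {(centreCell t, tokVal (emb B ((ω (host (centreCell t))).2 t)))} := by
    rw [← sum_fiberwise univ (fun t => host (centreCell t))]
    refine sum_congr rfl fun i _ => sum_congr rfl fun t ht => ?_
    rw [(mem_filter.1 ht).2]
  funext β
  simp only [firstOut, sum_add_distrib]
  rw [h1, h2, deliver_add, deliver_sum]
  simp only [deliver_singleton]
  rcases β with γ | σ | β
  · simp only [centreCell, reduceCtorEq, if_false, sum_const_zero, add_zero, cells, Sum.elim_inl]
    unfold deliver group
    rw [Multiset.filter_map, Multiset.map_map, Multiset.map_map]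
    simp only [Function.comp_def, Sum.inl.injEq]
  · simp only [centreCell, reduceCtorEq, Sum.inr.injEq, if_false, sum_const_zero, add_zero, cells,
      Sum.elim_inr, Sum.elim_inl]
    unfold deliver
    rw [Multiset.filter_map, Multiset.map_map]
    simp
  · have : deliver ((allEdges P).map fun e => ((Sum.inl ((ω (holder P s(e.1, e.2))).1
        s(e.1, e.2)).1, tokEdge (e.1, e.2, ((ω (holder P s(e.1, e.2))).1 s(e.1, e.2)).2)) :
          Cell N k Γ Λ L R × Token N k R B)) (.inr (.inr β)) = 0 := by
      unfold deliver
      rw [Multiset.filter_map, Multiset.map_map]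
      simp
    rw [this, zero_add]
    simp only [centreCell, Sum.inr.injEq, cells, Sum.elim_inr, centreTokens]
    obtain ⟨t, v, ρ⟩ := β
    simp only [Prod.mk.injEq]
    by_cases hv : v = 0 ∧ ρ = 0
    · obtain ⟨rfl, rfl⟩ := hv
      simp
    · rw [if_neg hv]
      refine sum_eq_zero fun t' _ => if_neg ?_
      rintro ⟨rfl, h2, h3⟩
      exact hv ⟨h2.symm, h3.symm⟩

open Classical in
/-- The neighbours that a main cell learns. -/
noncomputable def neighbours (G : SimpleGraph (Fin N))
    (ℓ : Sym2 (Fin N) → Fin Γ × Fin k × Fin R) (β : Grid (Λ * k) N R) : Multiset (Fin N) :=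
  (univ.filter fun w => G.Adj β.2.1 w ∧
    (ℓ s(β.2.1, w)).2 = ((finProdFinEquiv.symm β.1).2, β.2.2)).val

/-- Only one copy number belongs to the centre `β.1`. In that copy each edge is announced once to
each endpoint, whatever its orientation, so the result is duplicate-free. -/
lemma sum_bind_contrib {G : SimpleGraph (Fin N)} {O : Multiset (Fin N × Fin N)}
    [Fintype G.edgeSet]
    (hO : O.map (fun e => s(e.1, e.2)) = G.edgeFinset.val)
    (ℓ : Sym2 (Fin N) → Fin Γ × Fin k × Fin R) (β : Grid (Λ * k) N R) :
    ∑ g : Fin Λ, O.bind (fun e => contrib β g (e.1, e.2, (ℓ s(e.1, e.2)).2)) =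
      neighbours G ℓ β := by
  classical
  set y : Fin k × Fin R := ((finProdFinEquiv.symm β.1).2, β.2.2) with hy
  have h1 : ∀ (g : Fin Λ) (e : Fin N × Fin N), contrib β g (e.1, e.2, (ℓ s(e.1, e.2)).2) =
      if g = (finProdFinEquiv.symm β.1).1 then (if (ℓ s(e.1, e.2)).2 = y then
        (if e.1 = β.2.1 then {e.2} else 0) + (if e.2 = β.2.1 then {e.1} else 0) else 0) else 0 := by
    intro g e
    simp only [contrib]
    rw [← ite_and]
    refine if_congr ?_ rfl rfl
    rw [← Equiv.eq_symm_apply, hy, Prod.ext_iff, Prod.ext_iff]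
    simp only [and_assoc]
  simp_rw [h1]
  rw [sum_eq_single_of_mem (finProdFinEquiv.symm β.1).1 (mem_univ _)
    (fun g _ hg => by simp only [if_neg hg, Multiset.bind_zero])]
  simp only [if_true]
  refine Multiset.ext.2 fun w => ?_
  rw [Multiset.count_bind]
  have hedge : ∀ e ∈ O, G.Adj e.1 e.2 := by
    intro e he
    have : s(e.1, e.2) ∈ G.edgeFinset.val := by
      rw [← hO]; exact Multiset.mem_map_of_mem _ he
    exact SimpleGraph.mem_edgeFinset.1 this
  have h2 : O.map (fun e => Multiset.count w (if (ℓ s(e.1, e.2)).2 = y then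
      ((if e.1 = β.2.1 then {e.2} else 0) + (if e.2 = β.2.1 then {e.1} else 0) :
        Multiset (Fin N)) else 0)) =
      O.map ((fun x => if x = s(β.2.1, w) ∧ (ℓ x).2 = y then 1 else 0) ∘
        fun e => s(e.1, e.2)) := by
    refine Multiset.map_congr rfl fun e he => ?_
    have hne := (hedge e he).ne
    obtain ⟨a, b⟩ := e
    simp only [Function.comp_apply] at *
    by_cases hl : (ℓ s(a, b)).2 = y
    · simp only [hl, if_true, and_true, Multiset.count_add, Sym2.eq_iff]
      by_cases ha : a = β.2.1 <;> by_cases hb : b = β.2.1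
      · exact absurd (ha.trans hb.symm) hne
      · simp [ha, hb, Multiset.count_singleton, eq_comm]
      · simp [ha, hb, Multiset.count_singleton, eq_comm]
      · simp [ha, hb]
    · simp [hl]
  rw [h2, ← Multiset.map_map, hO]
  change ∑ x ∈ G.edgeFinset, (if x = s(β.2.1, w) ∧ (ℓ x).2 = y then 1 else 0) = _
  simp_rw [ite_and]
  rw [sum_ite_eq', neighbours]
  have h3 : s(β.2.1, w) ∈ G.edgeFinset ↔ G.Adj β.2.1 w := by
    rw [SimpleGraph.mem_edgeFinset, SimpleGraph.mem_edgeSet]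
  rw [Multiset.count_eq_of_nodup (Finset.nodup _)]
  simp only [h3, Finset.mem_val, mem_filter, mem_univ, true_and]
  rw [ite_and]

lemma sum_bind_group (O : Multiset (Fin N × Fin N)) (ℓ : Sym2 (Fin N) → Fin Γ × Fin k × Fin R)
    (h : LabelledEdge N k R → Multiset (Fin N)) :
    ∑ γ, (group O ℓ γ).bind h = O.bind fun e => h (e.1, e.2, (ℓ s(e.1, e.2)).2) := by
  induction O using Multiset.induction_on with
  | empty => simp [group]
  | cons e O ih =>
    rw [Multiset.cons_bind, ← ih]
    have : ∀ γ, (group (e ::ₘ O) ℓ γ).bind h =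
        (if (ℓ s(e.1, e.2)).1 = γ then h (e.1, e.2, (ℓ s(e.1, e.2)).2) else 0) +
          (group O ℓ γ).bind h := by
      intro γ
      unfold group
      split_ifs with hγ
      · rw [Multiset.filter_cons_of_pos (p := fun e : Fin N × Fin N => (ℓ s(e.1, e.2)).1 = γ) _ hγ,
          Multiset.map_cons, Multiset.cons_bind]
      · rw [Multiset.filter_cons_of_neg (p := fun e : Fin N × Fin N => (ℓ s(e.1, e.2)).1 = γ) _ hγ, zero_add]
    simp_rw [this]
    rw [sum_add_distrib, sum_ite_eq, if_pos (mem_univ _)]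

lemma sum_getElem?_bind {α β : Type*} (h : α → Multiset β) (m : Multiset α) (L : ℕ)
    (hL : m.card ≤ L) : ∑ i : Fin L, (m.toList[i.val]?.elim 0 h) = m.bind h := by
  rw [sum_getElem?_elim h m.toList L (by simpa using hL)]
  conv_rhs => rw [← Multiset.coe_toList m]
  rfl

/-- The contents of the cell for a single edge. -/
noncomputable def slotContent (O : Multiset (Fin N × Fin N))
    (ℓ : Sym2 (Fin N) → Fin Γ × Fin k × Fin R) (σ : Slot Γ Λ L) : Multiset (Token N k R B) :=
  (group O ℓ σ.2.1).toList[σ.2.2.val]?.elim 0 fun x => {tokEdge x}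

lemma card_slotContent_le (O : Multiset (Fin N × Fin N))
    (ℓ : Sym2 (Fin N) → Fin Γ × Fin k × Fin R) (σ : Slot Γ Λ L) :
    (slotContent (B := B) O ℓ σ).card ≤ 1 := by
  unfold slotContent
  rcases (group O ℓ σ.2.1).toList[σ.2.2.val]? with _ | x <;> simp

lemma getEdges_slotContent (O : Multiset (Fin N × Fin N))
    (ℓ : Sym2 (Fin N) → Fin Γ × Fin k × Fin R) (σ : Slot Γ Λ L) :
    getEdges (slotContent (B := B) O ℓ σ) =
      (group O ℓ σ.2.1).toList[σ.2.2.val]?.elim 0 fun x => {x} := by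
  unfold slotContent
  rcases (group O ℓ σ.2.1).toList[σ.2.2.val]? with _ | x
  · rfl
  · simpa using getEdges_map (N := N) (k := k) (R := R) (B := B) {x}

/-- No edge gets lost, because a group of at most `L` edges fits into its `L` slots and the groups
partition the edges. -/
lemma sum_slots {G : SimpleGraph (Fin N)} {O : Multiset (Fin N × Fin N)} [Fintype G.edgeSet]
    (hO : O.map (fun e => s(e.1, e.2)) = G.edgeFinset.val)
    (ℓ : Sym2 (Fin N) → Fin Γ × Fin k × Fin R) (hL : ∀ γ, (group O ℓ γ).card ≤ L)
    (β : Grid (Λ * k) N R) :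
    ∑ σ : Slot Γ Λ L, (getEdges (slotContent (B := B) O ℓ σ)).bind (contrib β σ.1) =
      neighbours G ℓ β := by
  rw [← sum_bind_contrib hO ℓ β, Fintype.sum_prod_type]
  refine sum_congr rfl fun g _ => ?_
  rw [← sum_bind_group, Fintype.sum_prod_type]
  refine sum_congr rfl fun γ _ => ?_
  rw [← sum_getElem?_bind (contrib β g) (group O ℓ γ) L (hL γ)]
  refine sum_congr rfl fun i _ => ?_
  rw [getEdges_slotContent]
  rcases (group O ℓ γ).toList[i.val]? with _ | x <;> simp

end Run
end MPC

/-! ### Contents and loads of the cells during a run -/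

namespace MPC
open Finset

section Run

variable {N k Γ Λ L R B b : ℕ} [NeZero Λ] [NeZero N] [NeZero k] [NeZero R]

/-- The contents of the cells before the edges are copied. -/
noncomputable def startCells (B L : ℕ) (O : Multiset (Fin N × Fin N))
    (ℓ : Sym2 (Fin N) → Fin Γ × Fin k × Fin R) (c : Fin (Λ * k) → Fin N) :
    Cell N k Γ Λ L R → Multiset (Token N k R B) :=
  cells (fun γ => (group O ℓ γ).map tokEdge) 0 fun β => (centreTokens B c β).map tokVal

/-- The capacities of the cells. -/
def capacity (b : ℕ) : Cell N k Γ Λ L R → ℕ :=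
  Sum.elim (fun _ => L) (Sum.elim (fun _ => L) fun _ => 2 * b + 1)

variable (prog : List (Instr (Grid (Λ * k) N R) (Fin N) (Regs B) (Fin (B + 1))))
  (O : Multiset (Fin N × Fin N)) (ℓ : Sym2 (Fin N) → Fin Γ × Fin k × Fin R)
  (c : Fin (Λ * k) → Fin N)

lemma runCells_one : runCells (protocol prog) (startCells B L O ℓ c) 1 =
    cells 0 (fun σ => if σ.1 = 0 then slotContent O ℓ σ else 0)
      fun β => (centreTokens B c β).map tokVal := by
  refine (nextCells_zero prog _ _).trans ?_
  simp only [getEdges_map]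
  rfl

lemma runCells_two : runCells (protocol prog) (startCells B L O ℓ c) 2 =
    cells 0 (fun σ => if divFin L σ.1 = 0 then slotContent O ℓ σ else 0)
      fun β => (centreTokens B c β).map tokVal := by
  change nextCells prog 1 (runCells (protocol prog) (startCells B L O ℓ c) 1) = _
  rw [runCells_one, nextCells_copy prog _ _ (Or.inl rfl)]
  rfl

lemma runCells_three (hΛ : Λ ≤ L ^ 2) : runCells (protocol prog) (startCells B L O ℓ c) 3 =
    cells 0 (slotContent O ℓ) fun β => (centreTokens B c β).map tokVal := by
  change nextCells prog 2 (runCells (protocol prog) (startCells B L O ℓ c) 2) = _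
  rw [runCells_two, nextCells_copy prog _ _ (Or.inr rfl)]
  congr 1
  funext σ
  have : divFin L (divFin L σ.1) = 0 := divFin_iterate hΛ σ.1
  exact if_pos this

variable {O ℓ} {G : SimpleGraph (Fin N)} [Fintype G.edgeSet]

lemma runCells_four (hΛ : Λ ≤ L ^ 2) (hO : O.map (fun e => s(e.1, e.2)) = G.edgeFinset.val)
    (hL : ∀ γ, (group O ℓ γ).card ≤ L) :
    runCells (protocol prog) (startCells B L O ℓ c) 4 =
      cells 0 0 fun β => gridContent (neighbours G ℓ β) 0 (centreTokens B c β) := by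
  change nextCells prog 3 (runCells (protocol prog) (startCells B L O ℓ c) 3) = _
  rw [runCells_three prog O ℓ c hΛ, nextCells_ship]
  congr 1
  funext β
  rw [sum_slots hO ℓ hL, gridContent]
  simp

/-- The state of the main cells before the first instruction. -/
noncomputable def startState (B : ℕ) (c : Fin (Λ * k) → Fin N) :
    NetState (Grid (Λ * k) N R) (Regs B) (Fin (B + 1)) :=
  (fun _ => theRegs 0, centreTokens B c)

/-- The stored registers `s` are existential because initially none are stored and `theRegs`
supplies default ones; after an instruction there is exactly one set of registers. -/
lemma runCells_instr (hΛ : Λ ≤ L ^ 2) (hO : O.map (fun e => s(e.1, e.2)) = G.edgeFinset.val)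
    (hL : ∀ γ, (group O ℓ γ).card ≤ L) (r : ℕ) (hr : r ≤ prog.length) :
    ∃ s : Grid (Λ * k) N R → Multiset (Regs B), (∀ α, (s α).card ≤ 1) ∧
      (∀ α, theRegs (s α) = (execAll (neighbours G ℓ) (prog.take r) (startState B c)).1 α) ∧
      runCells (protocol prog) (startCells B L O ℓ c) (r + 4) =
        cells 0 0 fun β => gridContent (neighbours G ℓ β) (s β)
          ((execAll (neighbours G ℓ) (prog.take r) (startState B c)).2 β) := by
  induction r with
  | zero =>
    exact ⟨fun _ => 0, fun _ => Nat.zero_le _, fun _ => rfl, runCells_four prog c hΛ hO hL⟩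
  | succ r ih =>
    obtain ⟨s, h1, h2, h3⟩ := ih (by omega)
    have hI : prog[r]? = some prog[r] := List.getElem?_eq_getElem (by omega)
    have h4 : runCells (protocol prog) (startCells B L O ℓ c) (r + 1 + 4) =
        nextCells prog (r + 4) (runCells (protocol prog) (startCells B L O ℓ c) (r + 4)) := by
      rw [add_right_comm]; rfl
    have h5 : execAll (neighbours G ℓ) (prog.take (r + 1)) (startState B c) =
        prog[r].exec (neighbours G ℓ) (execAll (neighbours G ℓ) (prog.take r) (startState B c)) := by
      rw [List.take_add_one, hI, Option.toList_some, execAll_append, execAll_singleton]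
    have h6 : ((fun α => theRegs (s α)),
        (execAll (neighbours G ℓ) (prog.take r) (startState B c)).2) =
        execAll (neighbours G ℓ) (prog.take r) (startState B c) :=
      Prod.ext (funext h2) rfl
    refine ⟨fun α => {(execAll (neighbours G ℓ) (prog.take (r + 1)) (startState B c)).1 α},
      fun α => le_of_eq (Multiset.card_singleton _), fun α => theRegs_singleton _, ?_⟩
    rw [h4, h3, nextCells_instr prog hI, h6, h5]

lemma card_centreTokens_le (β : Grid (Λ * k) N R) : (centreTokens B c β).card ≤ 1 := by
  unfold centreTokens
  split_ifs <;> simp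

lemma card_exec_take_le {nb : Grid (Λ * k) N R → Multiset (Fin N)} (hb : 1 ≤ b)
    (hprog : ∀ I ∈ prog, I.Within nb b) (r : ℕ) (β : Grid (Λ * k) N R) :
    ((execAll nb (prog.take r) (startState B c)).2 β).card ≤ b := by
  rcases r with _ | r
  · exact (card_centreTokens_le c β).trans hb
  · rw [List.take_add_one, execAll_append]
    rcases h : prog[r]? with _ | I
    · have : prog.length ≤ r := List.getElem?_eq_none_iff.1 h
      simp only [Option.toList_none]
      rcases List.eq_nil_or_concat' prog with rfl | ⟨l, I, rfl⟩
      · rw [List.take_nil]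
        exact (card_centreTokens_le c β).trans hb
      · rw [List.take_of_length_le this]
        change ((execAll nb (l ++ [I]) (startState B c)).2 β).card ≤ b
        rw [execAll_append, execAll_singleton]
        exact card_exec_le (hprog I (by simp)) _ β
    · rw [Option.toList_some, execAll_singleton]
      exact card_exec_le (hprog I (List.mem_of_getElem? h)) _ β

lemma card_gridContent_le {nb : Multiset (Fin N)} {s : Multiset (Regs B)}
    {x : Multiset (Fin (B + 1))} (h1 : nb.card ≤ b) (h2 : s.card ≤ 1) (h3 : x.card ≤ b) :
    (gridContent (k := k) (R := R) nb s x).card ≤ 2 * b + 1 := by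
  simp only [gridContent, Multiset.card_add, Multiset.card_map]
  omega

lemma card_spreadOut_le (γ : Fin Γ) (X : Multiset (Token N k R B)) :
    (spreadOut (Λ := Λ) (L := L) γ X).card ≤ L := by
  unfold spreadOut
  rw [Multiset.card_sum]
  refine (sum_le_sum fun i _ => (?_ : _ ≤ 1)).trans (by simp)
  rcases (getEdges X).toList[i.val]? with _ | x <;> simp

lemma card_copyOut_le (hL : 0 < L) (σ : Slot Γ Λ L) (X : Multiset (Token N k R B))
    (hX : X.card ≤ 1) : (copyOut σ X).card ≤ L := by
  unfold copyOut
  rw [Multiset.card_sum]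
  refine (sum_le_sum fun σ' _ => (Multiset.card_map _ _).trans_le hX).trans ?_
  rw [sum_const, smul_eq_mul, mul_one]
  refine le_trans (card_le_card_of_injOn (fun σ => σ.1) (t := univ.filter fun t =>
    divFin L t = σ.1) (fun α hα => ?_) ?_) (card_divFin_le hL σ.1)
  · simp only [coe_filter, mem_univ, true_and, Set.mem_ofPred_eq] at hα ⊢
    exact congrArg Prod.fst hα
  · intro α hα α' hα' h
    simp only [coe_filter, mem_univ, true_and, Set.mem_ofPred_eq] at hα hα'
    have e1 := congrArg Prod.snd (hα.trans hα'.symm)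
    exact Prod.ext h e1

lemma card_filterMap_le {α β : Type*} (f : α → Option β) (s : Multiset α) :
    (s.filterMap f).card ≤ s.card := by
  induction s using Multiset.induction_on with
  | empty => simp
  | cons a s ih =>
    rcases h : f a with _ | y
    · rw [Multiset.filterMap_cons_none _ _ h, Multiset.card_cons]; omega
    · rw [Multiset.filterMap_cons_some _ _ _ h, Multiset.card_cons, Multiset.card_cons]; omega

lemma card_shipOut_le (σ : Slot Γ Λ L) (X : Multiset (Token N k R B))
    (hX : X.card ≤ 1) : (shipOut σ X).card ≤ 2 := by
  unfold shipOut
  rw [Multiset.card_bind]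
  simp only [Function.comp_def, Multiset.card_add, Multiset.card_singleton, Multiset.map_const',
    Multiset.sum_replicate, smul_eq_mul]
  have : (getEdges X).card ≤ X.card := card_filterMap_le _ _
  omega

lemma card_instrOut_le {I : Instr (Grid (Λ * k) N R) (Fin N) (Regs B) (Fin (B + 1))}
    {nb : Grid (Λ * k) N R → Multiset (Fin N)} (hI : I.Within nb b) (α : Grid (Λ * k) N R)
    (hnb : (nb α).card ≤ b) (s : Multiset (Regs B)) (x : Multiset (Fin (B + 1))) :
    (instrOut (Γ := Γ) (L := L) I α (gridContent (nb α) s x)).card ≤ 2 * b + 1 := by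
  unfold instrOut
  rw [getNbrs_gridContent]
  simp only [Multiset.card_add, Multiset.card_map, Multiset.card_singleton]
  have := hI.1 α
  omega

/-- The capacity `2 * b + 1` of a main cell leaves room for `b` neighbours, one set of registers and
`b` values. -/
lemma card_runCells_le (hΛ : Λ ≤ L ^ 2) (hO : O.map (fun e => s(e.1, e.2)) = G.edgeFinset.val)
    (hL : ∀ γ, (group O ℓ γ).card ≤ L) (hL2 : 2 ≤ L) (hb : 1 ≤ b)
    (hnb : ∀ β : Grid (Λ * k) N R, (neighbours G ℓ β).card ≤ b)
    (hprog : ∀ I ∈ prog, I.Within (neighbours G ℓ) b)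
    (t : ℕ) (ht : t ≤ 4 + prog.length) (α : Cell N k Γ Λ L R) :
    (runCells (protocol prog) (startCells B L O ℓ c) t α).card ≤ capacity b α := by
  have hc : ∀ β : Grid (Λ * k) N R, ((centreTokens B c β).map (tokVal (N := N) (k := k) (R := R))).card ≤
      2 * b + 1 := by
    intro β
    rw [Multiset.card_map]
    exact (card_centreTokens_le c β).trans (by omega)
  have hs : ∀ (p : Prop) [Decidable p] (σ : Slot Γ Λ L),
      (if p then slotContent (B := B) O ℓ σ else 0).card ≤ L := by
    intro p _ σ
    split_ifs
    · exact (card_slotContent_le O ℓ σ).trans (by omega)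
    · exact Nat.zero_le _
  by_cases h4 : t < 4
  · interval_cases t
    · rcases α with γ | σ | β
      · exact (Multiset.card_map _ _).trans_le (hL γ)
      · exact Nat.zero_le _
      · exact hc β
    · rw [runCells_one]
      rcases α with γ | σ | β
      · exact Nat.zero_le _
      · exact hs _ σ
      · exact hc β
    · rw [runCells_two]
      rcases α with γ | σ | β
      · exact Nat.zero_le _
      · exact hs _ σ
      · exact hc β
    · rw [runCells_three prog O ℓ c hΛ]
      rcases α with γ | σ | β
      · exact Nat.zero_le _
      · exact (card_slotContent_le O ℓ σ).trans (by simp [capacity]; omega)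
      · exact hc β
  · obtain ⟨r, rfl⟩ : ∃ r, t = r + 4 := ⟨t - 4, by omega⟩
    obtain ⟨s, h1, -, h3⟩ := runCells_instr prog c hΛ hO hL r (by omega)
    rw [h3]
    rcases α with γ | σ | β
    · exact Nat.zero_le _
    · exact Nat.zero_le _
    · exact card_gridContent_le (hnb β) (h1 β) (card_exec_take_le prog c hb hprog r β)

lemma card_protocol_le (hΛ : Λ ≤ L ^ 2) (hO : O.map (fun e => s(e.1, e.2)) = G.edgeFinset.val)
    (hL : ∀ γ, (group O ℓ γ).card ≤ L) (hL2 : 2 ≤ L) (hb : 1 ≤ b)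
    (hnb : ∀ β : Grid (Λ * k) N R, (neighbours G ℓ β).card ≤ b)
    (hprog : ∀ I ∈ prog, I.Within (neighbours G ℓ) b)
    (t : ℕ) (ht : t < 4 + prog.length) (α : Cell N k Γ Λ L R) :
    (protocol prog t α (runCells (protocol prog) (startCells B L O ℓ c) t α)).card ≤
      capacity b α := by
  have hle := card_runCells_le prog c hΛ hO hL hL2 hb hnb hprog t ht.le α
  rcases α with γ | σ | α
  · simp only [protocol, Sum.elim_inl, capacity]
    split_ifs
    · exact card_spreadOut_le γ _
    · exact Nat.zero_le _
  · simp only [protocol, Sum.elim_inr, Sum.elim_inl, capacity]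
    have hs : ∀ (p : Prop) [Decidable p] (σ : Slot Γ Λ L),
        (if p then slotContent (B := B) O ℓ σ else 0).card ≤ 1 := by
      intro p _ σ
      split_ifs
      · exact card_slotContent_le O ℓ σ
      · exact Nat.zero_le _
    split_ifs with h1 h3
    · refine card_copyOut_le (by omega) σ _ ?_
      rcases h1 with rfl | rfl
      · rw [runCells_one]; exact hs _ σ
      · rw [runCells_two]; exact hs _ σ
    · subst h3
      refine (card_shipOut_le σ _ ?_).trans hL2
      rw [runCells_three prog O ℓ c hΛ]
      exact card_slotContent_le O ℓ σ
    · exact Nat.zero_le _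
  · simp only [protocol, Sum.elim_inr]
    split_ifs with h4
    · rw [Multiset.card_map]; exact hle
    · obtain ⟨r, rfl⟩ : ∃ r, t = r + 4 := ⟨t - 4, by omega⟩
      obtain ⟨s, h1, -, h3⟩ := runCells_instr prog c hΛ hO hL r (by omega)
      rw [Nat.add_sub_cancel, List.getElem?_eq_getElem (show r < prog.length by omega), h3]
      exact card_instrOut_le (hprog _ (List.getElem_mem _)) α (hnb α) _ _

end Run
end MPC

/-! ### The algorithm for several machines and its success on good labels -/

namespace MPC
open Finset

section Hosts

variable {M : ℕ} [NeZero M] {α : Type} [Fintype α]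

/-- Distribute the elements of a type evenly over the machines. -/
noncomputable def modHost (M : ℕ) [NeZero M] (a : α) : Fin M :=
  Fin.ofNat M (Fintype.equivFin α a).val

lemma card_modHost_le (i : Fin M) :
    (univ.filter fun a : α => modHost M a = i).card ≤ Fintype.card α / M + 1 := by
  have hM : 0 < M := Nat.pos_of_ne_zero (NeZero.ne M)
  rw [← card_range (Fintype.card α / M + 1)]
  refine card_le_card_of_injOn (fun a => (Fintype.equivFin α a).val / M) (fun a _ => ?_) ?_
  · simp only [coe_range, Set.mem_Iio]
    exact Nat.lt_succ_of_le (Nat.div_le_div_right (Fintype.equivFin α a).2.le)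
  · intro a ha a' ha' h
    simp only [coe_filter, mem_univ, true_and, Set.mem_ofPred_eq] at ha ha'
    have h1 : (Fintype.equivFin α a).val % M = i.val := congrArg Fin.val ha
    have h2 : (Fintype.equivFin α a').val % M = i.val := congrArg Fin.val ha'
    refine (Fintype.equivFin α).injective (Fin.ext ?_)
    rw [← Nat.div_add_mod (Fintype.equivFin α a).val M, ← Nat.div_add_mod
      (Fintype.equivFin α a').val M, h1, h2]
    exact congrArg (fun x => M * x + i.val) h

end Hosts

section Algorithm

variable {M N k Γ Λ L R B b f D : ℕ} [NeZero M] [NeZero Λ] [NeZero N] [NeZero k] [NeZero R]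

/-- The hosts of the cells. The main cells are distributed separately. -/
noncomputable def cellHost (M : ℕ) [NeZero M] : Cell N k Γ Λ L R → Fin M :=
  Sum.elim (fun γ => modHost M (Sum.inl γ : Fin Γ ⊕ Slot Γ Λ L))
    (Sum.elim (fun σ => modHost M (Sum.inr σ : Fin Γ ⊕ Slot Γ Λ L)) (modHost M))

/-- The output of a cell. -/
noncomputable def cellOut : Cell N k Γ Λ L R → Multiset (Token N k R B) → Option (Fin N × Fin k) :=
  Sum.elim (fun _ _ => none) (Sum.elim (fun _ _ => none) fun β X =>
    if β.1 = 0 ∧ β.2.2 = 0 then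
      if h : ((getVals X).toList.headD 0).val < k then some (β.2.1, ⟨_, h⟩) else none
    else none)

/-- The clustering algorithm for several machines. -/
noncomputable abbrev clusterAlgorithm (M N k Γ Λ L R B f D : ℕ) [NeZero M] [NeZero Λ] [NeZero N]
    [NeZero k] [NeZero R] [NeZero Γ] : Algorithm M N k :=
  cellAlgorithm (4 + (program (T := Λ * k) (N := N) (R := R) (k = 1) B f D).length)
    (Coin N k Γ Λ R) (cellHost (L := L) M) (firstOut (B := B) (cellHost M))
    (protocol (program (k = 1) B f D)) cellOut

/-- Edge cells and main cells are distributed separately because even numbers of cells mean even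
loads only among cells of equal capacity. The summands `+ 1` come from rounding. -/
lemma sum_capacity_host_le (i : Fin M) :
    ∑ α with cellHost M α = i, capacity (N := N) (k := k) (Γ := Γ) (Λ := Λ) (L := L) (R := R) b α ≤
      L * ((Γ + Λ * (Γ * L)) / M + 1) + (2 * b + 1) * ((Λ * k * (N * R)) / M + 1) := by
  rw [sum_filter, Fintype.sum_sum_type, Fintype.sum_sum_type, ← add_assoc]
  refine Nat.add_le_add ?_ ?_
  · have h := card_modHost_le (α := Fin Γ ⊕ Slot Γ Λ L) i
    simp only [Fintype.card_sum, Fintype.card_prod, Fintype.card_fin] at h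
    refine le_trans (le_of_eq ?_) (Nat.mul_le_mul_left L h)
    rw [card_eq_sum_ones, mul_sum, sum_filter, Fintype.sum_sum_type, mul_one]
    rfl
  · have h := card_modHost_le (α := Grid (Λ * k) N R) i
    simp only [Fintype.card_prod, Fintype.card_fin] at h
    refine le_trans (le_of_eq ?_) (Nat.mul_le_mul_left (2 * b + 1) h)
    rw [card_eq_sum_ones, mul_sum, sum_filter, mul_one]
    rfl

lemma sum_capacity :
    ∑ α, capacity (N := N) (k := k) (Γ := Γ) (Λ := Λ) (L := L) (R := R) b α =
      L * (Γ + Λ * (Γ * L)) + (2 * b + 1) * (Λ * k * (N * R)) := by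
  rw [Fintype.sum_sum_type, Fintype.sum_sum_type]
  simp [capacity]
  ring

/-- Main cells have capacity at least two, so a machine hosts at most `s / 2` of them. In the first
round the centres then take at most half of the words that may be sent; the edges take the other
half. -/
lemma card_main_host_le {s : ℕ} (hb : 1 ≤ b) {i : Fin M}
    (h : ∑ α with cellHost M α = i,
      capacity (N := N) (k := k) (Γ := Γ) (Λ := Λ) (L := L) (R := R) b α ≤ s) :
    2 * (univ.filter fun β : Grid (Λ * k) N R => modHost M β = i).card ≤ s := by
  refine le_trans ?_ h
  rw [sum_filter, Fintype.sum_sum_type, Fintype.sum_sum_type, ← add_assoc]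
  refine le_trans ?_ (Nat.le_add_left _ _)
  rw [card_eq_sum_ones, mul_sum, sum_filter]
  refine sum_le_sum fun β _ => ?_
  change _ ≤ if modHost M β = i then 2 * b + 1 else 0
  split_ifs <;> omega

/-- Adjacency in the subgraph with the group of labels that belongs to the `t`-th centre. -/
noncomputable def groupAdj (G : SimpleGraph (Fin N)) [DecidableRel G.Adj]
    (ℓ : Sym2 (Fin N) → Fin Γ × Fin k × Fin R) (t : Fin (Λ * k)) (v w : Fin N) : ℕ :=
  if G.Adj v w ∧ (ℓ s(v, w)).2.1 = (finProdFinEquiv.symm t).2 then 1 else 0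

lemma sum_count_neighbours (G : SimpleGraph (Fin N)) [DecidableRel G.Adj]
    (ℓ : Sym2 (Fin N) → Fin Γ × Fin k × Fin R) (t : Fin (Λ * k)) (v w : Fin N) :
    ∑ ρ, (neighbours G ℓ (t, v, ρ)).count w = groupAdj G ℓ t v w := by
  classical
  have h : ∀ ρ, (neighbours G ℓ (t, v, ρ)).count w =
      if (ℓ s(v, w)).2.2 = ρ then groupAdj G ℓ t v w else 0 := by
    intro ρ
    rw [neighbours, Multiset.count_eq_of_nodup (Finset.nodup _), groupAdj, ← ite_and]
    refine if_congr ?_ rfl rfl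
    simp only [Finset.mem_val, mem_filter, mem_univ, true_and, Prod.ext_iff]
    tauto
  simp_rw [h]
  rw [sum_ite_eq, if_pos (mem_univ _)]

lemma count_neighbours_symm (G : SimpleGraph (Fin N))
    (ℓ : Sym2 (Fin N) → Fin Γ × Fin k × Fin R) (t : Fin (Λ * k)) (v w : Fin N) (ρ : Fin R) :
    (neighbours G ℓ (t, v, ρ)).count w = (neighbours G ℓ (t, w, ρ)).count v := by
  classical
  rw [neighbours, neighbours, Multiset.count_eq_of_nodup (Finset.nodup _),
    Multiset.count_eq_of_nodup (Finset.nodup _)]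
  simp only [Finset.mem_val, mem_filter, mem_univ, true_and, G.adj_comm v w, Sym2.eq_swap (a := v)]

lemma pathCount_groupAdj_le (G : SimpleGraph (Fin N)) [DecidableRel G.Adj]
    (ℓ : Sym2 (Fin N) → Fin Γ × Fin k × Fin R) (c : Fin (Λ * k) → Fin N) (t : Fin (Λ * k))
    (v : Fin N) : pathCount (groupAdj G ℓ) c t v ≤ N := by
  refine (sum_le_sum fun w _ => (?_ : _ ≤ 1)).trans (by simp)
  simp only [groupAdj]
  split_ifs <;> simp

variable [NeZero Γ]

lemma succeeds_of_program
    {prog : List (Instr (Grid (Λ * k) N R) (Fin N) (Regs B) (Fin (B + 1)))}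
    {W s : ℕ} {S : ℝ} {σ : Fin N → Fin k} {G : SimpleGraph (Fin N)}
    [DecidableRel G.Adj] {P : Placement M N} (hP : IsPlacement s G P)
    (ω : (cellAlgorithm (4 + prog.length) (Coin N k Γ Λ R) (cellHost (L := L) M)
      (firstOut (B := B) (cellHost M)) (protocol prog) cellOut).Coins)
    (ℓ : Sym2 (Fin N) → Fin Γ × Fin k × Fin R) (c : Fin (Λ * k) → Fin N)
    (hinit : initialCells (τ := Token N k R B) ω P = startCells B L (allEdges P) ℓ c)
    (hNW : N ≤ W) (hW : Fintype.card (Cell N k Γ Λ L R × Token N k R B) ≤ W)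
    (hPS : ((∑ i, 2 * (P i).length : ℕ) : ℝ) ≤ S)
    (hcap : L * ((Γ + Λ * (Γ * L)) / M + 1) + (2 * b + 1) * ((Λ * k * (N * R)) / M + 1) ≤ s)
    (htotal : ((L * (Γ + Λ * (Γ * L)) + (2 * b + 1) * (Λ * k * (N * R)) : ℕ) : ℝ) ≤ S)
    (hΛ : Λ ≤ L ^ 2) (hL2 : 2 ≤ L) (hb : 1 ≤ b) (hkB : k ≤ B)
    (hL : ∀ γ, (group (allEdges P) ℓ γ).card ≤ L)
    (hnb : ∀ β : Grid (Λ * k) N R, (neighbours G ℓ β).card ≤ b)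
    (hprog : ∀ I ∈ prog, I.Within (neighbours G ℓ) b) (lab : Fin N → Fin k)
    (hres : (execAll (neighbours G ℓ) prog (startState B c)).2 = fun β => {emb B (lab β.2.1)})
    (hlab : ∀ u v, lab u = lab v ↔ σ u = σ v) :
    Succeeds (cellAlgorithm (4 + prog.length) (Coin N k Γ Λ R) (cellHost (L := L) M)
      (firstOut (B := B) (cellHost M)) (protocol prog) cellOut) W s S σ P ω := by
  classical
  have hO := map_allEdges hP
  have hcap' := fun i : Fin M => (sum_capacity_host_le (N := N) (k := k) (Γ := Γ) (Λ := Λ)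
    (L := L) (R := R) (b := b) i).trans hcap
  have hmain := fun i : Fin M => card_main_host_le hb (hcap' i)
  have hrun := card_runCells_le prog c hΛ hO hL hL2 hb hnb hprog
  have hend : ∀ β, getVals (runCells (protocol prog) (startCells B L (allEdges P) ℓ c)
      (4 + prog.length) (.inr (.inr β))) = {emb B (lab β.2.1)} := by
    intro β
    obtain ⟨s, -, -, h3⟩ := runCells_instr prog c hΛ hO hL prog.length le_rfl
    rw [add_comm 4, h3]
    refine (getVals_gridContent _ _ _).trans ?_
    rw [List.take_length, hres]
  refine succeeds_cellAlgorithm ω hNW hW hP.2 hPS ?_ ?_ ?_ ?_ ?_ ?_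
  · intro i
    have h1 : (univ.filter fun t => cellHost M (centreCell (N := N) (k := k) (Γ := Γ) (Λ := Λ)
        (L := L) (R := R) t) = i).card ≤
        (univ.filter fun β : Grid (Λ * k) N R => modHost M β = i).card := by
      refine card_le_card_of_injOn (fun t => (t, 0, 0)) (fun t ht => ?_)
        fun t _ t' _ h => congrArg Prod.fst h
      exact mem_coe.2 (mem_filter.2 ⟨mem_univ _, (mem_filter.1 (mem_coe.1 ht)).2⟩)
    have h2 := hP.2 i
    have h3 := hmain i
    unfold firstOut
    rw [Multiset.card_add, Multiset.card_map, Multiset.card_sum]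
    simp only [Multiset.coe_card, Multiset.card_singleton, sum_const, smul_eq_mul, mul_one]
    omega
  · intro t ht i
    rw [hinit]
    exact (sum_le_sum fun α _ => hrun t ht α).trans (hcap' i)
  · intro t ht i
    rw [hinit]
    exact (sum_le_sum fun α _ =>
      card_protocol_le prog c hΛ hO hL hL2 hb hnb hprog t ht α).trans (hcap' i)
  · intro t ht
    rw [hinit]
    refine le_trans ?_ htotal
    rw [← sum_capacity]
    exact_mod_cast sum_le_sum fun α _ => hrun t ht α
  · intro i
    refine le_trans ?_ ((Nat.le_mul_of_pos_left _ two_pos).trans (hmain i))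
    refine (card_le_card (t := (univ.filter fun β : Grid (Λ * k) N R => modHost M β = i).image
      fun β => Sum.inr (Sum.inr β)) ?_).trans card_image_le
    intro α hα
    simp only [mem_filter, mem_univ, true_and] at hα
    rcases α with γ | σ | β
    · exact absurd hα.2 (by simp [cellOut])
    · exact absurd hα.2 (by simp [cellOut])
    · exact mem_image.2 ⟨β, mem_filter.2 ⟨mem_univ _, hα.1⟩, rfl⟩
  · rw [hinit]
    have hval : ∀ v, (emb B (lab v)).val = (lab v).val := fun v =>
      emb_val ((lab v).2.le.trans hkB)
    have hout : ∀ β : Grid (Λ * k) N R, cellOut (Γ := Γ) (L := L) (.inr (.inr β))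
        (runCells (protocol prog) (startCells B L (allEdges P) ℓ c)
          (4 + prog.length) (.inr (.inr β))) =
        if β.1 = 0 ∧ β.2.2 = 0 then some (β.2.1, lab β.2.1) else none := by
      intro β
      change (if β.1 = 0 ∧ β.2.2 = 0 then _ else _) = _
      refine if_congr Iff.rfl ?_ rfl
      rw [dif_pos]
      · simp only [hend, Multiset.toList_singleton, List.headD_cons, hval]
      · simp only [hend, Multiset.toList_singleton, List.headD_cons, hval]
        exact (lab _).2
    refine ⟨lab, fun v x => ⟨?_, ?_⟩, hlab⟩
    · rintro ⟨γ | σ | β, hα⟩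
      · exact absurd hα (by simp [cellOut])
      · exact absurd hα (by simp [cellOut])
      · have hα := (hout β).symm.trans hα
        split_ifs at hα
        have h5 := Option.some.inj hα
        have h6 := congrArg Prod.fst h5
        have h7 := congrArg Prod.snd h5
        simp only at h6 h7
        rw [← h6, h7]
    · rintro rfl
      refine ⟨.inr (.inr (0, v, 0)), (hout (0, v, 0)).trans ?_⟩
      simp

/-- The label that a run gives to a pair of vertices. -/
noncomputable def runLabel (P : Placement M N) (ω : (clusterAlgorithm M N k Γ Λ L R B f D).Coins)
    (x : Sym2 (Fin N)) : Fin Γ × Fin k × Fin R := (choice ω (holder P x)).1 x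

/-- The centres that are chosen in a run. -/
noncomputable def runCentre (ω : (clusterAlgorithm M N k Γ Λ L R B f D).Coins)
    (t : Fin (Λ * k)) : Fin N :=
  (choice ω (cellHost M
    (centreCell (N := N) (k := k) (Γ := Γ) (Λ := Λ) (L := L) (R := R) t))).2 t

lemma initialCells_cluster {s : ℕ} {G : SimpleGraph (Fin N)} {P : Placement M N}
    (hP : IsPlacement s G P) (ω : (clusterAlgorithm M N k Γ Λ L R B f D).Coins) :
    initialCells (τ := Token N k R B) ω P = startCells B L (allEdges P) (runLabel P ω) (runCentre ω) :=
  deliver_firstOut (cellHost M) hP (choice ω)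

lemma succeeds_cluster {W s : ℕ} {S : ℝ} {σ : Fin N → Fin k} {G : SimpleGraph (Fin N)}
    [DecidableRel G.Adj] {P : Placement M N} (hP : IsPlacement s G P)
    (ω : (clusterAlgorithm M N k Γ Λ L R B f D).Coins)
    (hNW : N ≤ W) (hW : Fintype.card (Cell N k Γ Λ L R × Token N k R B) ≤ W)
    (hPS : ((∑ i, 2 * (P i).length : ℕ) : ℝ) ≤ S)
    (hcap : L * ((Γ + Λ * (Γ * L)) / M + 1) + (2 * b + 1) * ((Λ * k * (N * R)) / M + 1) ≤ s)
    (htotal : ((L * (Γ + Λ * (Γ * L)) + (2 * b + 1) * (Λ * k * (N * R)) : ℕ) : ℝ) ≤ S)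
    (hΛ : Λ ≤ L ^ 2) (hL2 : 2 ≤ L) (hf : 0 < f) (hfb : f ≤ b) (hNB : N ≤ B) (hTB : Λ * k ≤ B)
    (hD0 : 0 < D) (hDT : Λ * k ≤ f ^ D) (hDN : N ≤ f ^ D) (hDR : R ≤ f ^ D)
    (hL : ∀ γ, (group (allEdges P) (runLabel P ω) γ).card ≤ L)
    (hnb : ∀ β : Grid (Λ * k) N R, (neighbours G (runLabel P ω) β).card ≤ b)
    (hsame : ∀ t v, Same (k = 1) B (pathCount (groupAdj G (runLabel P ω)) (runCentre ω))
      (runCentre ω) t v ↔ σ (runCentre ω t) = σ v)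
    (hcentre : ∀ v, ∃ t, σ (runCentre ω t) = σ v) :
    Succeeds (clusterAlgorithm M N k Γ Λ L R B f D) W s S σ P ω := by
  have hb : 1 ≤ b := hf.trans_le hfb
  have hkT : k ≤ Λ * k := Nat.le_mul_of_pos_left _ (Nat.pos_of_ne_zero (NeZero.ne Λ))
  obtain ⟨lab, h1, h2⟩ := rank_spec hsame hcentre
  refine succeeds_of_program hP ω (runLabel P ω) (runCentre ω) (initialCells_cluster hP ω) hNW hW
    hPS hcap htotal hΛ hL2 hb (hkT.trans hTB) hL hnb
    (within_program _ hnb (count_neighbours_symm G _) hb hf hfb) lab ?_ h2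
  rw [exec_program (k = 1) (neighbours G (runLabel P ω)) (runCentre ω)
    (groupAdj G (runLabel P ω)) (sum_count_neighbours G _)
    (fun t v => (pathCount_groupAdj_le G _ _ t v).trans hNB) hNB hTB hD0 hDT hDN hDR]
  · simp only [h1]
  · intro α
    change sumBy (satAdd B) (centreTokens B (runCentre ω) α) = _
    unfold centreTokens
    split_ifs
    · exact sumBy_singleton _ _
    · rfl

end Algorithm
end MPC

/-! ### The probability of success for several machines -/

namespace MPC
open Finset

open Classical in
lemma exists_isPlacement {M N s : ℕ} (G : SimpleGraph (Fin N))
    (h : G.edgeFinset.card ≤ M * (s / 2)) : ∃ P : Placement M N, IsPlacement s G P := by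
  rcases Nat.eq_zero_or_pos G.edgeFinset.card with h0 | h0
  · refine ⟨fun _ => [], ?_, fun i => by simp⟩
    rw [card_eq_zero.1 h0]
    simp
  have hs : 0 < s / 2 := Nat.pos_of_mul_pos_left (h0.trans_le h)
  let idx : G.edgeFinset → ℕ := fun x => (G.edgeFinset.equivFin x).val
  have hidx : ∀ x, idx x / (s / 2) < M := fun x =>
    (Nat.div_lt_iff_lt_mul hs).2 ((G.edgeFinset.equivFin x).2.trans_le h)
  let g : G.edgeFinset → Fin M := fun x => ⟨idx x / (s / 2), hidx x⟩
  have hg : ∀ i, (univ.filter fun x => g x = i).card ≤ s / 2 := by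
    intro i
    rw [← card_range (s / 2)]
    refine card_le_card_of_injOn (fun x => idx x % (s / 2)) (fun x _ => ?_) ?_
    · simpa using Nat.mod_lt _ hs
    · intro x hx x' hx' hxx
      simp only [coe_filter, mem_univ, true_and, Set.mem_ofPred_eq] at hx hx'
      have h1 : idx x / (s / 2) = i := congrArg Fin.val hx
      have h2 : idx x' / (s / 2) = i := congrArg Fin.val hx'
      refine (G.edgeFinset.equivFin).injective (Fin.ext ?_)
      change idx x = idx x'
      rw [← Nat.div_add_mod (idx x) (s / 2), ← Nat.div_add_mod (idx x') (s / 2), h1, h2]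
      exact congrArg (fun y => s / 2 * i.val + y) hxx
  refine ⟨fun i => (univ.filter fun x => g x = i).toList.map fun x => Quot.out x.val, ?_, ?_⟩
  · have h1 : ∀ i, ((((univ.filter fun x => g x = i).toList.map fun x =>
        (Quot.out x.val : Fin N × Fin N)).map fun e => s(e.1, e.2) : List (Sym2 (Fin N))) :
          Multiset (Sym2 (Fin N))) = ∑ x with g x = i, {x.val} := by
      intro i
      rw [List.map_map, ← Multiset.map_coe, Finset.coe_toList, sum_singleton_eq_map]
      exact Multiset.map_congr rfl fun x _ => Quot.out_eq x.val
    simp_rw [h1]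
    rw [sum_fiberwise univ g fun x => ({x.val} : Multiset (Sym2 (Fin N))), sum_singleton_eq_map]
    exact Multiset.attach_map_val G.edgeFinset.val
  · intro i
    rw [List.length_map, length_toList]
    have := hg i
    omega

section Success

variable {M n k Γ Λ L R B b f D : ℕ} [NeZero M] [NeZero Λ] [NeZero (k * n)] [NeZero k] [NeZero R]
  [NeZero Γ]

open Classical in
lemma card_group {N s : ℕ} {G : SimpleGraph (Fin N)} {P : Placement M N} (hP : IsPlacement s G P)
    (ℓ : Sym2 (Fin N) → Fin Γ × Fin k × Fin R) (γ : Fin Γ) :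
    (group (allEdges P) ℓ γ).card = (G.edgeFinset.filter fun e => (ℓ e).1 = γ).card := by
  rw [group, Multiset.card_map, Finset.card_def, filter_val, ← map_allEdges hP,
    Multiset.filter_map, Multiset.card_map]
  rfl

/-- The midpoints `c t` and `v` contribute nothing because there are no loops. -/
lemma pathCount_eq_codeg {N : ℕ} [NeZero N] (G : SimpleGraph (Fin N)) [DecidableRel G.Adj]
    (ℓ : Sym2 (Fin N) → Fin Γ × Fin k × Fin R) (c : Fin (Λ * k) → Fin N) (t : Fin (Λ * k))
    (v : Fin N) (hv : v ≠ c t) : (pathCount (groupAdj G ℓ) c t v : ℝ) =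
      SBM.codeg (univ.filter fun y => y.2.1 = (finProdFinEquiv.symm t).2) G ℓ (c t) v := by
  classical
  rw [pathCount, SBM.codeg, SBM.hits, ← sum_subset (subset_univ (univ \ {c t, v}))]
  · push_cast
    refine sum_congr rfl fun w hw => ?_
    simp only [mem_sdiff, mem_univ, true_and, mem_insert, mem_singleton, not_or] at hw
    rw [prod_pair]
    · simp only [groupAdj, SBM.hit, SimpleGraph.mem_edgeFinset, SimpleGraph.mem_edgeSet,
        mem_filter, mem_univ, true_and]
      push_cast
      ring
    · rw [Ne, Sym2.eq_iff]
      rintro (⟨h1, h2⟩ | ⟨h1, h2⟩)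
      · exact hw.1 h1.symm
      · exact hv h1.symm
  · intro w _ hw
    simp only [mem_sdiff, mem_univ, true_and, mem_insert, mem_singleton, not_not] at hw
    rcases hw with rfl | rfl
    · simp [groupAdj]
    · simp [groupAdj]

open Classical in
/-- The event that the labels of the pairs of vertices are not good. -/
def BadLabels (n k Γ R L b : ℕ) (p q : ℝ) (σ : Fin (k * n) → Fin k)
    (G : SimpleGraph (Fin (k * n))) (ℓ : Sym2 (Fin (k * n)) → Fin Γ × Fin k × Fin R) : Prop :=
  (∃ γ : Fin Γ, L + 1 ≤ (G.edgeFinset.filter fun e => ℓ e ∈ univ.filter fun y => y.1 = γ).card) ∨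
  (∃ x : Fin (k * n) × Fin k × Fin R, b + 1 ≤ (univ.filter fun w => G.Adj x.1 w ∧
    ℓ s(x.1, w) ∈ univ.filter fun y => y.2 = x.2).card) ∨
  ∃ j : Fin k, ¬ SBM.Separates σ ((1 / k) ^ 2 * (k * n * q ^ 2 + 2 * (p - q) * q * n))
    ((1 / k) ^ 2 * ((p - q) ^ 2 * n)) (SBM.codeg (univ.filter fun y => y.2.1 = j) G ℓ)

lemma card_label_fst (γ : Fin Γ) :
    ((univ.filter fun y : Fin Γ × Fin k × Fin R => y.1 = γ).card : ℝ) /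
      Fintype.card (Fin Γ × Fin k × Fin R) = 1 / Γ := by
  have : (univ.filter fun y : Fin Γ × Fin k × Fin R => y.1 = γ) = {γ} ×ˢ univ := by
    ext y; simp only [mem_filter, mem_univ, true_and, mem_product, mem_singleton, and_true]
  have h1 : (k : ℝ) ≠ 0 := by exact_mod_cast NeZero.ne k
  have h2 : (R : ℝ) ≠ 0 := by exact_mod_cast NeZero.ne R
  have h3 : (Γ : ℝ) ≠ 0 := by exact_mod_cast NeZero.ne Γ
  rw [this, card_product]
  simp only [card_singleton, card_univ, Fintype.card_prod, Fintype.card_fin]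
  push_cast
  field_simp

lemma card_label_snd (x : Fin k × Fin R) :
    ((univ.filter fun y : Fin Γ × Fin k × Fin R => y.2 = x).card : ℝ) /
      Fintype.card (Fin Γ × Fin k × Fin R) = 1 / (k * R) := by
  have : (univ.filter fun y : Fin Γ × Fin k × Fin R => y.2 = x) = univ ×ˢ {x} := by
    ext y; simp only [mem_filter, mem_univ, true_and, mem_product, mem_singleton]
  have h1 : (k : ℝ) ≠ 0 := by exact_mod_cast NeZero.ne k
  have h2 : (R : ℝ) ≠ 0 := by exact_mod_cast NeZero.ne R
  have h3 : (Γ : ℝ) ≠ 0 := by exact_mod_cast NeZero.ne Γ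
  rw [this, card_product]
  simp only [card_singleton, card_univ, Fintype.card_prod, Fintype.card_fin]
  push_cast
  field_simp

lemma card_label_group (j : Fin k) :
    ((univ.filter fun y : Fin Γ × Fin k × Fin R => y.2.1 = j).card : ℝ) /
      Fintype.card (Fin Γ × Fin k × Fin R) = 1 / k := by
  have : (univ.filter fun y : Fin Γ × Fin k × Fin R => y.2.1 = j) = univ ×ˢ ({j} ×ˢ univ) := by
    ext y; simp only [mem_filter, mem_univ, true_and, mem_product, mem_singleton, and_true]
  have h1 : (k : ℝ) ≠ 0 := by exact_mod_cast NeZero.ne k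
  have h2 : (R : ℝ) ≠ 0 := by exact_mod_cast NeZero.ne R
  have h3 : (Γ : ℝ) ≠ 0 := by exact_mod_cast NeZero.ne Γ
  rw [this, card_product, card_product]
  simp only [card_singleton, card_univ, Fintype.card_prod, Fintype.card_fin]
  push_cast
  field_simp

/-- A union bound over the groups, the parts of neighbourhoods and the `k` subgraphs. The subgraphs
have density `r = 1 / k`, the smallest that `SBM.prob_not_separates_le` admits. -/
lemma prob_badLabels_le {p q : ℝ} (hs : SBM.Signal n k p q) {σ : Fin (k * n) → Fin k}
    (hσ : SBM.IsBalanced n k σ) (hn : 1 ≤ n) {y : ℝ} (hy : 0 < y)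
    (hL : Real.exp y * (SBM.edgeScale n k p q * (1 / Γ)) ≤ L)
    (hb : Real.exp y * ((n * p + k * n * q) * (1 / (k * R))) ≤ b) :
    SBM.prob p q σ (BadLabels n k Γ R L b p q σ) ≤
      Γ * Real.exp (-((y - 1) * (L + 1))) +
        (k * n * (k * R) * Real.exp (-((y - 1) * (b + 1))) +
          k * ((k * n) ^ 2 * (2 / (n : ℝ) ^ 9))) := by
  have hk : 1 ≤ k := Nat.one_le_iff_ne_zero.2 (NeZero.ne k)
  have hq := hs.q_pos.le
  have hqp := hs.q_lt_p.le
  have hp := hs.p_lt_one.le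
  refine (SBM.prob_or_le hq hqp hp _ _).trans (add_le_add ?_
    ((SBM.prob_or_le hq hqp hp _ _).trans (add_le_add ?_ ?_)))
  · refine (SBM.prob_exists_le hq hqp hp _
      (Real.exp (-((y - 1) * (L + 1)))) fun γ => ?_).trans (le_of_eq ?_)
    · refine ((SBM.prob_mono hq hqp hp fun G ℓ h => ?_).trans (SBM.prob_edges_le hs hσ
        (univ.filter fun y => y.1 = γ) y hy (L + 1) ?_)).trans (le_of_eq (by push_cast; rfl))
      · refine h.trans (le_of_eq ?_)
        congr!
      rw [card_label_fst]
      push_cast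
      linarith
    · rw [Fintype.card_fin]
  · refine (SBM.prob_exists_le hq hqp hp _
      (Real.exp (-((y - 1) * (b + 1)))) fun x => ?_).trans (le_of_eq ?_)
    · refine ((SBM.prob_mono hq hqp hp fun G ℓ h => ?_).trans (SBM.prob_degree_le hs hσ
        (univ.filter fun y => y.2 = x.2) x.1 y hy (b + 1) ?_)).trans (le_of_eq (by push_cast; rfl))
      · refine h.trans (le_of_eq ?_)
        congr!
      rw [card_label_snd]
      push_cast
      linarith
    · simp only [Fintype.card_prod, Fintype.card_fin]
      push_cast
      ring
  · refine (SBM.prob_exists_le hq hqp hp _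
      ((k * n) ^ 2 * (2 / (n : ℝ) ^ 9)) fun j => ?_).trans (le_of_eq ?_)
    · refine SBM.prob_not_separates_le hs hσ hn hk _ (card_label_group j) ?_
      rw [one_div_mul_cancel]
      exact_mod_cast NeZero.ne k
    · rw [Fintype.card_fin]

/-- The comparison of counts needs a centre outside the cluster of `v`. For `k = 1` there is none,
and the program answers without counting. -/
lemma same_iff_of_separates {N : ℕ} [NeZero N] {σ : Fin N → Fin k} {G : SimpleGraph (Fin N)}
    [DecidableRel G.Adj] {ℓ : Sym2 (Fin N) → Fin Γ × Fin k × Fin R} {c : Fin (Λ * k) → Fin N}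
    {h Δ : ℝ} (hΔ : 0 < Δ) (hNB : N ≤ B) (hσ : ∀ x, ∃ v, σ v = x)
    (hsep : ∀ j, SBM.Separates σ h Δ (SBM.codeg (univ.filter fun y => y.2.1 = j) G ℓ))
    (hc : ∀ v, ∃ t, v ≠ c t ∧ σ (c t) = σ v) (t : Fin (Λ * k)) (v : Fin N) :
    Same (k = 1) B (pathCount (groupAdj G ℓ) c) c t v ↔ σ (c t) = σ v := by
  by_cases hk : k = 1
  · subst hk
    exact iff_of_true (Or.inl rfl) (Subsingleton.elim _ _)
  · refine same_iff (h := h) hΔ (fun t v => (pathCount_groupAdj_le G ℓ c t v).trans hNB) ?_ hc ?_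
      hk t v
    · intro t v hv
      rw [pathCount_eq_codeg G ℓ c t v hv]
      exact hsep _ (c t) v (Ne.symm hv)
    · intro v
      have hk0 := NeZero.ne k
      have : Nontrivial (Fin k) := Fin.nontrivial_iff_two_le.2 (by omega)
      obtain ⟨x, hx⟩ := exists_ne (σ v)
      obtain ⟨u, rfl⟩ := hσ x
      obtain ⟨t, -, ht⟩ := hc u
      exact ⟨t, fun h => hx (ht.symm.trans h)⟩

/-- The clustering algorithm for several machines succeeds with large probability. -/
lemma le_successProb_cluster {p q : ℝ} (hs : SBM.Signal n k p q) {σ : Fin (k * n) → Fin k}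
    (hσ : SBM.IsBalanced n k σ) (hn : 1 ≤ n) {W s : ℕ} {S : ℝ}
    (Dist : SimpleGraph (Fin (k * n)) → Placement M (k * n))
    (hDist : ∀ G, (∃ P : Placement M (k * n), IsPlacement s G P) → IsPlacement s G (Dist G))
    {y : ℝ} (hy : 0 < y)
    (hL : Real.exp y * (SBM.edgeScale n k p q * (1 / Γ)) ≤ L)
    (hb : Real.exp y * ((n * p + k * n * q) * (1 / (k * R))) ≤ b)
    (hNW : k * n ≤ W) (hW : Fintype.card (Cell (k * n) k Γ Λ L R × Token (k * n) k R B) ≤ W)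
    (hedges : Γ * L ≤ M * (s / 2))
    (hcap : L * ((Γ + Λ * (Γ * L)) / M + 1) + (2 * b + 1) * ((Λ * k * (k * n * R)) / M + 1) ≤ s)
    (htotal : ((L * (Γ + Λ * (Γ * L)) + (2 * b + 1) * (Λ * k * (k * n * R)) : ℕ) : ℝ) ≤ S)
    (hΛ : Λ ≤ L ^ 2) (hΛ2 : 2 ≤ Λ) (hL2 : 2 ≤ L) (hf : 0 < f) (hfb : f ≤ b)
    (hNB : k * n ≤ B) (hTB : Λ * k ≤ B)
    (hD0 : 0 < D) (hDT : Λ * k ≤ f ^ D) (hDN : k * n ≤ f ^ D) (hDR : R ≤ f ^ D) :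
    1 - (Γ * Real.exp (-((y - 1) * (L + 1))) +
        (k * n * (k * R) * Real.exp (-((y - 1) * (b + 1))) +
          k * ((k * n) ^ 2 * (2 / (n : ℝ) ^ 9)))) -
      k * n * Real.exp (-(Λ * k * (n - 1) / (k * n))) ≤
      successProb (clusterAlgorithm M (k * n) k Γ Λ L R B f D) W s S p q σ Dist := by
  classical
  have hn0 : (0 : ℝ) < n := by exact_mod_cast hn
  have hk0 : (0 : ℝ) < k := by exact_mod_cast Nat.pos_of_ne_zero (NeZero.ne k)
  have hsurj : ∀ x, ∃ v, σ v = x := by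
    intro x
    have h1 : 0 < (univ.filter fun v => σ v = x).card := by rw [hσ x]; exact hn
    obtain ⟨v, hv⟩ := card_pos.1 h1
    exact ⟨v, (mem_filter.1 hv).2⟩
  -- The vertex `v` is removed since `v` needs a centre in its cluster other than itself for its
  -- largest count.
  let C : Fin (k * n) → Finset (Fin (k * n)) := fun v => (univ.filter fun w => σ w = σ v).erase v
  have hC : ∀ v, n - 1 ≤ (C v).card := by
    intro v
    rw [card_erase_of_mem (by simp), hσ (σ v)]
  have hcentre := card_not_hit_le (T := Λ * k) C (n - 1) hC (Nat.pos_of_ne_zero (NeZero.ne _))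
  have hbad := prob_badLabels_le (Γ := Γ) (R := R) (L := L) (b := b) hs hσ hn hy hL hb
  refine le_trans ?_ (le_successProb (clusterAlgorithm M (k * n) k Γ Λ L R B f D) W s
    hs.q_pos.le hs.q_lt_p.le hs.p_lt_one.le σ Dist (fun G ω => runLabel (Dist G) ω)
    (fun ω => runCentre ω) ?_ ?_ (BadLabels n k Γ R L b p q σ)
    (fun κ : Fin (Λ * k) → Fin (k * n) => ¬ ∀ x, ∃ t, κ t ∈ C x) ?_)
  · refine sub_le_sub (sub_le_sub le_rfl hbad) (le_trans (le_of_eq ?_) (hcentre.trans (le_of_eq ?_)))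
    · congr!
    · push_cast [Nat.cast_sub hn]
      rfl
  · intro G
    exact equidistributed_labels ((finCongr (Nat.sub_add_cancel Fintype.card_pos)).trans
      (Fintype.equivFin (Coin (k * n) k Γ Λ R)).symm) ⟨0, Nat.succ_pos _⟩ (holder (Dist G))
  -- With the two components of a coin exchanged, the centres play the role of the labels.
  · exact equidistributed_labels (((finCongr (Nat.sub_add_cancel Fintype.card_pos)).trans
      (Fintype.equivFin (Coin (k * n) k Γ Λ R)).symm).trans (Equiv.prodComm _ _))
      ⟨0, Nat.succ_pos _⟩ (fun t => cellHost M
        (centreCell (N := k * n) (k := k) (Γ := Γ) (Λ := Λ) (L := L) (R := R) t))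
  · intro G ω hE hκ
    simp only [BadLabels, not_or, not_exists, not_le, not_not, Nat.lt_succ_iff] at hE hκ
    obtain ⟨h1, h2, h3⟩ := hE
    have h1' : ∀ γ, (G.edgeFinset.filter fun e => (runLabel (Dist G) ω e).1 = γ).card ≤ L := by
      intro γ
      refine le_trans (le_of_eq ?_) (h1 γ)
      simp only [mem_filter, mem_univ, true_and]
    -- Small groups imply few edges. The graph then fits into the machines, so the given
    -- distribution is a placement.
    have hcard : G.edgeFinset.card ≤ Γ * L := by
      rw [card_eq_sum_card_fiberwise (f := fun e => (runLabel (Dist G) ω e).1) (t := univ)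
        (fun e _ => mem_coe.2 (mem_univ _))]
      refine (sum_le_sum fun γ _ => h1' γ).trans (by simp)
    have hP := hDist G (exists_isPlacement G (hcard.trans hedges))
    refine ⟨hP, ?_⟩
    have hc : ∀ v, ∃ t, v ≠ runCentre ω t ∧ σ (runCentre ω t) = σ v := by
      intro v
      obtain ⟨t, ht⟩ := hκ v
      simp only [C, mem_erase, mem_filter, mem_univ, true_and] at ht
      exact ⟨t, ht.1.symm, ht.2⟩
    refine succeeds_cluster hP ω hNW hW ?_ hcap htotal hΛ hL2 hf hfb hNB hTB hD0 hDT hDN hDR ?_ ?_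
      ?_ fun v => (hc v).imp fun t ht => ht.2
    · refine le_trans ?_ htotal
      have h4 : ∑ i, 2 * (Dist G i).length = 2 * G.edgeFinset.card := by
        rw [← mul_sum, Finset.card_def, ← map_allEdges hP, Multiset.card_map, allEdges,
          Multiset.card_sum]
        rfl
      have h5 : 2 * (Γ * L) ≤ L * (Λ * (Γ * L)) := by
        calc 2 * (Γ * L) ≤ Λ * (Γ * L) := Nat.mul_le_mul_right _ hΛ2
          _ ≤ _ := Nat.le_mul_of_pos_left _ (by omega)
      rw [h4]
      refine Nat.cast_le.2 ?_
      rw [Nat.mul_add]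
      omega
    · intro γ
      rw [card_group hP]
      exact h1' γ
    · intro β
      refine le_trans (le_of_eq ?_) (h2 (β.2.1, (finProdFinEquiv.symm β.1).2, β.2.2))
      rw [neighbours]
      simp only [mem_filter, mem_univ, true_and]
      rfl
    · have hpos : 0 < (1 / k : ℝ) ^ 2 * ((p - q) ^ 2 * n) := by
        have := sub_pos.2 hs.q_lt_p
        positivity
      exact same_iff_of_separates hpos hNB hsurj h3 hc

end Success
end MPC

/-! ### Consequences of the assumption on `p` and `q` -/

namespace SBM

/-- The fourth power of the hypothesis gives `Signal.pow_le`, with `10 ^ 4 = 10000`. As `(p - q) ^ 2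
≤ p ^ 2` and `k ^ 3 * log n ≥ 1`, it also gives `(p - q) ^ 2 * n ≥ 10000`, which is more than
`Signal.sq_le` needs because `p < 1`. -/
lemma signal_of_le {n k : ℕ} {p q : ℝ} (hn : 1 ≤ Real.log n) (hk : 1 ≤ k) (hq : 0 < q)
    (hqp : q < p) (hp : p < 1)
    (h : 10 * ((k : ℝ) ^ (3 / 4 : ℝ) * (n : ℝ) ^ (-(1 / 4) : ℝ) * Real.log n ^ (1 / 4 : ℝ)) ≤
      (p - q) / Real.sqrt p) : Signal n k p q := by
  have hp0 : 0 < p := hq.trans hqp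
  have hn0 : (0 : ℝ) < n := by
    rcases Nat.eq_zero_or_pos n with rfl | h0
    · norm_num at hn
    · exact_mod_cast h0
  have hk0 : (1 : ℝ) ≤ k := by exact_mod_cast hk
  have hlog : 0 ≤ Real.log n := by linarith
  have h4 := pow_le_pow_left₀ (by positivity) h 4
  have e1 : ((k : ℝ) ^ (3 / 4 : ℝ)) ^ 4 = (k : ℝ) ^ 3 := by
    rw [← Real.rpow_natCast, ← Real.rpow_mul (by positivity)]
    norm_num
  have e2 : ((n : ℝ) ^ (-(1 / 4) : ℝ)) ^ 4 = (n : ℝ)⁻¹ := by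
    rw [← Real.rpow_natCast, ← Real.rpow_mul (by positivity), ← Real.rpow_neg_one]
    norm_num
  have e3 : (Real.log n ^ (1 / 4 : ℝ)) ^ 4 = Real.log n := by
    rw [← Real.rpow_natCast, ← Real.rpow_mul hlog]
    norm_num
  have e4 : Real.sqrt p ^ 4 = p ^ 2 := by
    rw [show 4 = 2 * 2 from rfl, pow_mul, Real.sq_sqrt hp0.le]
  rw [mul_pow, mul_pow, mul_pow, div_pow, e1, e2, e3, e4, le_div_iff₀ (by positivity)] at h4
  have hpow : 10000 * (k : ℝ) ^ 3 * Real.log n * p ^ 2 ≤ (p - q) ^ 4 * n := by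
    calc _ = (10 ^ 4 * ((k : ℝ) ^ 3 * (n : ℝ)⁻¹ * Real.log n) * p ^ 2) * n := by
          field_simp
          norm_num
      _ ≤ _ := by gcongr
  refine ⟨hq, hqp, hp, hpow, ?_⟩
  have hd : 0 < p - q := sub_pos.2 hqp
  have hk3 : (1 : ℝ) ≤ (k : ℝ) ^ 3 := one_le_pow₀ hk0
  have h5 : 10000 * p ^ 2 ≤ p ^ 2 * ((p - q) ^ 2 * n) := by
    calc 10000 * p ^ 2 ≤ 10000 * (k : ℝ) ^ 3 * Real.log n * p ^ 2 := by
          have : 1 * 1 ≤ (k : ℝ) ^ 3 * Real.log n := mul_le_mul hk3 hn zero_le_one (by positivity)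
          nlinarith [sq_nonneg p]
      _ ≤ (p - q) ^ 4 * n := hpow
      _ = (p - q) ^ 2 * ((p - q) ^ 2 * n) := by ring
      _ ≤ p ^ 2 * ((p - q) ^ 2 * n) := by
          gcongr
          linarith
  have h6 : 10000 ≤ (p - q) ^ 2 * n := by
    have hp2 : 0 < p ^ 2 := by positivity
    refine le_of_mul_le_mul_left ?_ hp2
    linarith
  nlinarith

namespace Signal

variable {n k : ℕ} {p q : ℝ}

lemma sq_mul_ge (hs : Signal n k p q) : 10000 * (k : ℝ) ^ 3 * Real.log n ≤ p ^ 2 * n := by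
  have hp0 : 0 < p := hs.q_pos.trans hs.q_lt_p
  have hd : 0 < p - q := sub_pos.2 hs.q_lt_p
  refine le_of_mul_le_mul_right ?_ (show 0 < p ^ 2 by positivity)
  refine hs.pow_le.trans ?_
  calc (p - q) ^ 4 * n ≤ p ^ 4 * n := by
        gcongr
        linarith [hs.q_pos]
    _ = _ := by ring

lemma pow_three_le (hs : Signal n k p q) (hn : 1 ≤ Real.log n) : (k : ℝ) ^ 3 ≤ n := by
  have hp0 : 0 < p := hs.q_pos.trans hs.q_lt_p
  have h1 : p ^ 2 * n ≤ 1 * n := by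
    gcongr
    exact pow_le_one₀ hp0.le hs.p_lt_one.le
  have h2 := hs.sq_mul_ge
  have h3 : (k : ℝ) ^ 3 * 1 ≤ (k : ℝ) ^ 3 * Real.log n := by gcongr
  nlinarith [pow_nonneg (Nat.cast_nonneg (α := ℝ) k) 3]

lemma le_of_signal (hs : Signal n k p q) (hn : 1 ≤ Real.log n) : k ≤ n := by
  have h := hs.pow_three_le hn
  have h1 : k ^ 3 ≤ n := by exact_mod_cast h
  exact (Nat.le_self_pow (by norm_num) k).trans h1

/-- Degrees are at least of order `k * √n`. This pays for main cells whose loads may be as large as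
`√n`. -/
lemma mul_sqrt_le (hs : Signal n k p q) (hk : 1 ≤ k) (hn : 1 ≤ Real.log n) :
    k * Real.sqrt n ≤ n * p := by
  have hp0 : 0 < p := hs.q_pos.trans hs.q_lt_p
  have hk0 : (1 : ℝ) ≤ k := by exact_mod_cast hk
  refine le_of_sq_le_sq ?_ (by positivity)
  rw [mul_pow, Real.sq_sqrt (by positivity)]
  have h2 := hs.sq_mul_ge
  have h3 : (k : ℝ) ^ 2 ≤ 10000 * (k : ℝ) ^ 3 * Real.log n := by
    calc (k : ℝ) ^ 2 = 1 * (k : ℝ) ^ 2 * 1 := by ring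
      _ ≤ 10000 * (k : ℝ) ^ 3 * Real.log n := by
        gcongr
        · norm_num
        · norm_num
  calc (k : ℝ) ^ 2 * n ≤ (p ^ 2 * n) * n := by
        gcongr
        linarith
    _ = _ := by ring

end Signal

lemma edgeScale_le {n k : ℕ} {p q : ℝ} (hk : 1 ≤ k) (hp0 : 0 ≤ p) (hp : p ≤ 1)
    (hq : q ≤ 1) :
    edgeScale n k p q ≤ 2 * (k * n) ^ 2 := by
  have hk0 : (1 : ℝ) ≤ k := by exact_mod_cast hk
  unfold edgeScale
  have h1 : (k : ℝ) * n ^ 2 * p ≤ k ^ 2 * n ^ 2 * 1 := by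
    gcongr
    nlinarith
  have h2 : (k : ℝ) ^ 2 * n ^ 2 * q ≤ k ^ 2 * n ^ 2 * 1 := by gcongr
  nlinarith

end SBM

/-! ### Fan-out, loads and number of rounds -/

namespace MPC

/-- The fan-out of the trees that are used for sums: about `s ^ (1 / 20)`. -/
def fanOut (s : ℕ) : ℕ := Nat.findGreatest (fun f => f ^ 20 ≤ s) s

lemma fanOut_pow_le (s : ℕ) : fanOut s ^ 20 ≤ s :=
  Nat.findGreatest_spec (P := fun f => f ^ 20 ≤ s) (Nat.zero_le s) (by norm_num)

lemma lt_fanOut_pow (s : ℕ) : s < (fanOut s + 1) ^ 20 := by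
  by_contra! h
  have h1 : fanOut s + 1 ≤ s := (Nat.le_self_pow (by norm_num) _).trans h
  exact Nat.findGreatest_is_greatest (P := fun f => f ^ 20 ≤ s) (Nat.lt_succ_self _) h1 h

lemma two_le_fanOut {s : ℕ} (hs : 2 ^ 20 ≤ s) : 2 ≤ fanOut s := by
  refine Nat.le_findGreatest ?_ hs
  exact (by norm_num : 2 ≤ 2 ^ 20).trans hs

/-- Either kind of cell needs at most an eighth of the total space. Rounding adds at most one cell
of each kind per machine, and `24 * b ≤ s` makes room for these. -/
lemma loads_le {L Λ Γ b K R M s : ℕ} (hΓ : 16 * (Λ * L ^ 2) * Γ ≤ M * s)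
    (hR : 24 * (b * (Λ * K)) * R ≤ M * s) (hL : 1 ≤ L) (hΛ : 1 ≤ Λ) (hLb : L ≤ b) (hM : 0 < M)
    (hbs : 24 * b ≤ s) :
    L * ((Γ + Λ * (Γ * L)) / M + 1) + (2 * b + 1) * ((Λ * K * R) / M + 1) ≤ s ∧
    4 * (L * (Γ + Λ * (Γ * L)) + (2 * b + 1) * (Λ * K * R)) ≤ M * s ∧
    Γ * L ≤ M * (s / 2) := by
  have h1 : 8 * (L * (Γ + Λ * (Γ * L))) ≤ M * s := by
    refine le_trans ?_ hΓ
    have : Γ ≤ Λ * (Γ * L) := by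
      calc Γ = 1 * (Γ * 1) := by ring
        _ ≤ Λ * (Γ * L) := by gcongr
    calc _ ≤ 8 * (L * (Λ * (Γ * L) + Λ * (Γ * L))) := by gcongr
      _ = _ := by ring
  have h2 : 8 * ((2 * b + 1) * (Λ * K * R)) ≤ M * s := by
    refine le_trans ?_ hR
    calc _ ≤ 8 * ((3 * b) * (Λ * K * R)) := by gcongr; omega
      _ = _ := by ring
  have h3 : ∀ a X : ℕ, 8 * (a * X) ≤ M * s → 8 * (a * (X / M)) ≤ s := by
    intro a X h
    refine Nat.le_of_mul_le_mul_left (le_trans ?_ h) hM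
    calc M * (8 * (a * (X / M))) = 8 * (a * (M * (X / M))) := by ring
      _ ≤ _ := by gcongr; exact Nat.mul_div_le X M
  have h4 := h3 _ _ h1
  have h5 := h3 _ _ h2
  refine ⟨?_, by omega, ?_⟩
  · rw [Nat.mul_add, Nat.mul_add]
    omega
  · have h6 : 16 * (Γ * L) ≤ M * s := by
      refine le_trans ?_ hΓ
      calc 16 * (Γ * L) = 16 * (1 * (L * 1)) * Γ := by ring
        _ ≤ 16 * (Λ * (L * L)) * Γ := by gcongr
        _ = _ := by ring
    have h7 : M * s ≤ M * (16 * (s / 2)) := by gcongr; omega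
    have h8 : M * (16 * (s / 2)) = 16 * (M * (s / 2)) := by ring
    omega

lemma le_two_mul_mul_div {K Q : ℕ} (hK : 0 < K) (h : K ≤ Q) : Q ≤ 2 * K * (Q / K) := by
  have h1 := Nat.div_add_mod Q K
  have h2 := Nat.mod_lt Q hK
  have h3 : 1 ≤ Q / K := (Nat.one_le_div_iff hK).2 h
  nlinarith

/-- The number of rounds, in terms of the memory. -/
lemma clog_fanOut_le {n s : ℕ} (hn : 2 ≤ n) (hs : 2 ^ 20 ≤ s) (hsn : s ≤ n ^ 10) :
    ((18 * Nat.clog (fanOut s) (n ^ 10) + 13 : ℕ) : ℝ) ≤ 7510 * Real.logb s n := by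
  have hf := two_le_fanOut hs
  set f := fanOut s
  set D := Nat.clog f (n ^ 10)
  have hs1 : (1 : ℝ) < s := by
    have : 1 < s := lt_of_lt_of_le (by norm_num) hs
    exact_mod_cast this
  have hlogs : 0 < Real.log s := Real.log_pos hs1
  have hn0 : (0 : ℝ) < n := by
    have : 0 < n := by omega
    exact_mod_cast this
  have hf0 : (1 : ℝ) < f := by
    have : 1 < f := by omega
    exact_mod_cast this
  have hlogf : 0 < Real.log f := Real.log_pos hf0
  have h1 : Real.log s ≤ 10 * Real.log n := by
    have : (s : ℝ) ≤ (n : ℝ) ^ 10 := by exact_mod_cast hsn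
    calc Real.log s ≤ Real.log ((n : ℝ) ^ 10) := Real.log_le_log (by linarith) this
      _ = _ := by rw [Real.log_pow]; norm_num
  -- From `s < (f + 1) ^ 20 ≤ (f ^ 2) ^ 20`, where `f ≥ 2`.
  have h2 : Real.log s ≤ 40 * Real.log f := by
    have h3 : (s : ℝ) ≤ (f : ℝ) ^ 40 := by
      have h4 : s ≤ f ^ 40 := by
        calc s ≤ (f + 1) ^ 20 := (lt_fanOut_pow s).le
          _ ≤ (f ^ 2) ^ 20 := by gcongr; nlinarith
          _ = _ := by rw [← pow_mul]
      exact_mod_cast h4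
    calc Real.log s ≤ Real.log ((f : ℝ) ^ 40) := Real.log_le_log (by linarith) h3
      _ = _ := by rw [Real.log_pow]; norm_num
  have hD0 : 0 < D := Nat.clog_pos (by omega) (by
    calc 2 ≤ n := hn
      _ ≤ n ^ 10 := Nat.le_self_pow (by norm_num) n)
  have h5 : ((D : ℝ) - 1) * Real.log f ≤ 10 * Real.log n := by
    have h6 : f ^ (D - 1) < n ^ 10 := by
      refine Nat.pow_pred_clog_lt_self (by omega) ?_
      calc 1 < n := by omega
        _ ≤ n ^ 10 := Nat.le_self_pow (by norm_num) n
    have h7 : ((f : ℝ)) ^ (D - 1) ≤ (n : ℝ) ^ 10 := by exact_mod_cast h6.le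
    have h8 := Real.log_le_log (by positivity) h7
    rw [Real.log_pow, Real.log_pow, Nat.cast_sub hD0] at h8
    simpa using h8
  have h9 : ((D : ℝ) - 1) * Real.log s ≤ 400 * Real.log n := by
    have : (0 : ℝ) ≤ (D : ℝ) - 1 := by
      have : (1 : ℝ) ≤ D := by exact_mod_cast hD0
      linarith
    nlinarith
  -- The constant is `18 * 400 + (18 + 13) * 10`, where `log s ≤ 10 * log n` absorbs the additive
  -- terms.
  rw [Real.logb, ← mul_div_assoc, le_div_iff₀ hlogs]
  push_cast
  nlinarith

end MPC

/-! ### The choice of the parameters -/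

namespace MPC

/-- The number of edges in a group. -/
noncomputable def groupSize (c : ℝ) (n : ℕ) : ℕ := ⌊c * Real.log n⌋₊

/-- The number of copies of the graph. -/
noncomputable def copies (n : ℕ) : ℕ := ⌈6 * Real.log n⌉₊

/-- A bound for the numbers of tokens in the main cells. -/
noncomputable def loadBound (c : ℝ) (n s : ℕ) : ℕ := fanOut s + groupSize c n

/-- The number of groups of edges. -/
noncomputable def groupCount (c : ℝ) (n s M : ℕ) : ℕ :=
  M * s / (16 * (copies n * groupSize c n ^ 2))

/-- The number of parts of a neighbourhood. -/
noncomputable def partCount (c : ℝ) (n k s M : ℕ) : ℕ :=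
  M * s / (24 * (loadBound c n s * (copies n * (k * (k * n)))))

/-- A bound for the values. -/
noncomputable def maxValue (n k : ℕ) : ℕ := (k * n) ^ 2 + copies n * k

/-- The parameters for which the algorithm for several machines is made. -/
structure Regime (c z : ℝ) (n k s M : ℕ) (p q S : ℝ) : Prop where
  c_pos : 0 < c
  c_le : c ≤ 1 / 100
  one_le_z : 1 ≤ z
  signal : SBM.Signal n k p q
  one_le_k : 1 ≤ k
  two_le_M : 2 ≤ M
  log_ge : 2 ^ 21 / c + 28 / c ^ 2 + 40000 * z ≤ Real.log n
  mem_ge : 100 * c * Real.log n ≤ s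
  space_eq : S = 400 * z * SBM.edgeScale n k p q * Real.log (k * n) ^ 2
  le_total : S ≤ M * s
  total_le : (M : ℝ) * s ≤ 2 * S + s

namespace Regime

variable {c z : ℝ} {n k s M : ℕ} {p q S : ℝ}

lemma le_c_mul_log (h : Regime c z n k s M p q S) : 2 ^ 21 ≤ c * Real.log n := by
  have hc := h.c_pos
  have h1 : 2 ^ 21 / c ≤ Real.log n := by
    have := h.log_ge
    have h2 : 0 ≤ 28 / c ^ 2 := by positivity
    have := h.one_le_z
    linarith
  rw [div_le_iff₀ hc] at h1
  linarith

lemma le_sq_mul_log (h : Regime c z n k s M p q S) : 28 ≤ c ^ 2 * Real.log n := by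
  have hc := h.c_pos
  have h1 : 28 / c ^ 2 ≤ Real.log n := by
    have := h.log_ge
    have h2 : 0 ≤ 2 ^ 21 / c := by positivity
    have := h.one_le_z
    linarith
  rw [div_le_iff₀ (by positivity)] at h1
  linarith

lemma le_log (h : Regime c z n k s M p q S) : 2 ^ 21 ≤ Real.log n := by
  have h1 := h.le_c_mul_log
  have h2 := h.c_le
  have h3 := h.c_pos
  by_contra! h4
  nlinarith

lemma z_le (h : Regime c z n k s M p q S) : 40000 * z ≤ Real.log n := by
  have hc := h.c_pos
  have := h.log_ge
  have h2 : 0 ≤ 28 / c ^ 2 := by positivity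
  have h3 : 0 ≤ 2 ^ 21 / c := by positivity
  linarith

lemma n_pos (h : Regime c z n k s M p q S) : 0 < n := by
  rcases Nat.eq_zero_or_pos n with rfl | h0
  · have := h.le_log
    norm_num at this
  · exact h0

lemma log_le_sqrt (h : Regime c z n k s M p q S) : Real.log n ≤ 2 * Real.sqrt n := by
  have hn : (0 : ℝ) < n := by exact_mod_cast h.n_pos
  have h1 := Real.log_le_sub_one_of_pos (Real.sqrt_pos.2 hn)
  rw [Real.log_sqrt hn.le] at h1
  linarith

lemma log_le (h : Regime c z n k s M p q S) : Real.log n ≤ n := by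
  have hn : (0 : ℝ) < n := by exact_mod_cast h.n_pos
  have h1 := Real.log_le_sub_one_of_pos hn
  linarith

lemma le_n (h : Regime c z n k s M p q S) : 2 ^ 21 ≤ n := by
  have := h.le_log.trans h.log_le
  exact_mod_cast this

lemma groupSize_le (h : Regime c z n k s M p q S) : (groupSize c n : ℝ) ≤ c * Real.log n :=
  Nat.floor_le (le_trans (by norm_num) h.le_c_mul_log)

lemma le_groupSize (_h : Regime c z n k s M p q S) : c * Real.log n ≤ groupSize c n + 1 :=
  (Nat.lt_floor_add_one _).le

lemma two_le_groupSize (h : Regime c z n k s M p q S) : 2 ≤ groupSize c n := by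
  refine Nat.le_floor ?_
  have := h.le_c_mul_log
  push_cast
  linarith

lemma le_copies (_h : Regime c z n k s M p q S) : 6 * Real.log n ≤ copies n := Nat.le_ceil _

lemma copies_le (h : Regime c z n k s M p q S) : (copies n : ℝ) ≤ 7 * Real.log n := by
  have h1 := h.le_log
  have h2 := Nat.ceil_lt_add_one (show 0 ≤ 6 * Real.log n by linarith)
  unfold copies
  linarith

lemma two_le_copies (h : Regime c z n k s M p q S) : 2 ≤ copies n := by
  have h1 := h.le_log
  have h2 := h.le_copies
  have : (2 : ℝ) ≤ copies n := by linarith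
  exact_mod_cast this

/-- This keeps the tree of copies at depth two; it holds for large `n`, as `log n` is compared with
`(c * log n) ^ 2`. -/
lemma copies_le_sq (h : Regime c z n k s M p q S) : copies n ≤ groupSize c n ^ 2 := by
  have h1 := h.copies_le
  have h2 := h.le_groupSize
  have h3 := h.le_c_mul_log
  have h4 := h.le_sq_mul_log
  have h5 := h.le_log
  have h6 : c * Real.log n / 2 ≤ groupSize c n := by linarith
  have h7 : (c * Real.log n / 2) ^ 2 ≤ (groupSize c n : ℝ) ^ 2 := by gcongr
  have h8 : 7 * Real.log n ≤ (c * Real.log n / 2) ^ 2 := by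
    calc 7 * Real.log n = 28 * (Real.log n / 4) := by ring
      _ ≤ (c ^ 2 * Real.log n) * (Real.log n / 4) := by gcongr
      _ = _ := by ring
  have h9 : (copies n : ℝ) ≤ (groupSize c n : ℝ) ^ 2 := by linarith
  exact_mod_cast h9

lemma one_le_log (h : Regime c z n k s M p q S) : 1 ≤ Real.log n := le_trans (by norm_num) h.le_log

lemma k_le (h : Regime c z n k s M p q S) : k ≤ n := h.signal.le_of_signal h.one_le_log

lemma log_le_log_mul (h : Regime c z n k s M p q S) : Real.log n ≤ Real.log (k * n) := by
  have hn : (0 : ℝ) < n := by exact_mod_cast h.n_pos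
  have hk : (1 : ℝ) ≤ k := by exact_mod_cast h.one_le_k
  exact Real.log_le_log hn (by nlinarith)

lemma log_mul_le (h : Regime c z n k s M p q S) : Real.log (k * n) ≤ 2 * Real.log n := by
  have hn : (0 : ℝ) < n := by exact_mod_cast h.n_pos
  have hk : (1 : ℝ) ≤ k := by exact_mod_cast h.one_le_k
  have hkn : (k : ℝ) ≤ n := by exact_mod_cast h.k_le
  calc Real.log (k * n) ≤ Real.log ((n : ℝ) ^ 2) := Real.log_le_log (by positivity) (by nlinarith)
    _ = _ := by rw [Real.log_pow]; norm_num

lemma edgeScale_eq : SBM.edgeScale n k p q = k * n * (n * p + k * n * q) := by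
  unfold SBM.edgeScale
  ring

lemma p_pos (h : Regime c z n k s M p q S) : 0 < p := h.signal.q_pos.trans h.signal.q_lt_p

lemma degree_ge (h : Regime c z n k s M p q S) : k * Real.sqrt n ≤ n * p + k * n * q := by
  have h1 := h.signal.mul_sqrt_le h.one_le_k h.one_le_log
  have h2 := h.signal.q_pos
  have : 0 ≤ (k : ℝ) * n * q := by positivity
  linarith

/-- With at least two machines, `2 * s ≤ M * s ≤ 2 * S + s`. A single machine may have far more
memory than this, which is one reason to treat it apart. -/
lemma mem_le_two_mul (h : Regime c z n k s M p q S) : (s : ℝ) ≤ 2 * S := by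
  have h1 : (2 : ℝ) ≤ M := by exact_mod_cast h.two_le_M
  have h2 := h.total_le
  have h3 : (0 : ℝ) ≤ s := Nat.cast_nonneg s
  nlinarith

lemma total_le_four_mul (h : Regime c z n k s M p q S) : (M : ℝ) * s ≤ 4 * S := by
  have h1 := h.mem_le_two_mul
  have h2 := h.total_le
  linarith

lemma total_le_pow (h : Regime c z n k s M p q S) : M * s ≤ n ^ 7 := by
  have hn : (0 : ℝ) < n := by exact_mod_cast h.n_pos
  have hk : (k : ℝ) ≤ n := by exact_mod_cast h.k_le
  have h1 := SBM.edgeScale_le (n := n) h.one_le_k h.p_pos.le h.signal.p_lt_one.le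
    (h.signal.q_lt_p.trans h.signal.p_lt_one).le
  have h2 := h.log_mul_le
  have h3 := h.log_le_log_mul
  have h4 := h.le_log
  have h5 := h.one_le_z
  have h6 : S ≤ 400 * z * (2 * (n * n) ^ 2) * (2 * Real.log n) ^ 2 := by
    rw [h.space_eq]
    have : SBM.edgeScale n k p q ≤ 2 * ((n : ℝ) * n) ^ 2 := h1.trans (by gcongr)
    gcongr
    linarith
  have h7 := h.log_le
  have h8 := h.z_le
  have h9 : (M : ℝ) * s ≤ (n : ℝ) ^ 7 := by
    calc (M : ℝ) * s ≤ 4 * S := h.total_le_four_mul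
      _ ≤ 4 * (400 * z * (2 * (n * n) ^ 2) * (2 * Real.log n) ^ 2) := by gcongr
      _ = (12800 * z) * Real.log n ^ 2 * n ^ 4 := by ring
      _ ≤ n * n ^ 2 * n ^ 4 := by
        gcongr
        linarith
      _ = _ := by ring
  exact_mod_cast h9

lemma mem_le_pow (h : Regime c z n k s M p q S) : s ≤ n ^ 7 :=
  (Nat.le_mul_of_pos_left s (by have := h.two_le_M; omega)).trans h.total_le_pow

lemma le_mem (h : Regime c z n k s M p q S) : 2 ^ 20 ≤ s := by
  have h1 := h.mem_ge
  have h2 := h.le_c_mul_log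
  have : (2 ^ 20 : ℝ) ≤ s := by linarith
  exact_mod_cast this

lemma two_le_fanOut (h : Regime c z n k s M p q S) : 2 ≤ fanOut s := MPC.two_le_fanOut h.le_mem

/-- The memory is polynomial, `s ≤ n ^ 7 ≤ n ^ 10`, so the exponent `20` in `fanOut` suffices. -/
lemma fanOut_le_sqrt (h : Regime c z n k s M p q S) : (fanOut s : ℝ) ≤ Real.sqrt n := by
  have h1 : fanOut s ^ 20 ≤ n ^ 10 := (fanOut_pow_le s).trans
    (h.mem_le_pow.trans (Nat.pow_le_pow_right h.n_pos (by norm_num)))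
  have h2 : fanOut s ^ 2 ≤ n := by
    rw [show 20 = 2 * 10 from rfl, pow_mul] at h1
    exact (Nat.pow_le_pow_iff_left (by norm_num)).1 h1
  refine Real.le_sqrt_of_sq_le ?_
  exact_mod_cast h2

lemma loadBound_le_sqrt (h : Regime c z n k s M p q S) :
    (loadBound c n s : ℝ) ≤ 3 * Real.sqrt n := by
  have h1 := h.fanOut_le_sqrt
  have h2 := h.groupSize_le
  have h3 := h.log_le_sqrt
  have h4 := h.c_le
  have h5 := h.le_log
  unfold loadBound
  push_cast
  nlinarith

lemma loadBound_le_mem (h : Regime c z n k s M p q S) : 24 * loadBound c n s ≤ s := by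
  have h1 : fanOut s * 2 ^ 19 ≤ s := by
    calc fanOut s * 2 ^ 19 ≤ fanOut s * fanOut s ^ 19 := by
          gcongr
          exact h.two_le_fanOut
      _ = fanOut s ^ 20 := by ring
      _ ≤ s := fanOut_pow_le s
  have h2 := h.groupSize_le
  have h3 := h.mem_ge
  have h4 : (100 * groupSize c n : ℝ) ≤ s := by linarith
  have h5 : 100 * groupSize c n ≤ s := by exact_mod_cast h4
  unfold loadBound
  omega

lemma total_ge (h : Regime c z n k s M p q S) :
    400 * z * SBM.edgeScale n k p q * Real.log n ^ 2 ≤ (M * s : ℕ) := by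
  have h1 := h.le_total
  rw [h.space_eq] at h1
  push_cast
  refine le_trans ?_ h1
  have := h.one_le_z
  have := h.log_le_log_mul
  have := h.one_le_log
  have := h.p_pos
  have := h.signal.q_pos
  have : 0 ≤ SBM.edgeScale n k p q := by unfold SBM.edgeScale; positivity
  gcongr

lemma groups_le (h : Regime c z n k s M p q S) :
    16 * (copies n * groupSize c n ^ 2) ≤ M * s := by
  have hn : (0 : ℝ) < n := by exact_mod_cast h.n_pos
  have hk : (1 : ℝ) ≤ k := by exact_mod_cast h.one_le_k
  have h1 := h.copies_le
  have h2 := h.groupSize_le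
  have h3 := h.one_le_log
  have hc := h.c_pos
  have h4 : (groupSize c n : ℝ) ≤ Real.log n / 100 := by
    have := h.c_le
    nlinarith
  have h5 := h.degree_ge
  have h6 : (1 : ℝ) ≤ Real.sqrt n := by
    have := h.log_le_sqrt
    have := h.le_log
    linarith
  have h7 : Real.log n ≤ SBM.edgeScale n k p q := by
    rw [edgeScale_eq]
    calc Real.log n ≤ 1 * n * (1 * 1) := by linarith [h.log_le]
      _ ≤ k * n * (k * Real.sqrt n) := by gcongr
      _ ≤ _ := by gcongr
  have h8 : ((16 * (copies n * groupSize c n ^ 2) : ℕ) : ℝ) ≤ (M * s : ℕ) := by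
    refine le_trans ?_ h.total_ge
    push_cast
    calc _ ≤ 16 * (7 * Real.log n * (Real.log n / 100) ^ 2) := by gcongr
      _ ≤ 400 * 1 * Real.log n * Real.log n ^ 2 := by
        have : 0 ≤ Real.log n ^ 3 := by positivity
        nlinarith
      _ ≤ _ := by
        have := h.one_le_z
        gcongr
  exact_mod_cast h8

/-- There is space for at least one part. The grid needs about `log n * (k * (k * n)) * √n` words,
and `m` is `k * n` times a degree of at least `k * √n`. -/
lemma parts_le (h : Regime c z n k s M p q S) :
    24 * (loadBound c n s * (copies n * (k * (k * n)))) ≤ M * s := by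
  have hn : (0 : ℝ) < n := by exact_mod_cast h.n_pos
  have hk : (1 : ℝ) ≤ k := by exact_mod_cast h.one_le_k
  have h1 := h.copies_le
  have h2 := h.loadBound_le_sqrt
  have h3 := h.le_log
  have h5 := h.degree_ge
  have h8 : ((24 * (loadBound c n s * (copies n * (k * (k * n)))) : ℕ) : ℝ) ≤ (M * s : ℕ) := by
    refine le_trans ?_ h.total_ge
    rw [edgeScale_eq]
    push_cast
    calc _ ≤ 24 * (3 * Real.sqrt n * (7 * Real.log n * (k * (k * n)))) := by gcongr
      _ = 504 * Real.log n * (k * n * (k * Real.sqrt n)) := by ring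
      _ ≤ (400 * 1 * Real.log n ^ 2) * (k * n * (k * Real.sqrt n)) :=
        mul_le_mul_of_nonneg_right (by nlinarith) (by positivity)
      _ = 400 * 1 * (k * n * (k * Real.sqrt n)) * Real.log n ^ 2 := by ring
      _ ≤ _ := by
        have := h.one_le_z
        gcongr
  exact_mod_cast h8

/-- The mean size of a group stays below its capacity by the factor `z`, as large deviation bounds
require. The factor `log ^ 2` in the space pays for the `O(log n)` copies and for slots of capacity
`O(log n)`. -/
lemma group_mean_le (h : Regime c z n k s M p q S) :
    z * (SBM.edgeScale n k p q * (1 / groupCount c n s M)) ≤ groupSize c n := by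
  have hL : 0 < groupSize c n := by have := h.two_le_groupSize; omega
  have hΛ : 0 < copies n := by have := h.two_le_copies; omega
  have h1 := le_two_mul_mul_div (by positivity) h.groups_le
  have hΓ : 0 < groupCount c n s M := Nat.div_pos h.groups_le (by positivity)
  change M * s ≤ _ * groupCount c n s M at h1
  have hΓ' : (0 : ℝ) < groupCount c n s M := by exact_mod_cast hΓ
  have h2 : ((M * s : ℕ) : ℝ) ≤ 2 * (16 * (copies n * groupSize c n ^ 2)) *
    groupCount c n s M := by exact_mod_cast h1
  have h3 := h.total_ge.trans h2
  have h4 := h.copies_le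
  have h5 := h.groupSize_le
  have h6 := h.le_log
  have h7 : (groupSize c n : ℝ) ≤ Real.log n := by
    have := h.c_le
    nlinarith
  rw [mul_one_div, ← mul_div_assoc, div_le_iff₀ hΓ']
  refine le_of_mul_le_mul_right ?_ (show 0 < 400 * Real.log n ^ 2 by positivity)
  calc z * SBM.edgeScale n k p q * (400 * Real.log n ^ 2)
      = 400 * z * SBM.edgeScale n k p q * Real.log n ^ 2 := by ring
    _ ≤ _ := h3
    _ = 32 * ((copies n : ℝ) * groupSize c n) * (groupSize c n * groupCount c n s M) := by ring
    _ ≤ 32 * (7 * Real.log n * Real.log n) * (groupSize c n * groupCount c n s M) := by gcongr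
    _ ≤ (400 * Real.log n ^ 2) * (groupSize c n * groupCount c n s M) :=
      mul_le_mul_of_nonneg_right (by nlinarith) (by positivity)
    _ = _ := by ring

/-- The same margin for the number of neighbours in a part. The number of parts was chosen so that
the grid fills a constant fraction of the space. -/
lemma part_mean_le (h : Regime c z n k s M p q S) :
    z * ((n * p + k * n * q) * (1 / (k * partCount c n k s M))) ≤ loadBound c n s := by
  have hn : (0 : ℝ) < n := by exact_mod_cast h.n_pos
  have hk : (0 : ℝ) < k := by exact_mod_cast h.one_le_k
  have hL : 0 < loadBound c n s := by
    have := h.two_le_groupSize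
    unfold loadBound; omega
  have hΛ : 0 < copies n := by have := h.two_le_copies; omega
  have hn' := h.n_pos
  have hk' : 0 < k := h.one_le_k
  have h1 := le_two_mul_mul_div (by positivity) h.parts_le
  have hR : 0 < partCount c n k s M := Nat.div_pos h.parts_le (by positivity)
  change M * s ≤ _ * partCount c n k s M at h1
  have hR' : (0 : ℝ) < partCount c n k s M := by exact_mod_cast hR
  have h2 : ((M * s : ℕ) : ℝ) ≤ 2 * (24 * (loadBound c n s * (copies n * (k * (k * n))))) *
    partCount c n k s M := by exact_mod_cast h1
  have h3 := h.total_ge.trans h2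
  have h4 := h.copies_le
  have h6 := h.le_log
  rw [edgeScale_eq] at h3
  rw [mul_one_div, ← mul_div_assoc, div_le_iff₀ (by positivity)]
  refine le_of_mul_le_mul_right ?_ (show 0 < 400 * Real.log n ^ 2 * (k * n) by positivity)
  calc z * (n * p + k * n * q) * (400 * Real.log n ^ 2 * (k * n))
      = 400 * z * (k * n * (n * p + k * n * q)) * Real.log n ^ 2 := by ring
    _ ≤ _ := h3
    _ = 48 * copies n * (loadBound c n s * (k * partCount c n k s M) * (k * n)) := by ring
    _ ≤ 48 * (7 * Real.log n) * (loadBound c n s * (k * partCount c n k s M) * (k * n)) := by gcongr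
    _ ≤ (400 * Real.log n ^ 2) * (loadBound c n s * (k * partCount c n k s M) * (k * n)) :=
      mul_le_mul_of_nonneg_right (by nlinarith) (by positivity)
    _ = _ := by ring

end Regime
end MPC

/-! ### The algorithm for several machines with these parameters -/

namespace MPC

/-- The algorithm for several machines, or another one if there are not enough of them. -/
noncomputable def manyMachines (c : ℝ) (n k s M : ℕ) (A : Algorithm M (k * n) k) :
    Algorithm M (k * n) k :=
  open Classical in
  if h : M ≠ 0 ∧ copies n ≠ 0 ∧ k * n ≠ 0 ∧ k ≠ 0 ∧ partCount c n k s M ≠ 0 ∧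
      groupCount c n s M ≠ 0 then
    haveI : NeZero M := ⟨h.1⟩
    haveI : NeZero (copies n) := ⟨h.2.1⟩
    haveI : NeZero (k * n) := ⟨h.2.2.1⟩
    haveI : NeZero k := ⟨h.2.2.2.1⟩
    haveI : NeZero (partCount c n k s M) := ⟨h.2.2.2.2.1⟩
    haveI : NeZero (groupCount c n s M) := ⟨h.2.2.2.2.2⟩
    clusterAlgorithm M (k * n) k (groupCount c n s M) (copies n) (groupSize c n)
      (partCount c n k s M) (maxValue n k) (fanOut s) (Nat.clog (fanOut s) (n ^ 10))
  else A

namespace Regime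

variable {c z : ℝ} {n k s M : ℕ} {p q S : ℝ}

lemma ne_zero (h : Regime c z n k s M p q S) : M ≠ 0 ∧ copies n ≠ 0 ∧ k * n ≠ 0 ∧ k ≠ 0 ∧
    partCount c n k s M ≠ 0 ∧ groupCount c n s M ≠ 0 := by
  have h1 := h.two_le_M
  have h2 := h.two_le_copies
  have h3 := h.one_le_k
  have h4 := h.n_pos
  have h5 := h.two_le_groupSize
  have h6 : 0 < loadBound c n s := by unfold loadBound; omega
  have h7 : 0 < copies n := by omega
  have h8 : 0 < groupSize c n := by omega
  exact ⟨by omega, by omega, (Nat.mul_pos h3 h4).ne', by omega,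
    (Nat.div_pos h.parts_le (by positivity)).ne', (Nat.div_pos h.groups_le (by positivity)).ne'⟩

lemma loads (h : Regime c z n k s M p q S) :
    groupSize c n * ((groupCount c n s M + copies n * (groupCount c n s M * groupSize c n)) / M + 1) +
      (2 * loadBound c n s + 1) * ((copies n * (k * (k * n)) * partCount c n k s M) / M + 1) ≤ s ∧
    4 * (groupSize c n * (groupCount c n s M + copies n * (groupCount c n s M * groupSize c n)) +
      (2 * loadBound c n s + 1) * (copies n * (k * (k * n)) * partCount c n k s M)) ≤ M * s ∧
    groupCount c n s M * groupSize c n ≤ M * (s / 2) :=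
  loads_le (L := groupSize c n) (Λ := copies n) (Γ := groupCount c n s M) (b := loadBound c n s)
    (K := k * (k * n)) (R := partCount c n k s M) (M := M) (s := s) (Nat.mul_div_le _ _)
    (Nat.mul_div_le _ _) (by have := h.two_le_groupSize; omega)
    (by have := h.two_le_copies; omega) (Nat.le_add_left _ _)
    (by have := h.two_le_M; omega) h.loadBound_le_mem

lemma mul_le_sq (h : Regime c z n k s M p q S) : k * n ≤ n ^ 2 := by
  rw [sq]
  exact Nat.mul_le_mul_right n h.k_le

lemma copies_mul_le (h : Regime c z n k s M p q S) : copies n * k ≤ n ^ 3 := by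
  have h1 : (copies n : ℝ) ≤ 7 * n := h.copies_le.trans (by gcongr; exact h.log_le)
  have h2 : copies n ≤ 7 * n := by exact_mod_cast h1
  have h3 := h.le_n
  calc copies n * k ≤ (7 * n) * n := Nat.mul_le_mul h2 h.k_le
    _ ≤ (n * n) * n := by gcongr; omega
    _ = n ^ 3 := by ring

lemma group_part_le (h : Regime c z n k s M p q S) :
    groupCount c n s M + (copies n * (groupCount c n s M * groupSize c n) +
      copies n * k * (k * n * partCount c n k s M)) ≤ n ^ 7 := by
  have h1 := h.loads.2.1.trans h.total_le_pow
  refine le_trans ?_ h1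
  have h2 := h.two_le_groupSize
  set X := groupCount c n s M + copies n * (groupCount c n s M * groupSize c n)
  set Y := copies n * (k * (k * n)) * partCount c n k s M
  have h3 : X ≤ groupSize c n * X := Nat.le_mul_of_pos_left _ (by omega)
  have h4 : Y ≤ (2 * loadBound c n s + 1) * Y := Nat.le_mul_of_pos_left _ (by omega)
  have h5 : copies n * k * (k * n * partCount c n k s M) = Y := by simp only [Y]; ring
  rw [← add_assoc, h5]
  change X + Y ≤ _
  omega

lemma partCount_mul_le (h : Regime c z n k s M p q S) :
    k * n * (k * partCount c n k s M) ≤ n ^ 7 := by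
  refine le_trans ?_ ((Nat.le_add_left _ _).trans ((Nat.le_add_left _ _).trans h.group_part_le))
  have := h.two_le_copies
  calc k * n * (k * partCount c n k s M) = 1 * k * (k * n * partCount c n k s M) := by ring
    _ ≤ _ := by gcongr; omega

lemma partCount_le (h : Regime c z n k s M p q S) : partCount c n k s M ≤ n ^ 7 := by
  refine le_trans ?_ h.partCount_mul_le
  have h3 := h.one_le_k
  have h4 := h.n_pos
  rw [← mul_assoc]
  exact Nat.le_mul_of_pos_left _ (by positivity)

lemma maxValue_lt (h : Regime c z n k s M p q S) : maxValue n k + 1 ≤ n ^ 5 := by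
  have h1 : (k * n) ^ 2 ≤ n ^ 4 := by
    calc (k * n) ^ 2 ≤ (n ^ 2) ^ 2 := Nat.pow_le_pow_left h.mul_le_sq 2
      _ = n ^ 4 := by ring
  have h2 := h.copies_mul_le
  have h3 := h.le_n
  have h4 : n ^ 3 ≤ n ^ 4 := Nat.pow_le_pow_right h.n_pos (by norm_num)
  have h5 : 1 ≤ n ^ 4 := Nat.one_le_pow _ _ h.n_pos
  have h6 : 3 * n ^ 4 ≤ n ^ 5 := by
    rw [pow_succ' n 4]
    gcongr
    omega
  unfold maxValue
  omega

/-- At most `n ^ 7` cells and `n ^ 16` tokens; this is where the word size `n ^ 23` comes from. -/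
lemma card_token_le (h : Regime c z n k s M p q S) :
    Fintype.card (Cell (k * n) k (groupCount c n s M) (copies n) (groupSize c n)
      (partCount c n k s M) × Token (k * n) k (partCount c n k s M) (maxValue n k)) ≤ n ^ 23 := by
  rw [Fintype.card_prod]
  have h0 := h.n_pos
  have h1 : Fintype.card (Cell (k * n) k (groupCount c n s M) (copies n) (groupSize c n)
      (partCount c n k s M)) ≤ n ^ 7 := by
    simp only [Fintype.card_sum, Fintype.card_prod, Fintype.card_fin]
    exact h.group_part_le
  have h2 : Fintype.card (Token (k * n) k (partCount c n k s M) (maxValue n k)) ≤ n ^ 16 := by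
    simp only [Fintype.card_sum, Fintype.card_prod, Fintype.card_fin]
    have e1 : k * n * (k * n * (k * partCount c n k s M)) ≤ n ^ 15 := by
      calc _ ≤ n ^ 2 * n ^ 7 := Nat.mul_le_mul h.mul_le_sq h.partCount_mul_le
        _ = n ^ 9 := by ring
        _ ≤ n ^ 15 := Nat.pow_le_pow_right h0 (by norm_num)
    have e2 : k * n ≤ n ^ 15 := h.mul_le_sq.trans (Nat.pow_le_pow_right h0 (by norm_num))
    have e3 := h.maxValue_lt
    have e4 : (maxValue n k + 1) * ((maxValue n k + 1) * (maxValue n k + 1)) ≤ n ^ 15 := by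
      calc _ ≤ n ^ 5 * (n ^ 5 * n ^ 5) := by gcongr
        _ = n ^ 15 := by ring
    have e5 : maxValue n k + 1 ≤ n ^ 15 := e3.trans (Nat.pow_le_pow_right h0 (by norm_num))
    have e6 : 4 * n ^ 15 ≤ n ^ 16 := by
      rw [pow_succ' n 15]
      gcongr
      have := h.le_n
      omega
    omega
  calc _ ≤ n ^ 7 * n ^ 16 := Nat.mul_le_mul h1 h2
    _ = n ^ 23 := by ring

/-- Since the capacities plus one are at least `c * log n`, the choice `y - 1 = 11 / c` gives
failure probabilities `n ^ (-11)` for at most `n ^ 7` events. With `6 * log n` copies and `n - 1 ≥ n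
/ 2`, a vertex lacks a centre with probability at most `n ^ (-3)`, and there are at most `n ^ 2`
vertices. -/
lemma failure_le (h : Regime c z n k s M p q S) {y : ℝ} (hy : y = 1 + 11 / c) :
    (groupCount c n s M * Real.exp (-((y - 1) * (groupSize c n + 1))) +
      (k * n * (k * partCount c n k s M) * Real.exp (-((y - 1) * (loadBound c n s + 1))) +
        k * ((k * n) ^ 2 * (2 / (n : ℝ) ^ 9)))) +
      k * n * Real.exp (-(copies n * k * (n - 1) / (k * n))) ≤ 5 / n := by
  have hn : (0 : ℝ) < n := by exact_mod_cast h.n_pos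
  have hn1 : (1 : ℝ) ≤ n := by exact_mod_cast h.n_pos
  have hk : (0 : ℝ) < k := by exact_mod_cast h.one_le_k
  have hkn : (k : ℝ) ≤ n := by exact_mod_cast h.k_le
  have hc := h.c_pos
  have hlog := h.one_le_log
  have hexp : Real.exp (-(11 * Real.log n)) = 1 / (n : ℝ) ^ 11 := by
    rw [Real.exp_neg, show (11 : ℝ) = (11 : ℕ) by norm_num, ← Real.log_pow,
      Real.exp_log (by positivity), one_div]
  have hpow : (n : ℝ) ^ 7 * (1 / (n : ℝ) ^ 11) ≤ 1 / n := by
    rw [mul_one_div, div_le_div_iff₀ (by positivity) hn]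
    calc (n : ℝ) ^ 7 * n = (n : ℝ) ^ 8 := by ring
      _ ≤ 1 * (n : ℝ) ^ 11 := by
        rw [one_mul]
        exact pow_le_pow_right₀ hn1 (by norm_num)
  have hL := h.le_groupSize
  have e0 : ∀ X : ℝ, (groupSize c n : ℝ) + 1 ≤ X →
      Real.exp (-((y - 1) * X)) ≤ 1 / (n : ℝ) ^ 11 := by
    intro X hX
    rw [← hexp]
    refine Real.exp_le_exp.2 (neg_le_neg ?_)
    rw [hy, add_sub_cancel_left]
    calc 11 * Real.log n = 11 / c * (c * Real.log n) := by field_simp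
      _ ≤ _ := by gcongr; linarith
  have e1 : groupCount c n s M * Real.exp (-((y - 1) * (groupSize c n + 1))) ≤ 1 / n := by
    refine le_trans ?_ hpow
    have : (groupCount c n s M : ℝ) ≤ (n : ℝ) ^ 7 := by
      exact_mod_cast (Nat.le_add_right _ _).trans h.group_part_le
    gcongr
    exact e0 _ le_rfl
  have e2 : k * n * (k * partCount c n k s M) *
      Real.exp (-((y - 1) * (loadBound c n s + 1))) ≤ 1 / n := by
    refine le_trans ?_ hpow
    have : (k : ℝ) * n * (k * partCount c n k s M) ≤ (n : ℝ) ^ 7 := by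
      exact_mod_cast h.partCount_mul_le
    gcongr
    refine e0 _ ?_
    unfold loadBound
    push_cast
    have := Nat.cast_nonneg (α := ℝ) (fanOut s)
    linarith
  have e3 : k * ((k * n) ^ 2 * (2 / (n : ℝ) ^ 9)) ≤ 2 / n := by
    calc k * ((k * n) ^ 2 * (2 / (n : ℝ) ^ 9)) ≤ n * ((n * n) ^ 2 * (2 / (n : ℝ) ^ 9)) := by gcongr
      _ = 2 / (n : ℝ) ^ 4 := by field_simp
      _ ≤ 2 / n := by
        gcongr
        exact le_self_pow₀ hn1 (by norm_num)
  have e4 : k * n * Real.exp (-(copies n * k * (n - 1) / (k * n))) ≤ 1 / n := by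
    have h1 : Real.exp (-(copies n * k * (n - 1) / (k * n))) ≤ 1 / (n : ℝ) ^ 3 := by
      have h2 : Real.exp (-(3 * Real.log n)) = 1 / (n : ℝ) ^ 3 := by
        rw [Real.exp_neg, show (3 : ℝ) = (3 : ℕ) by norm_num, ← Real.log_pow,
          Real.exp_log (by positivity), one_div]
      rw [← h2]
      refine Real.exp_le_exp.2 (neg_le_neg ?_)
      have h3 := h.le_copies
      rw [le_div_iff₀ (by positivity)]
      have h4 : (2 : ℝ) ≤ n := by
        have := h.le_n
        exact_mod_cast (by omega : 2 ≤ n)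
      calc 3 * Real.log n * (k * n) = 6 * Real.log n * k * (n / 2) := by ring
        _ ≤ copies n * k * (n - 1) := by gcongr; linarith
    calc k * n * Real.exp (-(copies n * k * (n - 1) / (k * n))) ≤ n * n * (1 / (n : ℝ) ^ 3) := by
          gcongr
      _ = 1 / n := by field_simp
  have : 5 / (n : ℝ) = 1 / n + (1 / n + 2 / n) + 1 / n := by ring
  rw [this]
  linarith

lemma manyMachines_spec (h : Regime c z n k s M p q S) (hz : z = Real.exp (1 + 11 / c))
    (A : Algorithm M (k * n) k) :
    ((manyMachines c n k s M A).rounds : ℝ) ≤ 7510 * Real.logb s n ∧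
    ∀ σ : Fin (k * n) → Fin k, SBM.IsBalanced n k σ →
      ∀ D : SimpleGraph (Fin (k * n)) → Placement M (k * n),
      (∀ G, (∃ P : Placement M (k * n), IsPlacement s G P) → IsPlacement s G (D G)) →
      1 - 5 / n ≤ successProb (manyMachines c n k s M A) (n ^ 23) s S p q σ D := by
  have hne := h.ne_zero
  have : NeZero M := ⟨hne.1⟩
  have : NeZero (copies n) := ⟨hne.2.1⟩
  have : NeZero (k * n) := ⟨hne.2.2.1⟩
  have : NeZero k := ⟨hne.2.2.2.1⟩
  have : NeZero (partCount c n k s M) := ⟨hne.2.2.2.2.1⟩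
  have : NeZero (groupCount c n s M) := ⟨hne.2.2.2.2.2⟩
  have hA : manyMachines c n k s M A = clusterAlgorithm M (k * n) k (groupCount c n s M) (copies n)
      (groupSize c n) (partCount c n k s M) (maxValue n k) (fanOut s)
      (Nat.clog (fanOut s) (n ^ 10)) := dif_pos hne
  have hn0 := h.n_pos
  have hn2 : 2 ≤ n := by have := h.le_n; omega
  have hs10 : s ≤ n ^ 10 := h.mem_le_pow.trans (Nat.pow_le_pow_right hn0 (by norm_num))
  have hf := h.two_le_fanOut
  have hD : n ^ 10 ≤ fanOut s ^ Nat.clog (fanOut s) (n ^ 10) := Nat.le_pow_clog (by omega) _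
  rw [hA]
  constructor
  · refine le_trans (le_of_eq ?_) (clog_fanOut_le hn2 h.le_mem hs10)
    change ((4 + (program (T := copies n * k) (N := k * n) (R := partCount c n k s M) (k = 1)
      (maxValue n k) (fanOut s) (Nat.clog (fanOut s) (n ^ 10))).length + 1 : ℕ) : ℝ) = _
    rw [length_program]
    congr 1
    ring
  · intro σ hσ Dist hDist
    have hy : 0 < 1 + 11 / c := by have := h.c_pos; positivity
    have hm1 := h.group_mean_le
    have hm2 := h.part_mean_le
    rw [hz] at hm1 hm2
    have hle := h.failure_le (y := 1 + 11 / c) rfl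
    have hloads := h.loads
    rw [show copies n * (k * (k * n)) * partCount c n k s M =
      copies n * k * (k * n * partCount c n k s M) by ring] at hloads
    refine le_trans ?_ (le_successProb_cluster h.signal hσ hn0 Dist hDist hy hm1 hm2
      (h.mul_le_sq.trans (Nat.pow_le_pow_right hn0 (by norm_num))) h.card_token_le hloads.2.2
      hloads.1 ?_ h.copies_le_sq h.two_le_copies h.two_le_groupSize (by omega)
      (Nat.le_add_right _ _) ?_ (Nat.le_add_left _ _) ?_ ?_ ?_ ?_)
    · linarith
    · have h1 := h.total_le_four_mul
      have h2 : (4 * (groupSize c n * (groupCount c n s M + copies n *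
        (groupCount c n s M * groupSize c n)) + (2 * loadBound c n s + 1) *
          (copies n * k * (k * n * partCount c n k s M))) : ℕ) ≤ ((M * s : ℕ) : ℝ) := by
        exact_mod_cast hloads.2.1
      push_cast at h2 ⊢
      linarith
    · exact (Nat.le_self_pow (by norm_num) _).trans (Nat.le_add_right _ _)
    · refine Nat.clog_pos (by omega) ?_
      calc 2 ≤ n := hn2
        _ ≤ n ^ 10 := Nat.le_self_pow (by norm_num) n
    · exact h.copies_mul_le.trans ((Nat.pow_le_pow_right hn0 (by norm_num)).trans hD)
    · exact h.mul_le_sq.trans ((Nat.pow_le_pow_right hn0 (by norm_num)).trans hD)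
    · exact h.partCount_le.trans ((Nat.pow_le_pow_right hn0 (by norm_num)).trans hD)

end Regime
end MPC

/-! ### Clustering on a single machine -/

namespace SBM
open Finset

/-- A balanced partition into the classes of vertices with many common neighbours. -/
def IsThreshold {n k : ℕ} (f : Fin (k * n) → Fin (k * n) → ℝ) (ℓ : Fin (k * n) → Fin k) : Prop :=
  IsBalanced n k ℓ ∧ ∃ θ : ℝ, ∀ u v, u ≠ v → (ℓ u = ℓ v ↔ θ ≤ f u v)

lemma isThreshold_of_separates {n k : ℕ} {f : Fin (k * n) → Fin (k * n) → ℝ}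
    {σ : Fin (k * n) → Fin k} (hσ : IsBalanced n k σ) {h Δ : ℝ} (hΔ : 0 < Δ)
    (hf : Separates σ h Δ f) : IsThreshold f σ := by
  refine ⟨hσ, h + Δ / 2, fun u v huv => ⟨fun e => ?_, fun e => ?_⟩⟩
  · linarith [((hf u v huv).1 e).1]
  · by_contra hne
    linarith [((hf u v huv).2 hne).2]

/-- A class contained in a class of the same size equals it. -/
lemma eq_iff_of_refines {n k : ℕ} {ℓ σ : Fin (k * n) → Fin k} (hℓ : IsBalanced n k ℓ)
    (hσ : IsBalanced n k σ) (h : ∀ u v, ℓ u = ℓ v → σ u = σ v) (u v : Fin (k * n)) :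
    ℓ u = ℓ v ↔ σ u = σ v := by
  refine ⟨h u v, fun e => ?_⟩
  have h1 : (univ.filter fun w => ℓ w = ℓ v) ⊆ univ.filter fun w => σ w = σ v := by
    intro w hw
    exact mem_filter.2 ⟨mem_univ _, h w v (mem_filter.1 hw).2⟩
  have h2 := eq_of_subset_of_card_le h1 (by rw [hℓ, hσ])
  have h3 : u ∈ univ.filter fun w => ℓ w = ℓ v := by
    rw [h2]
    exact mem_filter.2 ⟨mem_univ _, e⟩
  exact (mem_filter.1 h3).2

/-- The partition with the larger threshold refines the other one, and both are balanced. Hence any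
partition that the search finds is the hidden one, without knowledge of the threshold. -/
lemma IsThreshold.eq_iff {n k : ℕ} {f : Fin (k * n) → Fin (k * n) → ℝ}
    {ℓ σ : Fin (k * n) → Fin k} (hℓ : IsThreshold f ℓ) (hσ : IsThreshold f σ)
    (u v : Fin (k * n)) : ℓ u = ℓ v ↔ σ u = σ v := by
  obtain ⟨hℓ, θ, h1⟩ := hℓ
  obtain ⟨hσ, θ', h2⟩ := hσ
  rcases le_total θ θ' with h | h
  · refine (eq_iff_of_refines hσ hℓ (fun u v e => ?_) u v).symm
    by_cases huv : u = v
    · rw [huv]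
    · exact (h1 u v huv).2 (h.trans ((h2 u v huv).1 e))
  · refine eq_iff_of_refines hℓ hσ (fun u v e => ?_) u v
    by_cases huv : u = v
    · rw [huv]
    · exact (h2 u v huv).2 (h.trans ((h1 u v huv).1 e))

end SBM

namespace MPC
open Finset

/-- The graph that an input memory stands for. -/
def decodeGraph (N : ℕ) (mem : List ℕ) : SimpleGraph (Fin N) :=
  SimpleGraph.fromEdgeSet {x | ∃ e ∈ decodeEdges N mem, s(e.1, e.2) = x}

/-- The numbers of common neighbours. -/
noncomputable def commonNeighbours {N : ℕ} (G : SimpleGraph (Fin N)) : Fin N → Fin N → ℝ :=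
  SBM.codeg (univ : Finset Unit) G fun _ => ()

open Classical in
/-- The algorithm that clusters the vertices on a single machine. -/
noncomputable def localAlgorithm (M n k : ℕ) : Algorithm M (k * n) k where
  rounds := 0
  coinBound := 0
  step _ _ _ _ := ([], [])
  output _ mem := if h : ∃ ℓ, SBM.IsThreshold (commonNeighbours (decodeGraph (k * n) mem)) ℓ then
    (List.finRange (k * n)).map fun v => (v, h.choose v) else []

lemma decodeGraph_input {N s : ℕ} {G : SimpleGraph (Fin N)} {P : Placement 1 N}
    (h : IsPlacement s G P) : decodeGraph N (input P 0) = G := by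
  classical
  have h1 : {x | ∃ e ∈ P 0, s(e.1, e.2) = x} = G.edgeSet := by
    ext x
    have h2 : x ∈ (allEdges P).map (fun e => s(e.1, e.2)) ↔ x ∈ G.edgeSet := by
      rw [map_allEdges h, Finset.mem_val, SimpleGraph.mem_edgeFinset]
    rw [← h2, Multiset.mem_map]
    simp [allEdges]
  rw [decodeGraph, input, decodeEdges_flatMap, h1, SimpleGraph.fromEdgeSet_edgeSet]

lemma succeeds_local {n k W s : ℕ} {S : ℝ} {σ : Fin (k * n) → Fin k}
    {G : SimpleGraph (Fin (k * n))} {P : Placement 1 (k * n)} (hP : IsPlacement s G P)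
    (hNW : k * n ≤ W) (hNs : k * n ≤ s) (hPS : ((2 * (P 0).length : ℕ) : ℝ) ≤ S)
    (hσ : SBM.IsThreshold (commonNeighbours G) σ) (ω : (localAlgorithm 1 n k).Coins) :
    Succeeds (localAlgorithm 1 n k) W s S σ P ω := by
  classical
  have hconf : ∀ t, t ≤ (localAlgorithm 1 n k).rounds →
      (localAlgorithm 1 n k).config ω (input P) t = input P := by
    intro t ht
    rw [Nat.le_zero.1 (show t ≤ 0 from ht)]
    rfl
  have hlen : ∀ i, (input P i).length = 2 * (P i).length := by
    intro i
    simp [input, mul_comm]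
  have hex : ∃ ℓ, SBM.IsThreshold (commonNeighbours (decodeGraph (k * n) (input P 0))) ℓ := by
    rw [decodeGraph_input hP]
    exact ⟨σ, hσ⟩
  have hout : ∀ i, (localAlgorithm 1 n k).output i ((localAlgorithm 1 n k).config ω (input P)
      (localAlgorithm 1 n k).rounds i) =
      (List.finRange (k * n)).map fun v => (v, hex.choose v) := by
    intro i
    rw [hconf _ le_rfl, Subsingleton.elim i 0]
    exact dif_pos hex
  have hσ' : SBM.IsThreshold (commonNeighbours (decodeGraph (k * n) (input P 0))) σ := by
    rw [decodeGraph_input hP]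
    exact hσ
  refine ⟨?_, ?_, fun t => t.elim0, ?_, ?_, hex.choose, ?_, hex.choose_spec.eq_iff hσ'⟩
  · intro t ht i w hw
    rw [hconf t ht] at hw
    obtain ⟨e, _, hw⟩ := List.mem_flatMap.1 hw
    have : w < k * n := by
      simp only [List.mem_cons, List.not_mem_nil, or_false] at hw
      rcases hw with rfl | rfl
      · exact e.1.2
      · exact e.2.2
    omega
  · intro t ht i
    rw [hconf t ht, hlen]
    exact hP.2 i
  · intro t ht
    rw [hconf t ht, Fin.sum_univ_one, hlen]
    exact hPS
  · intro i
    rw [hout]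
    simpa using hNs
  · intro v x
    simp only [hout, List.mem_map, List.mem_finRange, true_and, Prod.mk.injEq]
    constructor
    · rintro ⟨_, v', rfl, h⟩
      exact h
    · intro h
      exact ⟨0, v, rfl, h⟩

lemma equidistributed_unit {α : Type*} [Fintype α] (Φ : α → Unit) : Equidistributed Φ := by
  intro y y'
  rfl

/-- The algorithm for a single machine succeeds with large probability. -/
lemma le_successProb_local {n k s : ℕ} {p q S : ℝ} (hs : SBM.Signal n k p q)
    {σ : Fin (k * n) → Fin k} (hσ : SBM.IsBalanced n k σ) (hn : 1 ≤ n) (hk : 1 ≤ k) {W : ℕ}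
    (hNW : k * n ≤ W) (hNs : k * n ≤ s) (hSs : S ≤ s)
    (D : SimpleGraph (Fin (k * n)) → Placement 1 (k * n))
    (hD : ∀ G, (∃ P : Placement 1 (k * n), IsPlacement s G P) → IsPlacement s G (D G)) (K : ℕ)
    (hK : Real.exp 2 * SBM.edgeScale n k p q ≤ K) (hKS : 2 * (K : ℝ) ≤ S) :
    1 - (Real.exp (-K) + (k * n) ^ 2 * (2 / (n : ℝ) ^ 9)) ≤
      successProb (localAlgorithm 1 n k) W s S p q σ D := by
  classical
  have hq := hs.q_pos.le
  have hqp := hs.q_lt_p.le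
  have hp := hs.p_lt_one.le
  have hn0 : (0 : ℝ) < n := by exact_mod_cast hn
  -- With labels in `Unit` there is no subsampling, so the general estimates apply with `r = 1`.
  let E : SimpleGraph (Fin (k * n)) → (Sym2 (Fin (k * n)) → Unit) → Prop := fun G ℓ =>
    K ≤ (G.edgeFinset.filter fun e => ℓ e ∈ (univ : Finset Unit)).card ∨
    ¬ SBM.Separates σ ((1 : ℝ) ^ 2 * (k * n * q ^ 2 + 2 * (p - q) * q * n))
      ((1 : ℝ) ^ 2 * ((p - q) ^ 2 * n)) (SBM.codeg univ G ℓ)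
  have hE : SBM.prob p q σ E ≤ Real.exp (-K) + (k * n) ^ 2 * (2 / (n : ℝ) ^ 9) := by
    refine (SBM.prob_or_le hq hqp hp _ _).trans (add_le_add ?_ ?_)
    · refine ((SBM.prob_mono hq hqp hp fun G ℓ h => ?_).trans
        (SBM.prob_edges_le hs hσ (univ : Finset Unit) 2 (by norm_num) K (by simpa using hK))).trans
        (le_of_eq (by congr 1; ring))
      refine h.trans (le_of_eq ?_)
      congr!
    · refine SBM.prob_not_separates_le hs hσ hn hk univ (by simp) ?_
      rw [one_mul]
      exact_mod_cast hk
  have hmain := le_successProb (localAlgorithm 1 n k) W s hq hqp hp σ D (Y := Unit) (Z := Unit)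
    (S := S) (fun _ _ _ => ()) (fun _ => ()) (fun G => fun y y' => by
      rw [Subsingleton.elim y y']) (equidistributed_unit _) E (fun _ => False) ?_
  · simp only [filter_false, card_empty, Nat.cast_zero, zero_div, sub_zero] at hmain
    exact (sub_le_sub_left hE 1).trans hmain
  · intro G ω hG _
    simp only [E, not_or, not_le, not_not] at hG
    obtain ⟨h1, h2⟩ := hG
    have h3 : G.edgeFinset.card < K := by
      refine lt_of_le_of_lt (le_of_eq ?_) h1
      simp
    have h4 : 2 * G.edgeFinset.card ≤ s := by
      have : (2 * G.edgeFinset.card : ℝ) ≤ s := by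
        have : (G.edgeFinset.card : ℝ) ≤ K := by exact_mod_cast h3.le
        linarith
      exact_mod_cast this
    have hP := hD G (exists_isPlacement G (by omega))
    refine ⟨hP, succeeds_local hP hNW hNs ?_ (SBM.isThreshold_of_separates hσ ?_ h2) ω⟩
    · have h5 : (D G 0).length = G.edgeFinset.card := by
        rw [Finset.card_def, ← map_allEdges hP, Multiset.card_map, allEdges]
        simp
      rw [h5]
      have : (G.edgeFinset.card : ℝ) ≤ K := by exact_mod_cast h3.le
      push_cast
      linarith
    · have := sub_pos.2 hs.q_lt_p
      positivity

end MPC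

/-! ### Assembling the theorem -/

namespace MPC

/-- The whole graph fits into the machine, since it has fewer than about `exp 2 * m` edges except
with probability at most `1 / n`; here `m ≥ n ≥ log n` is used. -/
lemma le_successProb_one_machine {n k s : ℕ} {p q S z : ℝ} (hs : SBM.Signal n k p q)
    (hk : 1 ≤ k) (hlog : 2 ≤ Real.log n) (hz : Real.exp 2 ≤ z)
    (hS : S = 400 * z * SBM.edgeScale n k p q * Real.log (k * n) ^ 2) (hSs : S ≤ s)
    {σ : Fin (k * n) → Fin k} (hσ : SBM.IsBalanced n k σ)
    (D : SimpleGraph (Fin (k * n)) → Placement 1 (k * n))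
    (hD : ∀ G, (∃ P : Placement 1 (k * n), IsPlacement s G P) → IsPlacement s G (D G)) :
    1 - 5 / n ≤ successProb (localAlgorithm 1 n k) (n ^ 23) s S p q σ D := by
  have hn : 1 ≤ n := by
    rcases Nat.eq_zero_or_pos n with rfl | h0
    · norm_num at hlog
    · exact h0
  have hn0 : (0 : ℝ) < n := by exact_mod_cast hn
  have hn1 : (1 : ℝ) ≤ n := by exact_mod_cast hn
  have hk1 : (1 : ℝ) ≤ k := by exact_mod_cast hk
  have hk0 : (0 : ℝ) < k := by linarith
  have hkn := hs.le_of_signal (by linarith)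
  have hkn' : (k : ℝ) ≤ n := by exact_mod_cast hkn
  have hp : 0 < p := hs.q_pos.trans hs.q_lt_p
  have hq := hs.q_pos
  set m := SBM.edgeScale n k p q with hm
  have hm1 : (k : ℝ) * n ≤ m := by
    have h1 := hs.mul_sqrt_le hk (by linarith)
    have h2 : (1 : ℝ) ≤ Real.sqrt n := Real.one_le_sqrt.2 hn1
    have h3 : 1 ≤ n * p + k * n * q := by
      have : 0 ≤ (k : ℝ) * n * q := by positivity
      nlinarith
    calc (k : ℝ) * n = k * n * 1 := by ring
      _ ≤ k * n * (n * p + k * n * q) := by gcongr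
      _ = m := by rw [hm]; unfold SBM.edgeScale; ring
  have hn_m : (n : ℝ) ≤ m := le_trans (by nlinarith) hm1
  have hm0 : 1 ≤ m := hn1.trans hn_m
  have hlogkn : Real.log n ≤ Real.log (k * n) := Real.log_le_log hn0 (by nlinarith)
  have hz1 : 1 ≤ z := (Real.one_le_exp (by norm_num)).trans hz
  have hSm : 400 * z * m ≤ S := by
    rw [hS]
    have : 1 ≤ Real.log (k * n) ^ 2 := one_le_pow₀ (by linarith)
    exact le_mul_of_one_le_right (by positivity) this
  set K := ⌈Real.exp 2 * m⌉₊ with hK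
  have hK1 : Real.exp 2 * m ≤ K := Nat.le_ceil _
  have hK2 : (K : ℝ) < Real.exp 2 * m + 1 := Nat.ceil_lt_add_one (by positivity)
  have hez : Real.exp 2 * m ≤ z * m := by gcongr
  have hzm : 1 ≤ z * m := by nlinarith
  have hNs : k * n ≤ s := by
    have : (k : ℝ) * n ≤ s := by nlinarith
    exact_mod_cast this
  have hNW : k * n ≤ n ^ 23 := by
    calc k * n ≤ n * n := Nat.mul_le_mul_right n hkn
      _ = n ^ 2 := by ring
      _ ≤ n ^ 23 := Nat.pow_le_pow_right hn (by norm_num)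
  refine le_trans ?_ (le_successProb_local hs hσ hn hk hNW hNs hSs D hD K hK1 (by linarith))
  have h1 : Real.exp (-K) ≤ 1 / n := by
    have h2 : Real.log n ≤ K := by
      have h3 := Real.log_le_sub_one_of_pos hn0
      have h4 : 1 ≤ Real.exp 2 := Real.one_le_exp (by norm_num)
      nlinarith
    calc Real.exp (-K) ≤ Real.exp (-Real.log n) := Real.exp_le_exp.2 (neg_le_neg h2)
      _ = 1 / n := by rw [Real.exp_neg, Real.exp_log hn0, one_div]
  have h2 : ((k : ℝ) * n) ^ 2 * (2 / (n : ℝ) ^ 9) ≤ 2 / n := by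
    calc ((k : ℝ) * n) ^ 2 * (2 / (n : ℝ) ^ 9) ≤ (n * n) ^ 2 * (2 / (n : ℝ) ^ 9) := by gcongr
      _ = 2 / (n : ℝ) ^ 5 := by field_simp
      _ ≤ 2 / n := by
        gcongr
        exact le_self_pow₀ hn1 (by norm_num)
  have h3 : 5 / (n : ℝ) = 1 / n + 2 / n + 2 / n := by ring
  have h4 : 0 ≤ 2 / (n : ℝ) := by positivity
  linarith

/-- The value of `log n` from which on the algorithms work. -/
noncomputable def logThreshold (c : ℝ) : ℝ :=
  2 ^ 21 / c + 28 / c ^ 2 + 40000 * Real.exp (1 + 11 / c)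

open Classical in
/-- The clustering algorithm, for an arbitrary number of machines. -/
noncomputable def sbmAlgorithm (c : ℝ) (n k s M : ℕ) : Algorithm M (k * n) k :=
  if M ≤ 1 ∨ Real.log n < logThreshold c then localAlgorithm M n k
  else manyMachines c n k s M (localAlgorithm M n k)

end MPC

theorem theorem3 :
    ∃ C₀ : ℝ, 0 < C₀ ∧
    -- `s ≥ c₀ log n` for an arbitrary constant `c₀`
    ∀ c₀ : ℝ, 0 < c₀ →
    -- constants in the word length, the total space, the rounds and the failure probability
    ∃ (a b : ℕ) (Cspace Crounds Cprob : ℝ), 0 < Cspace ∧ 0 < Crounds ∧ 0 < Cprob ∧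
    -- the algorithm knows neither `p, q` nor the hidden partition
    ∃ A : (n k s M : ℕ) → MPC.Algorithm M (k * n) k,
    ∀ (n k s : ℕ) (p q S : ℝ),
      1 ≤ n → 1 ≤ k → 0 < q → q < p → p < 1 →
      C₀ * ((k : ℝ) ^ (3 / 4 : ℝ) * (n : ℝ) ^ (-(1 / 4) : ℝ) * Real.log n ^ (1 / 4 : ℝ)) ≤
        (p - q) / Real.sqrt p →
      2 ≤ s → c₀ * Real.log n ≤ s →
      -- the total space `S`, and any number `M` of machines that provides it
      S = Cspace * SBM.edgeScale n k p q * Real.log (k * n) ^ b →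
      ∀ M : ℕ, S ≤ M * s → (M : ℝ) * s ≤ 2 * S + s →
      ((A n k s M).rounds : ℝ) ≤ Crounds * Real.logb s n ∧
      ∀ σ : Fin (k * n) → Fin k, SBM.IsBalanced n k σ →
      -- an arbitrary distribution of the edges over the machines
      ∀ D : SimpleGraph (Fin (k * n)) → MPC.Placement M (k * n),
      (∀ G, (∃ P : MPC.Placement M (k * n), MPC.IsPlacement s G P) → MPC.IsPlacement s G (D G)) →
      1 - Cprob / n ≤ MPC.successProb (A n k s M) (n ^ a) s S p q σ D := by
  -- The fourth power of this constant is the `10000` of `SBM.Signal`.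
  refine ⟨10, by norm_num, fun c₀ hc₀ => ?_⟩
  -- Groups of `c * log n` edges occupy at most a hundredth of the memory of a machine; the minimum
  -- ensures `c ≤ 1 / 100`.
  set c : ℝ := min c₀ 1 / 100 with hc
  have hc0 : 0 < c := by positivity
  have hc1 : c ≤ 1 / 100 := by
    rw [hc]
    gcongr
    exact min_le_right _ _
  have hcc : 100 * c ≤ c₀ := by
    have := min_le_left c₀ 1
    rw [hc]
    linarith
  set z := Real.exp (1 + 11 / c) with hz
  have hz2 : Real.exp 2 ≤ z := by
    refine Real.exp_le_exp.2 ?_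
    have : 1 ≤ 11 / c := by
      rw [le_div_iff₀ hc0]
      linarith
    linarith
  have hz1 : 1 ≤ z := (Real.one_le_exp (by norm_num)).trans hz2
  have hT : 2 ≤ MPC.logThreshold c := by
    have h1 : 0 ≤ 2 ^ 21 / c := by positivity
    have h2 : 0 ≤ 28 / c ^ 2 := by positivity
    unfold MPC.logThreshold
    linarith
  -- The first summand of the last constant makes the probability bound nonpositive for all `n`
  -- below the threshold; the `5` is the failure bound above it.
  refine ⟨23, 2, 400 * z, 7510, Real.exp (MPC.logThreshold c) + 5, by positivity, by norm_num,
    by positivity, fun n k s M => MPC.sbmAlgorithm c n k s M, ?_⟩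
  intro n k s p q S hn hk hq hqp hp hsig hs hcs hS M hSM hMS
  have hn0 : (0 : ℝ) < n := by exact_mod_cast hn
  have hn1 : (1 : ℝ) ≤ n := by exact_mod_cast hn
  have hs1 : (1 : ℝ) < s := by exact_mod_cast hs
  have hlogb : 0 ≤ Real.logb s n := Real.logb_nonneg hs1 hn1
  have hpos : 0 ≤ Real.exp (MPC.logThreshold c) / n := by positivity
  rcases lt_or_ge (Real.log n) (MPC.logThreshold c) with hsmall | hlarge
  · have hA : MPC.sbmAlgorithm c n k s M = MPC.localAlgorithm M n k := if_pos (Or.inr hsmall)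
    simp only [hA]
    refine ⟨?_, fun σ _ D _ => ?_⟩
    · change ((0 : ℕ) : ℝ) ≤ _
      rw [Nat.cast_zero]
      positivity
    · refine le_trans ?_ (MPC.successProb_nonneg _ _ _ hq.le hqp.le hp.le σ D)
      have h1 : (n : ℝ) ≤ Real.exp (MPC.logThreshold c) :=
        ((Real.log_lt_iff_lt_exp hn0).1 hsmall).le
      rw [sub_nonpos, le_div_iff₀ hn0]
      linarith
  have hsignal := SBM.signal_of_le (by linarith) hk hq hqp hp hsig
  have hsplit : 1 - (Real.exp (MPC.logThreshold c) + 5) / n ≤ 1 - 5 / (n : ℝ) := by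
    rw [add_div]
    linarith
  -- Without machines there would be no space, but `S > 0`.
  have hM0 : M ≠ 0 := by
    rintro rfl
    have hk0 : (0 : ℝ) < k := by exact_mod_cast hk
    have hp0 : 0 < p := hq.trans hqp
    have hm : 0 < SBM.edgeScale n k p q := by unfold SBM.edgeScale; positivity
    have hk1 : (1 : ℝ) ≤ k := by exact_mod_cast hk
    have hl : 0 < Real.log (k * n) :=
      lt_of_lt_of_le (by linarith) (Real.log_le_log hn0 (by nlinarith))
    have : 0 < S := by rw [hS]; positivity
    simp at hSM
    linarith
  by_cases hM : M ≤ 1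
  · obtain rfl : M = 1 := by omega
    have hA : MPC.sbmAlgorithm c n k s 1 = MPC.localAlgorithm 1 n k := if_pos (Or.inl le_rfl)
    simp only [hA]
    refine ⟨?_, fun σ hσ D hD => hsplit.trans ?_⟩
    · change ((0 : ℕ) : ℝ) ≤ _
      rw [Nat.cast_zero]
      positivity
    · exact MPC.le_successProb_one_machine hsignal hk (by linarith) hz2 hS (by simpa using hSM) hσ
        D hD
  · have hA : MPC.sbmAlgorithm c n k s M =
        MPC.manyMachines c n k s M (MPC.localAlgorithm M n k) :=
      if_neg (by
        rintro (h | h)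
        · exact hM h
        · linarith)
    have hreg : MPC.Regime c z n k s M p q S :=
      ⟨hc0, hc1, hz1, hsignal, hk, by omega, hlarge,
        le_trans (mul_le_mul_of_nonneg_right hcc (by linarith)) hcs, hS, hSM, hMS⟩
    obtain ⟨h1, h2⟩ := hreg.manyMachines_spec hz (MPC.localAlgorithm M n k)
    simp only [hA]
    exact ⟨h1, fun σ hσ D hD => hsplit.trans (h2 σ hσ D hD)⟩
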